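/- Let $H_n$ be the real vector space of $n\times n$ complex Hermitian matrices, with the inner product $\langle x,y\rangle=\operatorname{tr}(xy)$ and the associated Euclidean (Lebesgue) measure $m_n$. For $\mu>0$ let $\mathbb P_{n,\mu}$ be the probability measure on $H_n$ given by $$\mathbb P_{n,\mu}(dx)=\frac1{C_{n,\mu}}\,|\det x|^{2\mu}e^{-\operatorname{tr}(x^2)}\,m_n(dx),\qquad C_{n,\mu}=\int_{H_n}|\det x|^{2\mu}e^{-\operatorname{tr}(x^2)}\,m_n(dx).$$ Let $(\mu_n)_{n\ge1}$ be a sequence of positive real numbers such that $\mu_n/n\to c$ for some real constant $c$ (so $c\ge0$), and put $b=\sqrt{1+c+\sqrt{1+2c}}$. Let $(X_n)_{n\ge1}$ be random Hermitian matrices defined on the same probability space, such that $X_n$ has law $\mathbb P_{n,\mu_n}$ on $H_n$ for every $n\ge1$; no assumption is made on their joint law. Let $\lambda_{\max}(x)$ and $\lambda_{\min}(x)$ denote the largest and the smallest eigenvalue of $x\in H_n$. Then, as $n\to\infty$, $$\frac{\lambda_{\max}(X_n)}{\sqrt n}\to b\quad\text{almost surely}\qquad\text{and}\qquad \frac{\lambda_{\min}(X_n)}{\sqrt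 n}\to-b\quad\text{almost surely}.$$ -/

import Mathlib

open MeasureTheory ProbabilityTheory Filter
open scoped Topology ENNReal

noncomputable section

/-- The real vector space `Herm(n, ℂ)` of `n × n` complex Hermitian matrices. It is a type of its
own, so that the Euclidean structure given below is the only norm and topology on it. -/
def Herm (n : ℕ) : Type := selfAdjoint (Matrix (Fin n) (Fin n) ℂ)

namespace Herm

variable {n : ℕ}

instance : AddCommGroup (Herm n) :=
  inferInstanceAs (AddCommGroup (selfAdjoint (Matrix (Fin n) (Fin n) ℂ)))

instance : Module ℝ (Herm n) :=
  inferInstanceAs (Module ℝ (selfAdjoint (Matrix (Fin n) (Fin n) ℂ)))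

/-- The underlying matrix. -/
def toMatrix (x : Herm n) : Matrix (Fin n) (Fin n) ℂ := Subtype.val x

theorem isHermitian (x : Herm n) : x.toMatrix.IsHermitian := Subtype.property x

/-- The underlying matrix, as a real-linear map. -/
def toMatrixLin (n : ℕ) : Herm n →ₗ[ℝ] Matrix (Fin n) (Fin n) ℂ where
  toFun := toMatrix
  map_add' _ _ := rfl
  map_smul' _ _ := rfl

theorem toMatrix_injective : Function.Injective (toMatrix (n := n)) := Subtype.val_injective

instance : FiniteDimensional ℝ (Herm n) :=
  Module.Finite.of_injective (toMatrixLin n) toMatrix_injective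

theorem re_trace_mul_self (x : Herm n) :
    (x.toMatrix * x.toMatrix).trace.re = ∑ i, ∑ j, ‖x.toMatrix i j‖ ^ 2 := by
  have h : x.toMatrix * x.toMatrix = x.toMatrix * x.toMatrix.conjTranspose := by
    rw [x.isHermitian.eq]
  rw [h]
  simp [Matrix.trace, Matrix.mul_apply, Complex.mul_conj, Complex.normSq_eq_norm_sq]
  norm_cast

/-- The inner product `⟨x, y⟩ = tr (x y)` (a real number for Hermitian `x`, `y`). -/
abbrev innerCore (n : ℕ) : InnerProductSpace.Core ℝ (Herm n) where
  inner x y := (x.toMatrix * y.toMatrix).trace.re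
  conj_inner_symm x y := by
    simp [Matrix.trace_mul_comm x.toMatrix y.toMatrix]
  re_inner_nonneg x := by
    simp only [re_trace_mul_self, RCLike.re_to_real]
    positivity
  add_left x y z := by
    change ((x.toMatrix + y.toMatrix) * z.toMatrix).trace.re = _
    simp [add_mul]
  smul_left x y r := by
    change ((r • x.toMatrix) * y.toMatrix).trace.re = _
    simp
  definite x h := by
    rw [re_trace_mul_self] at h
    apply toMatrix_injective
    ext i j
    change x.toMatrix i j = 0
    have h1 := (Finset.sum_eq_zero_iff_of_nonneg (fun i _ => by positivity)).1 h i
      (Finset.mem_univ i)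
    have h2 := (Finset.sum_eq_zero_iff_of_nonneg (fun j _ => by positivity)).1 h1 j
      (Finset.mem_univ j)
    simpa using h2

instance : NormedAddCommGroup (Herm n) := (innerCore n).toNormedAddCommGroup

instance : InnerProductSpace ℝ (Herm n) := InnerProductSpace.ofCore (innerCore n).toCore

instance : MeasurableSpace (Herm n) := borel (Herm n)

instance : BorelSpace (Herm n) := ⟨rfl⟩

/-- The largest eigenvalue. -/
def lambdaMax (x : Herm n) : ℝ := ⨆ i, x.isHermitian.eigenvalues i

/-- The smallest eigenvalue. -/
def lambdaMin (x : Herm n) : ℝ := ⨅ i, x.isHermitian.eigenvalues i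

/-- The unnormalized density `|det x|^{2μ} exp (-tr (x²))`. -/
def weight (μ : ℝ) (x : Herm n) : ℝ≥0∞ :=
  ENNReal.ofReal (‖x.toMatrix.det‖ ^ (2 * μ) * Real.exp (-(x.toMatrix * x.toMatrix).trace.re))

/-- The law `P_{n,μ} (dx) = C⁻¹ |det x|^{2μ} exp (-tr (x²)) m (dx)`, with `C` the normalizing
constant and `m = volume` the Euclidean measure of the inner product `tr (x y)`. -/
def ensemble (n : ℕ) (μ : ℝ) : Measure (Herm n) :=
  (∫⁻ x : Herm n, weight μ x)⁻¹ • (volume : Measure (Herm n)).withDensity (weight μ)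

end Herm

end

/-! The eigenvalues of a matrix with law `Herm.ensemble n μ` form an orthogonal polynomial ensemble
for the even weight `|s|^{2μ} exp(-s²)`. Its Jacobi matrix has zero diagonal and off-diagonal
entries `√((k + 2μ [k odd]) / 2)`. Near the index `k = n`, with `μ ≈ cn`, two consecutive entries
add up to about `√n (√((1 + 2c) / 2) + √(1 / 2)) = b √n`, and this local row sum locates the edge of
the spectrum.

No kernel asymptotics are needed. For a polynomial `g ≥ 0`, the expectation of `∏ g(λ_i)` is the
determinant of the positive semidefinite matrix `G` of multiplication by `g`, compressed to the
first `n` orthonormal polynomials. Since `λ ≤ exp(λ - 1)`, this determinant is at most `exp(tr(G -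
1))`, so only the diagonal elements `hermiteDiag` matter (`Herm.integral_prod_eval_le`). For `g =
(rs + R)^{2m}` such an element is the squared norm of a row of the `m`-th power of `R + rJ`, which
is bounded on both sides by powers of local row sums (`hermiteDiag_pow_le`, `le_hermiteDiag_pow`).
Markov's inequality and Borel-Cantelli then give almost sure statements, whatever the joint law.

Outer bound (`ae_eventually_abs_eigs_lt`): with `g = 1 + n² (s / (T√n))^{2⌊n/q⌋}`, `T > b`, one
eigenvalue outside makes the product at least `1 + n²`, while its expectation stays bounded. Inner
bound (`ae_eventually_exists_eigs`): with `g = (1 - δ((s/√n + R)^{2m} - K))²` the product is at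
least 1 when no eigenvalue exceeds `T√n`, `T < b`, and none lies below `-R√n`. Its expectation
decays exponentially, because a positive fraction of the indices `k < n` carries mass near the edge.
Reflection handles the other side.

The passage from matrices to eigenvalues avoids the change of variables of Weyl's formula. Hermitian
matrices with density 1 and `ℝⁿ` with the squared Vandermonde satisfy the same Gaussian loop
equations, which determine all symmetric polynomial moments up to a constant. Homogeneity turns
Gaussian integrals into integrals over the unit ball, where `|det|^{2μ}` is a uniform limit of
polynomials in the determinant (`IsSpectralModel.weighted_comm`). -/

/-! ### Gaussian integrals on Euclidean spaces: integration by parts and homogeneity -/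

section GaussianIntegrals

variable {E : Type*} [NormedAddCommGroup E] [InnerProductSpace ℝ E] [FiniteDimensional ℝ E]
  [MeasurableSpace E] [BorelSpace E]

theorem integrable_exp_neg_mul_norm_sq {b : ℝ} (hb : 0 < b) :
    Integrable (fun x : E => Real.exp (-b * ‖x‖ ^ 2)) := by
  have h := GaussianFourier.integrable_cexp_neg_mul_sq_norm_add (V := E) (b := (b : ℂ))
    (by simpa using hb) 0 0
  refine (h.re).congr (ae_of_all _ fun x => ?_)
  simp only [zero_mul, add_zero]
  rw [show (-(b : ℂ) * (‖x‖ : ℂ) ^ 2) = ((-b * ‖x‖ ^ 2 : ℝ) : ℂ) by push_cast; ring]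
  exact Complex.exp_ofReal_re _

/-- Polynomial growth is integrable against the Gaussian weight. -/
theorem integrable_mul_gaussian {G : E → ℝ} (hG : Continuous G) {C : ℝ} {m : ℕ}
    (hb : ∀ x, |G x| ≤ C * (1 + ‖x‖) ^ m) :
    Integrable (fun x : E => G x * Real.exp (-‖x‖ ^ 2)) := by
  have hC : 0 ≤ C := by
    have := (abs_nonneg _).trans (hb 0)
    simpa using this
  -- `K` comes from `(1 + ‖x‖)^m ≤ m! exp(1 + ‖x‖)` and `1 + ‖x‖ ≤ 2 + ‖x‖² / 2`; half of the
  -- Gaussian exponent pays for the polynomial.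
  set K : ℝ := C * (m.factorial * Real.exp 1 * Real.exp 1) with hK
  refine Integrable.mono' ((integrable_exp_neg_mul_norm_sq (E := E) (b := 1 / 2)
    (by norm_num)).const_mul K) (by fun_prop) (ae_of_all _ fun x => ?_)
  have h1 : (1 + ‖x‖) ^ m ≤ m.factorial * Real.exp (1 + ‖x‖) := by
    have := Real.pow_div_factorial_le_exp (1 + ‖x‖) (by positivity) m
    rw [div_le_iff₀ (by positivity)] at this
    linarith
  have h2 : Real.exp (1 + ‖x‖) ≤ Real.exp 1 * Real.exp 1 * Real.exp (1 / 2 * ‖x‖ ^ 2) := by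
    rw [← Real.exp_add, ← Real.exp_add]
    apply Real.exp_le_exp.2
    nlinarith [sq_nonneg (‖x‖ - 1)]
  rw [Real.norm_eq_abs, abs_mul, abs_of_pos (Real.exp_pos _)]
  have h3 : Real.exp (-(1 / 2) * ‖x‖ ^ 2)
      = Real.exp (1 / 2 * ‖x‖ ^ 2) * Real.exp (-‖x‖ ^ 2) := by
    rw [← Real.exp_add]; ring_nf
  rw [h3, hK]
  calc |G x| * Real.exp (-‖x‖ ^ 2) ≤ (C * (m.factorial *
        (Real.exp 1 * Real.exp 1 * Real.exp (1 / 2 * ‖x‖ ^ 2)))) * Real.exp (-‖x‖ ^ 2) := by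
        gcongr
        exact (hb x).trans (by gcongr; exact h1.trans (by gcongr))
    _ = _ := by ring

theorem Function.HasTemperateGrowth.integrable_gaussian {G : E → ℝ} (hG : G.HasTemperateGrowth) :
    Integrable (fun x : E => G x * Real.exp (-‖x‖ ^ 2)) := by
  obtain ⟨m, C, h⟩ := hG.2 0
  exact integrable_mul_gaussian hG.1.continuous (C := C) (m := m) (by simpa using h)

theorem Function.HasTemperateGrowth.fderiv_apply {E : Type*} [NormedAddCommGroup E]
    [InnerProductSpace ℝ E] {G : E → ℝ} (hG : G.HasTemperateGrowth) (e : E) :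
    (fun x => fderiv ℝ G x e).HasTemperateGrowth := by
  have h : (fderiv ℝ G).HasTemperateGrowth := by
    refine ⟨hG.1.fderiv_right (by simp), fun n => ?_⟩
    obtain ⟨k, C, h⟩ := hG.2 (n + 1)
    refine ⟨k, C, fun x => ?_⟩
    rw [norm_iteratedFDeriv_fderiv]
    exact h x
  exact (ContinuousLinearMap.hasTemperateGrowth
    (ContinuousLinearMap.apply ℝ ℝ e)).comp h

/-- Gaussian integration by parts along a vector. -/
theorem integral_fderiv_mul_gaussian {G : E → ℝ} (hG : G.HasTemperateGrowth) (e : E) :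
    ∫ x, fderiv ℝ G x e * Real.exp (-‖x‖ ^ 2)
      = ∫ x, (2 * inner ℝ x e * G x) * Real.exp (-‖x‖ ^ 2) := by
  have hd : ∀ x : E, HasFDerivAt (fun x : E => Real.exp (-‖x‖ ^ 2))
      (Real.exp (-‖x‖ ^ 2) • (-((2 : ℕ) • (innerSL ℝ x : E →L[ℝ] ℝ)))) x := by
    intro x
    exact ((hasStrictFDerivAt_norm_sq x).hasFDerivAt.neg).exp
  have hd' : ∀ x : E, fderiv ℝ (fun x : E => Real.exp (-‖x‖ ^ 2)) x e
      = - (2 * inner ℝ x e) * Real.exp (-‖x‖ ^ 2) := by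
    intro x
    rw [(hd x).fderiv]
    simp; ring
  have hin : (fun x : E => 2 * inner ℝ x e * G x).HasTemperateGrowth :=
    ((Function.HasTemperateGrowth.const (2 : ℝ)).mul
      (Function.hasTemperateGrowth_inner_left e)).mul hG
  have key := integral_mul_fderiv_eq_neg_fderiv_mul_of_integrable (μ := (volume : Measure E))
    (f := G) (g := fun x : E => Real.exp (-‖x‖ ^ 2)) (v := e)
    (hG.fderiv_apply e).integrable_gaussian
    (by
      simp_rw [hd']
      refine (hin.integrable_gaussian.neg).congr (ae_of_all _ fun x => ?_)
      simp; ring)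
    hG.integrable_gaussian
    (fun x _ => hG.1.differentiable (by simp) x)
    (fun x _ => (hd x).differentiableAt)
  rw [← neg_eq_iff_eq_neg] at key
  rw [← key, ← integral_neg]
  refine integral_congr_ae (ae_of_all _ fun x => ?_)
  simp only [hd']
  ring

/-- Gaussian divergence theorem for the vector field `F • V`. -/
theorem integral_divergence_mul_gaussian {ι : Type*} [Fintype ι] (e : OrthonormalBasis ι ℝ E)
    {F : E → ℝ} {V : E → E} (hF : F.HasTemperateGrowth)
    (hV : ∀ a, (fun x => inner ℝ (e a) (V x)).HasTemperateGrowth) :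
    ∫ x, ((∑ a, fderiv ℝ (fun y => inner ℝ (e a) (V y)) x (e a)) * F x + fderiv ℝ F x (V x))
        * Real.exp (-‖x‖ ^ 2)
      = ∫ x, (2 * inner ℝ x (V x) * F x) * Real.exp (-‖x‖ ^ 2) := by
  have h1 : ∀ x, ((∑ a, fderiv ℝ (fun y => inner ℝ (e a) (V y)) x (e a)) * F x
      + fderiv ℝ F x (V x)) * Real.exp (-‖x‖ ^ 2)
      = ∑ a, fderiv ℝ (fun y => inner ℝ (e a) (V y) * F y) x (e a) * Real.exp (-‖x‖ ^ 2) := by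
    intro x
    rw [← Finset.sum_mul]
    congr 1
    have h2 : fderiv ℝ F x (V x) = ∑ a, inner ℝ (e a) (V x) * fderiv ℝ F x (e a) := by
      conv_lhs => rw [← e.sum_repr' (V x)]
      simp
    rw [h2, Finset.sum_mul, ← Finset.sum_add_distrib]
    refine Finset.sum_congr rfl fun a _ => ?_
    have hd := ((hV a).1.differentiable (by simp) x).hasFDerivAt.mul
      (hF.1.differentiable (by simp) x).hasFDerivAt
    erw [hd.fderiv]
    simp; ring
  have h3 : ∀ x, (2 * inner ℝ x (V x) * F x) * Real.exp (-‖x‖ ^ 2)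
      = ∑ a, (2 * inner ℝ x (e a) * (inner ℝ (e a) (V x) * F x)) * Real.exp (-‖x‖ ^ 2) := by
    intro x
    rw [← e.sum_inner_mul_inner x (V x), Finset.mul_sum, Finset.sum_mul, Finset.sum_mul]
    exact Finset.sum_congr rfl fun a _ => by ring
  have hT : ∀ a, (fun y => inner ℝ (e a) (V y) * F y).HasTemperateGrowth := fun a => (hV a).mul hF
  simp_rw [h1, h3]
  rw [integral_finsetSum, integral_finsetSum]
  · exact Finset.sum_congr rfl fun a _ => integral_fderiv_mul_gaussian (hT a) (e a)
  · intro a _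
    exact (((Function.HasTemperateGrowth.const (2 : ℝ)).mul
      (Function.hasTemperateGrowth_inner_left (e a))).mul (hT a)).integrable_gaussian
  · intro a _
    exact ((hT a).fderiv_apply (e a)).integrable_gaussian

/-- Substituting `√s • x` for `x` contributes `√s ^ dim` from the volume and `√s ^ d` from `G`. -/
theorem setIntegral_ball_of_homogeneous {G : E → ℝ} {d : ℝ}
    (hd : ∀ r : ℝ, 0 < r → ∀ x, G (r • x) = r ^ d * G x) {s : ℝ} (hs : 0 < s) :
    ∫ x in {x : E | ‖x‖ ^ 2 < s}, G x
      = s ^ ((Module.finrank ℝ E + d) / 2) * ∫ x in {x : E | ‖x‖ ^ 2 < 1}, G x := by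
  have hq : 0 < √s := Real.sqrt_pos.2 hs
  have hm : ∀ t : ℝ, MeasurableSet {x : E | ‖x‖ ^ 2 < t} := fun t =>
    (isOpen_lt (by fun_prop) continuous_const).measurableSet
  rw [← integral_indicator (hm s), ← integral_indicator (hm 1)]
  have h := Measure.integral_comp_smul (volume : Measure E)
    (fun x => Set.indicator {x : E | ‖x‖ ^ 2 < s} G x) (√s)
  have h2 : ∀ x, Set.indicator {x : E | ‖x‖ ^ 2 < s} G (√s • x)
      = √s ^ d * Set.indicator {x : E | ‖x‖ ^ 2 < 1} G x := by
    intro x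
    have : (√s • x ∈ {x : E | ‖x‖ ^ 2 < s}) ↔ x ∈ {x : E | ‖x‖ ^ 2 < 1} := by
      simp only [Set.mem_ofPred_eq, norm_smul, mul_pow, Real.norm_eq_abs, sq_abs, Real.sq_sqrt hs.le]
      constructor <;> intro h <;> nlinarith
    by_cases hx : x ∈ {x : E | ‖x‖ ^ 2 < 1}
    · rw [Set.indicator_of_mem hx, Set.indicator_of_mem (this.2 hx), hd _ hq]
    · rw [Set.indicator_of_notMem hx, Set.indicator_of_notMem (fun h => hx (this.1 h)), mul_zero]
  simp_rw [h2] at h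
  rw [integral_const_mul, smul_eq_mul, abs_of_pos (by positivity)] at h
  have h4 : s ^ ((Module.finrank ℝ E + d) / 2) = √s ^ (Module.finrank ℝ E) * √s ^ d := by
    rw [← Real.rpow_natCast, ← Real.rpow_add hq, Real.sqrt_eq_rpow, ← Real.rpow_mul hs.le]
    ring_nf
  rw [h4, mul_assoc, h]
  field_simp

/-- The Gaussian integral of a homogeneous function in terms of its integral over the ball. -/
theorem integral_gaussian_of_homogeneous {G : E → ℝ} {d : ℝ} (hG : Continuous G)
    (hd : ∀ r : ℝ, 0 < r → ∀ x, G (r • x) = r ^ d * G x)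
    (hGint : Integrable (fun x : E => G x * Real.exp (-‖x‖ ^ 2))) :
    ∫ x, G x * Real.exp (-‖x‖ ^ 2)
      = (∫ s in Set.Ioi (0 : ℝ), Real.exp (-s) * s ^ ((Module.finrank ℝ E + d) / 2))
        * ∫ x in {x : E | ‖x‖ ^ 2 < 1}, G x := by
  have hm : ∀ t : ℝ, MeasurableSet {x : E | ‖x‖ ^ 2 < t} := fun t =>
    (isOpen_lt (by fun_prop) continuous_const).measurableSet
  -- Layer-cake argument: `exp(-‖x‖²)` is the integral of `exp(-s)` over `s > ‖x‖²`, so the Gaussian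
  -- integral is an average over `s` of integrals over balls of radius `√s`, by Fubini.
  set S : Set (E × ℝ) := {p | ‖p.1‖ ^ 2 < p.2} with hS
  have hSm : MeasurableSet S := (isOpen_lt (by fun_prop) (by fun_prop)).measurableSet
  set H : E × ℝ → ℝ := S.indicator (fun p => G p.1 * Real.exp (-p.2)) with hH
  have hx : ∀ x : E, (fun s => H (x, s))
      = (Set.Ioi (‖x‖ ^ 2)).indicator (fun s => G x * Real.exp (-s)) := by
    intro x; ext s
    simp [hH, hS, Set.indicator]
  have hs : ∀ s : ℝ, (fun x => H (x, s))
      = {x : E | ‖x‖ ^ 2 < s}.indicator (fun x => G x * Real.exp (-s)) := by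
    intro s; ext x
    simp [hH, hS, Set.indicator]
  have hHm : AEStronglyMeasurable H ((volume : Measure E).prod (volume : Measure ℝ)) := by
    refine (AEStronglyMeasurable.indicator ?_ hSm)
    fun_prop
  have hHint : Integrable H ((volume : Measure E).prod (volume : Measure ℝ)) := by
    rw [integrable_prod_iff hHm]
    refine ⟨ae_of_all _ fun x => ?_, ?_⟩
    · rw [hx, integrable_indicator_iff measurableSet_Ioi]
      exact (integrableOn_exp_neg_Ioi _).const_mul _
    · refine hGint.norm.congr (ae_of_all _ fun x => ?_)
      have : (fun s => ‖H (x, s)‖)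
          = (Set.Ioi (‖x‖ ^ 2)).indicator (fun s => |G x| * Real.exp (-s)) := by
        ext s
        rw [show H (x, s) = (fun s => H (x, s)) s from rfl, hx]
        simp only [Set.indicator]
        split_ifs <;> simp
      simp only [this]
      rw [integral_indicator measurableSet_Ioi, integral_const_mul, integral_exp_neg_Ioi]
      simp
  have hsw := integral_integral_swap (f := fun x s => H (x, s)) hHint
  have h1 : ∀ x, ∫ s, H (x, s) = G x * Real.exp (-‖x‖ ^ 2) := by
    intro x
    rw [hx, integral_indicator measurableSet_Ioi, integral_const_mul, integral_exp_neg_Ioi]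
  have h2 : ∀ s, ∫ x, H (x, s) = (Set.Ioi (0 : ℝ)).indicator (fun s =>
      (Real.exp (-s) * s ^ ((Module.finrank ℝ E + d) / 2))
        * ∫ x in {x : E | ‖x‖ ^ 2 < 1}, G x) s := by
    intro s
    rw [hs, integral_indicator (hm s), integral_mul_const]
    by_cases h0 : 0 < s
    · rw [Set.indicator_of_mem (by exact h0), setIntegral_ball_of_homogeneous hd h0]
      ring
    · have : {x : E | ‖x‖ ^ 2 < s} = ∅ := by
        ext x
        simp only [Set.mem_ofPred_eq, Set.mem_empty_iff_false, iff_false, not_lt]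
        push Not at h0
        exact h0.trans (by positivity)
      rw [Set.indicator_of_notMem (by exact h0), this]
      simp
  simp_rw [h1, h2] at hsw
  rw [hsw, integral_indicator measurableSet_Ioi, integral_mul_const]

theorem integral_exp_neg_mul_rpow_pos {a : ℝ} (ha : 0 ≤ a) :
    0 < ∫ s in Set.Ioi (0 : ℝ), Real.exp (-s) * s ^ a := by
  have := Real.Gamma_eq_integral (s := a + 1) (by linarith)
  rw [add_sub_cancel_right] at this
  rw [← this]
  exact Real.Gamma_pos_of_pos (by linarith)

/-- A continuous homogeneous function has polynomial growth. -/
theorem integrable_gaussian_of_homogeneous {G : E → ℝ} {d : ℝ} (hG : Continuous G)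
    (hd : ∀ r : ℝ, 0 < r → ∀ x, G (r • x) = r ^ d * G x) :
    Integrable (fun x : E => G x * Real.exp (-‖x‖ ^ 2)) := by
  obtain ⟨C, hC⟩ := (isCompact_closedBall (0 : E) 1).exists_bound_of_continuousOn hG.continuousOn
  obtain ⟨m, hm⟩ := exists_nat_ge d
  have hC0 : 0 ≤ C := (norm_nonneg _).trans (hC 0 (by simp))
  refine integrable_mul_gaussian hG (C := C) (m := m) fun x => ?_
  set r := 1 + ‖x‖ with hr
  have hr1 : 1 ≤ r := by simp [hr]
  have hr0 : 0 < r := by linarith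
  have : G x = r ^ d * G (r⁻¹ • x) := by
    rw [← hd r hr0, smul_inv_smul₀ hr0.ne']
  rw [this, abs_mul, abs_of_pos (by positivity), mul_comm]
  have h2 : |G (r⁻¹ • x)| ≤ C := by
    apply hC
    rw [mem_closedBall_zero_iff, norm_smul, norm_inv, Real.norm_eq_abs, abs_of_pos hr0]
    rw [inv_mul_le_one₀ hr0]
    linarith
  have h3 : r ^ d ≤ r ^ m := by
    rw [← Real.rpow_natCast]
    exact Real.rpow_le_rpow_of_exponent_le hr1 hm
  gcongr

end GaussianIntegrals

/-! ### Symmetric polynomials, power sums and loop equations -/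

section PowerSums

/-- The power sum `∑ i, l i ^ k`. -/
def powerSum {n : ℕ} (k : ℕ) (l : Fin n → ℝ) : ℝ := ∑ i, l i ^ k

/-- The product of the power sums with exponents in a list. -/
def powerSumProd {n : ℕ} (L : List ℕ) (l : Fin n → ℝ) : ℝ := (L.map fun k => powerSum k l).prod

@[simp] theorem powerSumProd_nil {n : ℕ} (l : Fin n → ℝ) : powerSumProd [] l = 1 := rfl

@[simp] theorem powerSumProd_cons {n : ℕ} (k : ℕ) (L : List ℕ) (l : Fin n → ℝ) :
    powerSumProd (k :: L) l = powerSum k l * powerSumProd L l := by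
  simp [powerSumProd]

theorem powerSum_zero {n : ℕ} (l : Fin n → ℝ) : powerSum 0 l = n := by simp [powerSum]

theorem eval_psum {n : ℕ} (k : ℕ) (l : Fin n → ℝ) :
    MvPolynomial.eval l (MvPolynomial.psum (Fin n) ℝ k) = powerSum k l := by
  simp [MvPolynomial.psum, powerSum]

/-- Newton's identities express `k e_k` through power sums and smaller `e_j`; over `ℝ` one may
divide by `k`. -/
theorem esymm_mem_adjoin_psum (n k : ℕ) : MvPolynomial.esymm (Fin n) ℝ k ∈
    Algebra.adjoin ℝ (Set.range (MvPolynomial.psum (Fin n) ℝ)) := by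
  induction k using Nat.strong_induction_on with
  | _ k ih =>
    rcases Nat.eq_zero_or_pos k with rfl | hk
    · rw [MvPolynomial.esymm_zero]; exact one_mem _
    · have h := MvPolynomial.mul_esymm_eq_sum (Fin n) ℝ k
      have h2 : MvPolynomial.esymm (Fin n) ℝ k
          = (k : ℝ)⁻¹ • ((k : MvPolynomial (Fin n) ℝ) * MvPolynomial.esymm (Fin n) ℝ k) := by
        rw [← nsmul_eq_mul, ← Nat.cast_smul_eq_nsmul ℝ, smul_smul, inv_mul_cancel₀ (by positivity),
          one_smul]
      rw [h2, h]
      refine Subalgebra.smul_mem _ (mul_mem (pow_mem (neg_mem (one_mem _)) _)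
        (sum_mem fun a ha => mul_mem (mul_mem (pow_mem (neg_mem (one_mem _)) _) ?_) ?_)) _
      · exact ih _ (Finset.mem_filter.1 ha).2
      · exact Algebra.subset_adjoin ⟨_, rfl⟩

/-- Symmetric polynomials are linear combinations of products of power sums. -/
theorem MvPolynomial.IsSymmetric.mem_span_psum {n : ℕ} {S : MvPolynomial (Fin n) ℝ}
    (hS : S.IsSymmetric) : S ∈ Submodule.span ℝ
      (Set.range fun L : List ℕ => (L.map (MvPolynomial.psum (Fin n) ℝ)).prod) := by
  have h1 : S ∈ Algebra.adjoin ℝ (Set.range (MvPolynomial.psum (Fin n) ℝ)) := by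
    obtain ⟨q, hq⟩ := MvPolynomial.esymmAlgHom_surjective (σ := Fin n) ℝ (n := n) (by simp)
      ⟨S, hS⟩
    have h2 := MvPolynomial.esymmAlgHom_apply (σ := Fin n) (R := ℝ) (n := n) q
    rw [hq] at h2
    change S = _ at h2
    rw [h2]
    clear h2 hq
    induction q using MvPolynomial.induction_on with
    | C a =>
      rw [MvPolynomial.aeval_C]
      exact Subalgebra.algebraMap_mem _ a
    | add p q hp hq =>
      rw [map_add]
      exact add_mem hp hq
    | mul_X p i hp =>
      rw [map_mul, MvPolynomial.aeval_X]
      exact mul_mem hp (esymm_mem_adjoin_psum n _)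
  rw [← Subalgebra.mem_toSubmodule, Algebra.adjoin_eq_span] at h1
  refine Submodule.span_mono ?_ h1
  intro x hx
  obtain ⟨l, hl, rfl⟩ := Submonoid.exists_list_of_mem_closure hx
  clear hx h1
  induction l with
  | nil => exact ⟨[], rfl⟩
  | cons a l ih =>
    obtain ⟨k, rfl⟩ := hl a (by simp)
    obtain ⟨L, hL⟩ := ih fun y hy => hl y (by simp [hy])
    exact ⟨k :: L, by simp only [List.map_cons, List.prod_cons]; rw [← hL]⟩

theorem eval_psum_prod {n : ℕ} (L : List ℕ) (l : Fin n → ℝ) :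
    MvPolynomial.eval l (L.map (MvPolynomial.psum (Fin n) ℝ)).prod = powerSumProd L l := by
  induction L with
  | nil => simp
  | cons a L ih => simp [ih, eval_psum]

/-- The derivative of a product of power sums along the vector field `l i ^ k`, as a formal linear
combination of products of power sums. -/
def powerSumDeriv (k : ℕ) : List ℕ → List (ℕ × List ℕ)
  | [] => []
  | l :: L => (l, (k + l - 1) :: L) :: (powerSumDeriv k L).map fun q => (q.1, l :: q.2)

/-- The degree drop is what makes the loop equations a recursion. The alternative `q.1 = 0` covers
the exponent 0, where the truncated subtraction `k + l - 1` may be wrong but the coefficient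
vanishes. -/
theorem degree_powerSumDeriv (k : ℕ) (L : List ℕ) :
    ∀ q ∈ powerSumDeriv k L, q.1 = 0 ∨ q.2.sum + 1 = k + L.sum := by
  induction L with
  | nil => simp [powerSumDeriv]
  | cons l L ih =>
    intro q hq
    simp only [powerSumDeriv, List.mem_cons, List.mem_map] at hq
    rcases hq with rfl | ⟨q', hq', rfl⟩
    · rcases Nat.eq_zero_or_pos l with h | h
      · exact Or.inl h
      · right; simp; omega
    · rcases ih q' hq' with h | h
      · exact Or.inl h
      · right; simp; omega

/-- The loop equations for a functional on formal products of power sums. -/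
structure SatisfiesLoopEquations (n : ℕ) (W : List ℕ → ℝ) : Prop where
  zero_cons : ∀ L, W (0 :: L) = n * W L
  succ_cons : ∀ k L, 2 * W ((k + 1) :: L) = (∑ j ∈ Finset.range k, W (j :: (k - 1 - j) :: L))
    + ((powerSumDeriv k L).map fun q => (q.1 : ℝ) * W q.2).sum

/-- The loop equations determine the functional up to a constant. -/
theorem SatisfiesLoopEquations.proportional {n : ℕ} {W₁ W₂ : List ℕ → ℝ}
    (h₁ : SatisfiesLoopEquations n W₁) (h₂ : SatisfiesLoopEquations n W₂) (L : List ℕ) :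
    W₁ L * W₂ [] = W₂ L * W₁ [] := by
  obtain ⟨d, hd⟩ : ∃ d, L.sum = d := ⟨_, rfl⟩
  -- Every term on the right of `succ_cons` with nonzero coefficient has total degree two less than
  -- the left side. Leading zeros do not change the degree and are removed by the inner induction on
  -- the list.
  induction d using Nat.strong_induction_on generalizing L with
  | _ d ih =>
    induction L with
    | nil => ring
    | cons a L ihL =>
      cases a with
      | zero =>
        have := ihL (by simpa using hd)
        rw [h₁.zero_cons, h₂.zero_cons, mul_assoc, mul_assoc, this]
      | succ k =>
        have e1 := h₁.succ_cons k L
        have e2 := h₂.succ_cons k L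
        simp only [List.sum_cons] at hd
        have s1 : (∑ j ∈ Finset.range k, W₁ (j :: (k - 1 - j) :: L)) * W₂ []
            = (∑ j ∈ Finset.range k, W₂ (j :: (k - 1 - j) :: L)) * W₁ [] := by
          rw [Finset.sum_mul, Finset.sum_mul]
          refine Finset.sum_congr rfl fun j hj => ?_
          rw [Finset.mem_range] at hj
          refine ih _ ?_ _ rfl
          simp only [List.sum_cons]
          omega
        have s2 : ((powerSumDeriv k L).map fun q => (q.1 : ℝ) * W₁ q.2).sum * W₂ []
            = ((powerSumDeriv k L).map fun q => (q.1 : ℝ) * W₂ q.2).sum * W₁ [] := by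
          rw [← List.sum_map_mul_right, ← List.sum_map_mul_right]
          congr 1
          refine List.map_congr_left fun q hq => ?_
          rcases degree_powerSumDeriv k L q hq with h | h
          · simp [h]
          · rw [mul_assoc, mul_assoc, ih _ (by omega) q.2 rfl]
        have : (2 * W₁ ((k + 1) :: L)) * W₂ [] = (2 * W₂ ((k + 1) :: L)) * W₁ [] := by
          rw [e1, e2, add_mul, add_mul, s1, s2]
        linarith

end PowerSums

/-! ### Spectral models and their loop equations -/

section SpectralModels

variable {E : Type*} [NormedAddCommGroup E] [InnerProductSpace ℝ E] [FiniteDimensional ℝ E]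
  [MeasurableSpace E] [BorelSpace E] {n : ℕ}

/-- A Euclidean space with an `n`-tuple of eigenvalues `ev` at each point, and a homogeneous
density `D` satisfying the Gaussian loop equations. -/
structure IsSpectralModel (ev : E → Fin n → ℝ) (D : E → ℝ) : Prop where
  psum_temperate : ∀ k, (fun x => powerSum k (ev x)).HasTemperateGrowth
  density_temperate : D.HasTemperateGrowth
  density_nonneg : ∀ x, 0 ≤ D x
  norm_sq : ∀ x, ‖x‖ ^ 2 = powerSum 2 (ev x)
  psum_smul : ∀ k (r : ℝ), 0 < r → ∀ x, powerSum k (ev (r • x)) = r ^ k * powerSum k (ev x)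
  prod_smul : ∀ r : ℝ, 0 < r → ∀ x, ∏ i, ev (r • x) i = r ^ n * ∏ i, ev x i
  density_smul : ∃ d : ℕ, Module.finrank ℝ E + d = n ^ 2 ∧
    ∀ r : ℝ, 0 < r → ∀ x, D (r • x) = r ^ d * D x
  loop : SatisfiesLoopEquations n fun L =>
    ∫ x, powerSumProd L (ev x) * D x * Real.exp (-‖x‖ ^ 2)

theorem powerSumProd_hasTemperateGrowth {E : Type*} [NormedAddCommGroup E] [NormedSpace ℝ E]
    {ev : E → Fin n → ℝ}
    (h : ∀ k, (fun x => powerSum k (ev x)).HasTemperateGrowth) (L : List ℕ) :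
    (fun x => powerSumProd L (ev x)).HasTemperateGrowth := by
  induction L with
  | nil => exact Function.HasTemperateGrowth.const 1
  | cons a L ih =>
    simp_rw [powerSumProd_cons]
    exact (h a).mul ih

/-- Loop equations from a family of vector fields along which the power sums are differentiated
as in the diagonal case. -/
theorem satisfiesLoopEquations_of_vectorField {ι : Type*} [Fintype ι] (e : OrthonormalBasis ι ℝ E)
    {ev : E → Fin n → ℝ} {D : E → ℝ} (V : ℕ → E → E)
    (hp : ∀ k, (fun x => powerSum k (ev x)).HasTemperateGrowth) (hD : D.HasTemperateGrowth)
    (hV : ∀ k a, (fun x => inner ℝ (e a) (V k x)).HasTemperateGrowth)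
    (hinner : ∀ k x, inner ℝ x (V k x) = powerSum (k + 1) (ev x))
    (hderiv : ∀ k l x, fderiv ℝ (fun y => powerSum l (ev y)) x (V k x)
      = l * powerSum (k + l - 1) (ev x))
    (hdiv : ∀ k x, (∑ a, fderiv ℝ (fun y => inner ℝ (e a) (V k y)) x (e a)) * D x
        + fderiv ℝ D x (V k x)
      = (∑ j ∈ Finset.range k, powerSum j (ev x) * powerSum (k - 1 - j) (ev x)) * D x) :
    SatisfiesLoopEquations n fun L =>
      ∫ x, powerSumProd L (ev x) * D x * Real.exp (-‖x‖ ^ 2) := by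
  have hw := powerSumProd_hasTemperateGrowth hp
  have hGint : ∀ L, Integrable fun x => powerSumProd L (ev x) * D x * Real.exp (-‖x‖ ^ 2) :=
    fun L => ((hw L).mul hD).integrable_gaussian
  have hdw : ∀ k L x, fderiv ℝ (fun y => powerSumProd L (ev y)) x (V k x)
      = ((powerSumDeriv k L).map fun q => (q.1 : ℝ) * powerSumProd q.2 (ev x)).sum := by
    intro k L x
    induction L with
    | nil => simp [powerSumDeriv]
    | cons l L ih =>
      have hd := ((hp l).1.differentiable (by simp) x).hasFDerivAt.mul
        ((hw L).1.differentiable (by simp) x).hasFDerivAt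
      have : (fun y => powerSumProd (l :: L) (ev y))
          = (fun y => powerSum l (ev y)) * fun y => powerSumProd L (ev y) := by
        ext y; simp
      rw [this, hd.fderiv]
      simp only [powerSumDeriv, List.map_cons, List.sum_cons, List.map_map, Function.comp_def,
        powerSumProd_cons, add_apply, smul_apply,
        smul_eq_mul]
      rw [ih, hderiv, add_comm, ← List.sum_map_mul_left]
      congr 1
      · ring
      · congr 1
        exact List.map_congr_left fun q _ => by ring
  refine ⟨fun L => ?_, fun k L => ?_⟩
  · rw [← integral_const_mul]
    refine integral_congr_ae (ae_of_all _ fun x => ?_)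
    simp only [powerSumProd_cons, powerSum_zero]
    ring
  -- Divergence theorem for the field `V k` times the product of power sums times `D`. The Gaussian
  -- side yields `2 p_{k+1}` by `hinner`; on the other side `hdiv` gives the quadratic terms and
  -- `hdw` the derivative of the remaining power sums.
  · have key := integral_divergence_mul_gaussian e (F := fun x => powerSumProd L (ev x) * D x)
      ((hw L).mul hD) (hV k)
    have hlist : ∀ Q : List (ℕ × List ℕ),
        Integrable (fun x => (Q.map fun q => (q.1 : ℝ) * powerSumProd q.2 (ev x)).sum * D x
          * Real.exp (-‖x‖ ^ 2)) ∧
        (Q.map fun q => (q.1 : ℝ) *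
          ∫ x, powerSumProd q.2 (ev x) * D x * Real.exp (-‖x‖ ^ 2)).sum
        = ∫ x, (Q.map fun q => (q.1 : ℝ) * powerSumProd q.2 (ev x)).sum * D x
          * Real.exp (-‖x‖ ^ 2) := by
      intro Q
      induction Q with
      | nil => simp
      | cons q Q ih =>
        have he : ∀ x, ((q :: Q).map fun q => (q.1 : ℝ) * powerSumProd q.2 (ev x)).sum * D x
            * Real.exp (-‖x‖ ^ 2)
            = (q.1 : ℝ) * (powerSumProd q.2 (ev x) * D x * Real.exp (-‖x‖ ^ 2))
              + (Q.map fun q => (q.1 : ℝ) * powerSumProd q.2 (ev x)).sum * D x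
              * Real.exp (-‖x‖ ^ 2) := by
          intro x; simp only [List.map_cons, List.sum_cons]; ring
        simp_rw [he]
        refine ⟨((hGint q.2).const_mul _).add ih.1, ?_⟩
        rw [integral_add ((hGint q.2).const_mul _) ih.1, integral_const_mul, ← ih.2]
        simp
    rw [(hlist _).2, ← integral_finsetSum _ fun j _ => hGint _, ← integral_add
      (integrable_finsetSum _ fun j _ => hGint _) (hlist _).1, ← integral_const_mul]
    rw [eq_comm]
    refine (integral_congr_ae (ae_of_all _ fun x => ?_)).trans
      (key.trans (integral_congr_ae (ae_of_all _ fun x => ?_)))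
    · have hdF := ((hw L).1.differentiable (by simp) x).hasFDerivAt.mul
        (hD.1.differentiable (by simp) x).hasFDerivAt
      have : fderiv ℝ (fun x => powerSumProd L (ev x) * D x) x (V k x)
          = powerSumProd L (ev x) * fderiv ℝ D x (V k x)
            + D x * fderiv ℝ (fun x => powerSumProd L (ev x)) x (V k x) := by
        erw [hdF.fderiv]; simp
      rw [this, hdw, ← Finset.sum_mul]
      have h3 : ∀ j, powerSumProd (j :: (k - 1 - j) :: L) (ev x) * D x
          = (powerSum j (ev x) * powerSum (k - 1 - j) (ev x)) * D x * powerSumProd L (ev x) := by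
        intro j; simp only [powerSumProd_cons]; ring
      simp_rw [h3]
      rw [← Finset.sum_mul, ← Finset.sum_mul, ← hdiv]
      ring
    · beta_reduce
      rw [hinner, powerSumProd_cons]
      ring

end SpectralModels

/-! ### Comparison of two spectral models of the same size -/

section SpectralModelComparison

variable {n : ℕ} {E : Type*} [NormedAddCommGroup E] [InnerProductSpace ℝ E] [FiniteDimensional ℝ E]
  [MeasurableSpace E] [BorelSpace E] {ev : E → Fin n → ℝ} {D : E → ℝ}
  {E' : Type*} [NormedAddCommGroup E'] [InnerProductSpace ℝ E'] [FiniteDimensional ℝ E']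
  [MeasurableSpace E'] [BorelSpace E'] {ev' : E' → Fin n → ℝ} {D' : E' → ℝ}

theorem Continuous.integrableOn_normSq_lt_one {G : E → ℝ} (hG : Continuous G) :
    IntegrableOn G {x : E | ‖x‖ ^ 2 < 1} := by
  refine (hG.continuousOn.integrableOn_compact (isCompact_closedBall (0 : E) 1)).mono_set ?_
  intro x hx
  simp only [Set.mem_ofPred_eq] at hx
  rw [mem_closedBall_zero_iff]
  nlinarith [norm_nonneg x]

theorem prod_isSymmetric (n : ℕ) : (∏ i, MvPolynomial.X i : MvPolynomial (Fin n) ℝ).IsSymmetric := by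
  intro e
  rw [map_prod]
  simp only [MvPolynomial.rename_X]
  exact Equiv.prod_comp e fun i => (MvPolynomial.X i : MvPolynomial (Fin n) ℝ)

theorem IsSpectralModel.continuous_eval (h : IsSpectralModel ev D) {S : MvPolynomial (Fin n) ℝ}
    (hS : S.IsSymmetric) : Continuous fun x => MvPolynomial.eval (ev x) S := by
  refine Submodule.span_induction (p := fun S _ => Continuous fun x => MvPolynomial.eval (ev x) S)
    ?_ ?_ ?_ ?_ hS.mem_span_psum
  · rintro _ ⟨L, rfl⟩
    simp_rw [eval_psum_prod]
    exact (powerSumProd_hasTemperateGrowth h.psum_temperate L).1.continuous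
  · simpa using continuous_const
  · intro S T _ _ hS hT
    simp only [map_add]
    exact hS.add hT
  · intro c S _ hS
    simp only [MvPolynomial.smul_eval]
    exact continuous_const.mul hS

theorem IsSpectralModel.continuous_prod (h : IsSpectralModel ev D) :
    Continuous fun x => ∏ i, ev x i := by
  simpa using h.continuous_eval (prod_isSymmetric n)

theorem IsSpectralModel.powerSumProd_smul (h : IsSpectralModel ev D) (L : List ℕ) {r : ℝ}
    (hr : 0 < r) (x : E) : powerSumProd L (ev (r • x)) = r ^ L.sum * powerSumProd L (ev x) := by
  induction L with
  | nil => simp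
  | cons a L ih =>
    rw [powerSumProd_cons, powerSumProd_cons, ih, h.psum_smul a r hr, List.sum_cons, pow_add]
    ring

/-- Each squared eigenvalue is at most the sum of squares `‖x‖²`. Hence on the ball polynomial
approximation of `|t|^a` is needed only on `[-1, 1]`. -/
theorem IsSpectralModel.abs_prod_le_one (h : IsSpectralModel ev D) {x : E} (hx : ‖x‖ ^ 2 < 1) :
    |∏ i, ev x i| ≤ 1 := by
  rw [Finset.abs_prod]
  refine Finset.prod_le_one (fun i _ => abs_nonneg _) fun i _ => ?_
  rw [h.norm_sq, powerSum] at hx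
  have := Finset.single_le_sum (f := fun i => ev x i ^ 2) (fun i _ => sq_nonneg _)
    (Finset.mem_univ i)
  rw [← sq_le_one_iff_abs_le_one]
  exact this.trans hx.le

/-- The integrand with a determinantal weight. -/
theorem IsSpectralModel.continuous_weighted (h : IsSpectralModel ev D) {a : ℝ} (ha : 0 ≤ a)
    {S : MvPolynomial (Fin n) ℝ} (hS : S.IsSymmetric) :
    Continuous fun x => MvPolynomial.eval (ev x) S * |∏ i, ev x i| ^ a * D x :=
  ((h.continuous_eval hS).mul (h.continuous_prod.abs.rpow_const fun _ => Or.inr ha)).mul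
    h.density_temperate.1.continuous

/-- The Gamma-type factor depends on `n`, the degree and `a` but not on the model, because dimension
plus degree of the density is `n²` in every model. This permits passing to the ball and back. -/
theorem IsSpectralModel.gaussian_eq_ball (h : IsSpectralModel ev D) {a : ℝ} (ha : 0 ≤ a)
    (L : List ℕ) :
    Integrable (fun x => powerSumProd L (ev x) * |∏ i, ev x i| ^ a * D x * Real.exp (-‖x‖ ^ 2)) ∧
    ∫ x, powerSumProd L (ev x) * |∏ i, ev x i| ^ a * D x * Real.exp (-‖x‖ ^ 2)
      = (∫ s in Set.Ioi (0 : ℝ), Real.exp (-s) * s ^ (((n : ℝ) ^ 2 + L.sum + n * a) / 2))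
        * ∫ x in {x : E | ‖x‖ ^ 2 < 1}, powerSumProd L (ev x) * |∏ i, ev x i| ^ a * D x := by
  obtain ⟨d, hd, hD⟩ := h.density_smul
  have hc : Continuous fun x => powerSumProd L (ev x) * |∏ i, ev x i| ^ a * D x :=
    ((powerSumProd_hasTemperateGrowth h.psum_temperate L).1.continuous.mul
      (h.continuous_prod.abs.rpow_const fun _ => Or.inr ha)).mul h.density_temperate.1.continuous
  have hh : ∀ r : ℝ, 0 < r → ∀ x, powerSumProd L (ev (r • x)) * |∏ i, ev (r • x) i| ^ a * D (r • x)
      = r ^ ((L.sum : ℝ) + n * a + d) * (powerSumProd L (ev x) * |∏ i, ev x i| ^ a * D x) := by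
    intro r hr x
    rw [h.powerSumProd_smul L hr, h.prod_smul r hr, hD r hr, abs_mul, abs_of_pos (pow_pos hr n),
      Real.mul_rpow (by positivity) (abs_nonneg _), Real.rpow_add hr, Real.rpow_add hr,
      Real.rpow_natCast, Real.rpow_natCast, ← Real.rpow_natCast r n, ← Real.rpow_mul hr.le]
    ring
  have hi := integrable_gaussian_of_homogeneous hc hh
  refine ⟨hi, ?_⟩
  rw [integral_gaussian_of_homogeneous hc hh hi]
  have : (Module.finrank ℝ E : ℝ) + ((L.sum : ℝ) + n * a + d) = (n : ℝ) ^ 2 + L.sum + n * a := by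
    have : (Module.finrank ℝ E : ℝ) + d = (n : ℝ) ^ 2 := by exact_mod_cast hd
    linarith
  rw [this]

/-- Uniqueness in the loop equations gives the Gaussian version; the common radial factor cancels.
-/
theorem IsSpectralModel.ball_psum_comm (h : IsSpectralModel ev D) (h' : IsSpectralModel ev' D')
    (L : List ℕ) :
    (∫ x in {x : E | ‖x‖ ^ 2 < 1}, powerSumProd L (ev x) * D x)
        * (∫ x, D' x * Real.exp (-‖x‖ ^ 2))
      = (∫ x in {x : E' | ‖x‖ ^ 2 < 1}, powerSumProd L (ev' x) * D' x)
        * (∫ x, D x * Real.exp (-‖x‖ ^ 2)) := by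
  have key := h.loop.proportional h'.loop L
  have e := (h.gaussian_eq_ball le_rfl L).2
  have e' := (h'.gaussian_eq_ball le_rfl L).2
  simp only [Real.rpow_zero, mul_one] at e e'
  simp only [powerSumProd_nil, one_mul] at key
  rw [e, e'] at key
  have hp := integral_exp_neg_mul_rpow_pos (a := ((n : ℝ) ^ 2 + L.sum + n * 0) / 2) (by positivity)
  refine mul_left_cancel₀ hp.ne' ?_
  linarith

theorem IsSpectralModel.ball_symmetric_comm (h : IsSpectralModel ev D)
    (h' : IsSpectralModel ev' D') {S : MvPolynomial (Fin n) ℝ} (hS : S.IsSymmetric) :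
    (∫ x in {x : E | ‖x‖ ^ 2 < 1}, MvPolynomial.eval (ev x) S * D x)
        * (∫ x, D' x * Real.exp (-‖x‖ ^ 2))
      = (∫ x in {x : E' | ‖x‖ ^ 2 < 1}, MvPolynomial.eval (ev' x) S * D' x)
        * (∫ x, D x * Real.exp (-‖x‖ ^ 2)) := by
  refine (Submodule.span_induction (p := fun S _ =>
    (IntegrableOn (fun x => MvPolynomial.eval (ev x) S * D x) {x : E | ‖x‖ ^ 2 < 1} ∧
      IntegrableOn (fun x => MvPolynomial.eval (ev' x) S * D' x) {x : E' | ‖x‖ ^ 2 < 1}) ∧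
    (∫ x in {x : E | ‖x‖ ^ 2 < 1}, MvPolynomial.eval (ev x) S * D x)
        * (∫ x, D' x * Real.exp (-‖x‖ ^ 2))
      = (∫ x in {x : E' | ‖x‖ ^ 2 < 1}, MvPolynomial.eval (ev' x) S * D' x)
        * (∫ x, D x * Real.exp (-‖x‖ ^ 2))) ?_ ?_ ?_ ?_ hS.mem_span_psum).2
  · rintro _ ⟨L, rfl⟩
    simp_rw [eval_psum_prod]
    refine ⟨⟨?_, ?_⟩, h.ball_psum_comm h' L⟩
    · exact ((powerSumProd_hasTemperateGrowth h.psum_temperate L).1.continuous.mul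
        h.density_temperate.1.continuous).integrableOn_normSq_lt_one
    · exact ((powerSumProd_hasTemperateGrowth h'.psum_temperate L).1.continuous.mul
        h'.density_temperate.1.continuous).integrableOn_normSq_lt_one
  · simp
  · intro S T _ _ hS hT
    simp only [map_add, add_mul]
    refine ⟨⟨hS.1.1.add hT.1.1, hS.1.2.add hT.1.2⟩, ?_⟩
    rw [integral_add hS.1.1 hT.1.1, integral_add hS.1.2 hT.1.2, add_mul, add_mul, hS.2, hT.2]
  · intro c S _ hS
    simp only [MvPolynomial.smul_eval, mul_assoc]
    refine ⟨⟨hS.1.1.const_mul c, hS.1.2.const_mul c⟩, ?_⟩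
    rw [integral_const_mul, integral_const_mul, mul_assoc, mul_assoc, hS.2]

/-- Replacing the weight by a uniformly close polynomial changes the ball integral little. -/
theorem IsSpectralModel.ball_weight_near (h : IsSpectralModel ev D) {a : ℝ} (ha : 0 ≤ a)
    {S : MvPolynomial (Fin n) ℝ} (hS : S.IsSymmetric) {q : Polynomial ℝ} {η : ℝ}
    (hq : ∀ t ∈ Set.Icc (-1 : ℝ) 1, |q.eval t - |t| ^ a| < η) :
    |(∫ x in {x : E | ‖x‖ ^ 2 < 1}, MvPolynomial.eval (ev x) S * q.eval (∏ i, ev x i) * D x)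
      - ∫ x in {x : E | ‖x‖ ^ 2 < 1}, MvPolynomial.eval (ev x) S * |∏ i, ev x i| ^ a * D x|
      ≤ η * ∫ x in {x : E | ‖x‖ ^ 2 < 1}, |MvPolynomial.eval (ev x) S * D x| := by
  have hm : MeasurableSet {x : E | ‖x‖ ^ 2 < 1} :=
    (isOpen_lt (by fun_prop) continuous_const).measurableSet
  have hc := h.density_temperate.1.continuous
  rw [← integral_sub, ← integral_const_mul, ← Real.norm_eq_abs]
  · refine (norm_integral_le_integral_norm _).trans (setIntegral_mono_on ?_ ?_ hm ?_)
    · refine Continuous.integrableOn_normSq_lt_one (Continuous.norm (Continuous.sub ?_ ?_))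
      · exact ((h.continuous_eval hS).mul (q.continuous.comp h.continuous_prod)).mul hc
      · exact h.continuous_weighted ha hS
    · exact (((h.continuous_eval hS).mul hc).abs.const_smul η).integrableOn_normSq_lt_one
    · intro x hx
      have h1 := hq _ (abs_le.1 (h.abs_prod_le_one hx))
      rw [← sub_mul, ← mul_sub, Real.norm_eq_abs, abs_mul, abs_mul, abs_mul]
      have := mul_le_mul_of_nonneg_left h1.le
        (mul_nonneg (abs_nonneg (MvPolynomial.eval (ev x) S)) (abs_nonneg (D x)))
      linarith
  · exact (((h.continuous_eval hS).mul (q.continuous.comp h.continuous_prod)).mul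
      hc).integrableOn_normSq_lt_one
  · exact (h.continuous_weighted ha hS).integrableOn_normSq_lt_one

/-- By Weierstrass, `|t|^a` is uniformly close to a polynomial `q` on `[-1, 1]`. Since `q` of the
product of the eigenvalues is again a symmetric polynomial, the unweighted identity applies to it.
-/
theorem IsSpectralModel.ball_weighted_comm (h : IsSpectralModel ev D)
    (h' : IsSpectralModel ev' D') {a : ℝ} (ha : 0 ≤ a) {S : MvPolynomial (Fin n) ℝ}
    (hS : S.IsSymmetric) :
    (∫ x in {x : E | ‖x‖ ^ 2 < 1}, MvPolynomial.eval (ev x) S * |∏ i, ev x i| ^ a * D x)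
        * (∫ x, D' x * Real.exp (-‖x‖ ^ 2))
      = (∫ x in {x : E' | ‖x‖ ^ 2 < 1}, MvPolynomial.eval (ev' x) S * |∏ i, ev' x i| ^ a * D' x)
        * (∫ x, D x * Real.exp (-‖x‖ ^ 2)) := by
  set Z := ∫ x, D x * Real.exp (-‖x‖ ^ 2)
  set Z' := ∫ x, D' x * Real.exp (-‖x‖ ^ 2)
  set A := ∫ x in {x : E | ‖x‖ ^ 2 < 1}, |MvPolynomial.eval (ev x) S * D x|
  set A' := ∫ x in {x : E' | ‖x‖ ^ 2 < 1}, |MvPolynomial.eval (ev' x) S * D' x|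
  rw [← sub_eq_zero, ← abs_nonpos_iff]
  refine le_of_forall_pos_le_add fun ε hε => ?_
  -- Replacing the weight by `q` in both models costs at most `(ε / K)(A |Z'| + A' |Z|)`; the added
  -- 1 keeps `K` positive.
  set K := A * |Z'| + A' * |Z| + 1 with hK
  have hA : 0 ≤ A := integral_nonneg fun _ => abs_nonneg _
  have hA' : 0 ≤ A' := integral_nonneg fun _ => abs_nonneg _
  have hKp : 0 < K := by positivity
  obtain ⟨q, hq⟩ := exists_polynomial_near_of_continuousOn (-1) 1 (fun t : ℝ => |t| ^ a)
    (continuous_abs.rpow_const fun _ => Or.inr ha).continuousOn (ε / K) (by positivity)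
  have e1 := h.ball_weight_near ha hS hq
  have e2 := h'.ball_weight_near ha hS hq
  have hT : (S * Polynomial.aeval (∏ i, MvPolynomial.X i) q : MvPolynomial (Fin n) ℝ).IsSymmetric :=
    mul_mem (S := Subalgebra ℝ _) (s := MvPolynomial.symmetricSubalgebra (Fin n) ℝ) hS
      (by
        rw [Polynomial.aeval_eq_sum_range]
        exact sum_mem fun i _ => Subalgebra.smul_mem _ (pow_mem (prod_isSymmetric n) i) _)
  have e3 := h.ball_symmetric_comm h' hT
  have hev : ∀ l : Fin n → ℝ,
      MvPolynomial.eval l (S * Polynomial.aeval (∏ i, MvPolynomial.X i) q)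
        = MvPolynomial.eval l S * q.eval (∏ i, l i) := by
    intro l
    rw [map_mul]
    congr 1
    rw [← MvPolynomial.coe_aeval_eq_eval]
    change (MvPolynomial.aeval l) _ = _
    rw [← Polynomial.aeval_algHom_apply]
    simp [Polynomial.coe_aeval_eq_eval]
  simp_rw [hev] at e3
  set I := ∫ x in {x : E | ‖x‖ ^ 2 < 1}, MvPolynomial.eval (ev x) S * |∏ i, ev x i| ^ a * D x
  set I' := ∫ x in {x : E' | ‖x‖ ^ 2 < 1}, MvPolynomial.eval (ev' x) S * |∏ i, ev' x i| ^ a * D' x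
  set J := ∫ x in {x : E | ‖x‖ ^ 2 < 1}, MvPolynomial.eval (ev x) S * q.eval (∏ i, ev x i) * D x
  set J' := ∫ x in {x : E' | ‖x‖ ^ 2 < 1},
    MvPolynomial.eval (ev' x) S * q.eval (∏ i, ev' x i) * D' x
  have : I * Z' - I' * Z = (J' - I') * Z - (J - I) * Z' := by linarith
  rw [this, zero_add]
  calc |(J' - I') * Z - (J - I) * Z'| ≤ |J' - I'| * |Z| + |J - I| * |Z'| := by
        rw [← abs_mul, ← abs_mul]; exact abs_sub _ _
    _ ≤ (ε / K * A') * |Z| + (ε / K * A) * |Z'| := by gcongr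
    _ = ε / K * (K - 1) := by rw [hK]; ring
    _ ≤ ε / K * K := by gcongr; linarith
    _ = ε := by field_simp

/-- Two spectral models of the same size have proportional integrals of symmetric polynomials
against the Gaussian weight times a power of the absolute value of the product of eigenvalues. -/
theorem IsSpectralModel.weighted_comm (h : IsSpectralModel ev D)
    (h' : IsSpectralModel ev' D') {a : ℝ} (ha : 0 ≤ a) {S : MvPolynomial (Fin n) ℝ}
    (hS : S.IsSymmetric) :
    (Integrable (fun x => MvPolynomial.eval (ev x) S * |∏ i, ev x i| ^ a * D x
        * Real.exp (-‖x‖ ^ 2)) ∧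
      Integrable (fun x => MvPolynomial.eval (ev' x) S * |∏ i, ev' x i| ^ a * D' x
        * Real.exp (-‖x‖ ^ 2))) ∧
    (∫ x, MvPolynomial.eval (ev x) S * |∏ i, ev x i| ^ a * D x * Real.exp (-‖x‖ ^ 2))
        * (∫ x, D' x * Real.exp (-‖x‖ ^ 2))
      = (∫ x, MvPolynomial.eval (ev' x) S * |∏ i, ev' x i| ^ a * D' x * Real.exp (-‖x‖ ^ 2))
        * (∫ x, D x * Real.exp (-‖x‖ ^ 2)) := by
  refine Submodule.span_induction (p := fun S _ =>
    (Integrable (fun x => MvPolynomial.eval (ev x) S * |∏ i, ev x i| ^ a * D x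
        * Real.exp (-‖x‖ ^ 2)) ∧
      Integrable (fun x => MvPolynomial.eval (ev' x) S * |∏ i, ev' x i| ^ a * D' x
        * Real.exp (-‖x‖ ^ 2))) ∧
    (∫ x, MvPolynomial.eval (ev x) S * |∏ i, ev x i| ^ a * D x * Real.exp (-‖x‖ ^ 2))
        * (∫ x, D' x * Real.exp (-‖x‖ ^ 2))
      = (∫ x, MvPolynomial.eval (ev' x) S * |∏ i, ev' x i| ^ a * D' x * Real.exp (-‖x‖ ^ 2))
        * (∫ x, D x * Real.exp (-‖x‖ ^ 2))) ?_ ?_ ?_ ?_ hS.mem_span_psum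
  · rintro _ ⟨L, rfl⟩
    have hsym : ((L.map (MvPolynomial.psum (Fin n) ℝ)).prod).IsSymmetric :=
      list_prod_mem (S := MvPolynomial.symmetricSubalgebra (Fin n) ℝ) (by
        intro x hx
        obtain ⟨k, -, rfl⟩ := List.mem_map.1 hx
        exact MvPolynomial.psum_isSymmetric _ _ k)
    have key := h.ball_weighted_comm h' ha hsym
    simp_rw [eval_psum_prod] at key ⊢
    obtain ⟨i1, e1⟩ := h.gaussian_eq_ball ha L
    obtain ⟨i2, e2⟩ := h'.gaussian_eq_ball ha L
    refine ⟨⟨i1, i2⟩, ?_⟩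
    rw [e1, e2, mul_assoc, mul_assoc, key]
  · simp
  · intro S T _ _ hS hT
    simp only [map_add, add_mul]
    refine ⟨⟨hS.1.1.add hT.1.1, hS.1.2.add hT.1.2⟩, ?_⟩
    rw [integral_add hS.1.1 hT.1.1, integral_add hS.1.2 hT.1.2, add_mul, add_mul, hS.2, hT.2]
  · intro c S _ hS
    simp only [MvPolynomial.smul_eval, mul_assoc] at hS ⊢
    refine ⟨⟨hS.1.1.const_mul c, hS.1.2.const_mul c⟩, ?_⟩
    rw [integral_const_mul, integral_const_mul, mul_assoc, mul_assoc, hS.2]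

end SpectralModelComparison

/-! ### The diagonal model: `ℝⁿ` with the squared Vandermonde density -/

section DiagonalModel

variable {n : ℕ}

/-- The pairs `i < j` of indices. -/
def indexPairs (n : ℕ) : Finset (Σ _ : Fin n, Fin n) := Finset.univ.sigma fun i => Finset.Ioi i

/-- The Vandermonde product. -/
def vandermondeProd (l : Fin n → ℝ) : ℝ := ∏ p ∈ indexPairs n, (l p.2 - l p.1)

theorem vandermondeProd_eq_det (l : Fin n → ℝ) :
    vandermondeProd l = (Matrix.vandermonde l).det := by
  rw [Matrix.det_vandermonde, vandermondeProd, indexPairs, Finset.prod_sigma]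

theorem card_indexPairs (n : ℕ) : n + 2 * (indexPairs n).card = n ^ 2 := by
  have h : (indexPairs n).card = ∑ i ∈ Finset.range n, (n - 1 - i) := by
    rw [indexPairs, Finset.card_sigma, ← Fin.sum_univ_eq_sum_range (fun i => n - 1 - i) n]
    exact Finset.sum_congr rfl fun i _ => by rw [Fin.card_Ioi]
  rw [h, Finset.sum_range_reflect (fun i => i) n, mul_comm, Finset.sum_range_id_mul_two]
  cases n with
  | zero => simp
  | succ m => simp; ring

/-- The right side is the double sum over all index pairs of the symmetric kernel `f`. Its diagonal
gives `k p_{k-1}`, and the off-diagonal terms pair up into twice the sum over `i < j`. -/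
theorem sum_indexPairs_geom (k : ℕ) (l : Fin n → ℝ) :
    k * powerSum (k - 1) l
      + 2 * ∑ p ∈ indexPairs n, ∑ a ∈ Finset.range k, l p.2 ^ a * l p.1 ^ (k - 1 - a)
    = ∑ a ∈ Finset.range k, powerSum a l * powerSum (k - 1 - a) l := by
  set f : Fin n → Fin n → ℝ := fun j i => ∑ a ∈ Finset.range k, l j ^ a * l i ^ (k - 1 - a)
    with hf
  have hsymm : ∀ i j, f i j = f j i := by
    intro i j
    simp only [hf]
    rw [← Finset.sum_range_reflect]
    refine Finset.sum_congr rfl fun a ha => ?_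
    rw [Finset.mem_range] at ha
    rw [show k - 1 - (k - 1 - a) = a by omega, mul_comm]
  have h1 := Finset.sum_sum_Ioi_add_eq_sum_sum_off_diag f
  have h2 : ∀ i, ∑ j ∈ ({i}ᶜ : Finset (Fin n)), f j i = ∑ j, f j i - f i i := by
    intro i
    rw [← Finset.sum_compl_add_sum {i}]
    simp
  have h3 : ∀ i, f i i = k * l i ^ (k - 1) := by
    intro i
    simp only [hf]
    rw [Finset.sum_congr rfl (g := fun _ => l i ^ (k - 1))]
    · simp
    · intro a ha
      rw [Finset.mem_range] at ha
      rw [← pow_add]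
      congr 1
      omega
  have h4 : ∑ i, ∑ j, f j i = ∑ a ∈ Finset.range k, powerSum a l * powerSum (k - 1 - a) l := by
    simp only [hf, powerSum]
    rw [Finset.sum_comm]
    simp_rw [Finset.sum_mul_sum]
    conv_rhs => rw [Finset.sum_comm]
    refine Finset.sum_congr rfl fun j _ => ?_
    rw [Finset.sum_comm]
  have h5 : ∑ i, ∑ j ∈ Finset.Ioi i, (f j i + f i j)
      = 2 * ∑ p ∈ indexPairs n, ∑ a ∈ Finset.range k, l p.2 ^ a * l p.1 ^ (k - 1 - a) := by
    rw [indexPairs, Finset.sum_sigma, Finset.mul_sum]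
    refine Finset.sum_congr rfl fun i _ => ?_
    rw [Finset.mul_sum]
    refine Finset.sum_congr rfl fun j _ => ?_
    rw [hsymm i j]
    simp only [hf]
    ring
  rw [← h5, h1]
  simp_rw [h2]
  rw [Finset.sum_sub_distrib, h4]
  simp_rw [h3]
  rw [← Finset.mul_sum]
  simp [powerSum]

theorem coord_hasTemperateGrowth (i : Fin n) :
    (fun x : EuclideanSpace ℝ (Fin n) => x i).HasTemperateGrowth :=
  (EuclideanSpace.proj (𝕜 := ℝ) i).hasTemperateGrowth

theorem EuclideanSpace.proj_eq (i : Fin n) (x : EuclideanSpace ℝ (Fin n)) :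
    EuclideanSpace.proj (𝕜 := ℝ) i x = x i := rfl

theorem coord_hasFDerivAt (i : Fin n) (x : EuclideanSpace ℝ (Fin n)) :
    HasFDerivAt (fun x : EuclideanSpace ℝ (Fin n) => x i) (EuclideanSpace.proj (𝕜 := ℝ) i) x :=
  (EuclideanSpace.proj (𝕜 := ℝ) i).hasFDerivAt

theorem vandermondeProd_hasTemperateGrowth (s : Finset (Σ _ : Fin n, Fin n)) :
    (fun x : EuclideanSpace ℝ (Fin n) => ∏ p ∈ s, (x p.2 - x p.1)).HasTemperateGrowth := by
  induction s using Finset.induction_on with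
  | empty => simp
  | insert a s ha ih =>
    simp_rw [Finset.prod_insert ha]
    exact ((coord_hasTemperateGrowth a.2).sub (coord_hasTemperateGrowth a.1)).mul ih

/-- The vector field `x i ^ k`. -/
def coordPow (k : ℕ) (x : EuclideanSpace ℝ (Fin n)) : EuclideanSpace ℝ (Fin n) :=
  WithLp.toLp 2 fun i => x i ^ k

/-- Along the field `x_i^k` the factor `x_j - x_i` has derivative `x_j^k - x_i^k`, which is the
factor itself times a geometric sum; no division is needed where coordinates coincide. -/
theorem fderiv_vandermondeProd_coordPow (k : ℕ) (x : EuclideanSpace ℝ (Fin n)) :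
    fderiv ℝ (fun x : EuclideanSpace ℝ (Fin n) => vandermondeProd x) x (coordPow k x)
      = vandermondeProd x
        * ∑ p ∈ indexPairs n, ∑ a ∈ Finset.range k, x p.2 ^ a * x p.1 ^ (k - 1 - a) := by
  have h := HasFDerivAt.finsetProd (u := indexPairs n) (x := x)
    (g := fun (p : Σ _ : Fin n, Fin n) (x : EuclideanSpace ℝ (Fin n)) => x p.2 - x p.1)
    (fun p _ => (coord_hasFDerivAt p.2 x).sub (coord_hasFDerivAt p.1 x))
  have he : (fun x : EuclideanSpace ℝ (Fin n) => vandermondeProd x)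
      = fun x => ∏ p ∈ indexPairs n, (x p.2 - x p.1) := rfl
  rw [he, h.fderiv]
  simp only [sum_apply, smul_apply, sub_apply, smul_eq_mul]
  rw [Finset.mul_sum]
  refine Finset.sum_congr rfl fun p hp => ?_
  simp only [EuclideanSpace.proj_eq, coordPow]
  rw [← Commute.mul_geom_sum₂ (Commute.all _ _), vandermondeProd, ← Finset.mul_prod_erase _ _ hp]
  ring

/-- The field `x_i^k` has divergence `k p_{k-1}`, and the squared Vandermonde contributes twice the
pair sum; `sum_indexPairs_geom` adds them up to the quadratic term of the loop equations. -/
theorem isSpectralModel_diagonal (n : ℕ) :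
    IsSpectralModel (n := n) (fun x : EuclideanSpace ℝ (Fin n) => (x : Fin n → ℝ))
      (fun x => vandermondeProd x ^ 2) := by
  have hp : ∀ k, (fun x : EuclideanSpace ℝ (Fin n) => powerSum k (x : Fin n → ℝ)).HasTemperateGrowth :=
    fun k => Function.HasTemperateGrowth.sum fun i _ => (coord_hasTemperateGrowth i).pow k
  have hv := vandermondeProd_hasTemperateGrowth (indexPairs n)
  have hD : (fun x : EuclideanSpace ℝ (Fin n) => vandermondeProd x ^ 2).HasTemperateGrowth :=
    hv.pow 2
  refine ⟨hp, hD, fun x => sq_nonneg _, ?_, ?_, ?_, ⟨2 * (indexPairs n).card, ?_, ?_⟩, ?_⟩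
  · intro x
    rw [EuclideanSpace.norm_sq_eq]
    simp [powerSum]
  · intro k r _ x
    simp [powerSum, mul_pow, Finset.mul_sum]
  · intro r _ x
    simp [Finset.prod_mul_distrib]
  · simpa using card_indexPairs n
  · intro r _ x
    simp only [vandermondeProd, PiLp.smul_apply, smul_eq_mul, ← mul_sub, Finset.prod_mul_distrib,
      Finset.prod_const]
    ring
  · have hin : ∀ (k : ℕ) (a : Fin n) (x : EuclideanSpace ℝ (Fin n)),
        inner ℝ (EuclideanSpace.basisFun (Fin n) ℝ a) (coordPow k x) = x a ^ k := by
      intro k a x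
      rw [EuclideanSpace.basisFun_apply, EuclideanSpace.inner_single_left]
      simp [coordPow]
    refine satisfiesLoopEquations_of_vectorField (EuclideanSpace.basisFun (Fin n) ℝ) coordPow
      hp hD ?_ ?_ ?_ ?_
    · intro k a
      simp_rw [hin]
      exact (coord_hasTemperateGrowth a).pow k
    · intro k x
      simp [PiLp.inner_apply, coordPow, powerSum, pow_succ, mul_comm]
    · intro k l x
      have h := HasFDerivAt.fun_sum (u := Finset.univ) (x := x)
        (A := fun (i : Fin n) (x : EuclideanSpace ℝ (Fin n)) => x i ^ l)
        (fun i _ => (coord_hasFDerivAt i x).pow l)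
      have he : (fun x : EuclideanSpace ℝ (Fin n) => powerSum l (x : Fin n → ℝ))
        = fun x => ∑ i, x i ^ l := rfl
      rw [he, h.fderiv]
      simp only [sum_apply, smul_apply, smul_eq_mul, EuclideanSpace.proj_eq,
        coordPow, powerSum, Finset.mul_sum]
      refine Finset.sum_congr rfl fun i _ => ?_
      rcases Nat.eq_zero_or_pos l with rfl | hl
      · simp
      · rw [show k + l - 1 = l - 1 + k by omega, pow_add]
        simp
        ring
    · intro k x
      simp_rw [hin]
      have h1 : ∀ a, fderiv ℝ (fun y : EuclideanSpace ℝ (Fin n) => y a ^ k) x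
          (EuclideanSpace.basisFun (Fin n) ℝ a) = k * x a ^ (k - 1) := by
        intro a
        rw [((coord_hasFDerivAt a x).pow k).fderiv]
        simp [EuclideanSpace.basisFun_apply]
      have hd := (hv.1.differentiable (by simp) x).hasFDerivAt.pow 2
      have h2 : fderiv ℝ (fun x : EuclideanSpace ℝ (Fin n) => vandermondeProd x ^ 2) x
          (coordPow k x) = 2 * vandermondeProd x *
            fderiv ℝ (fun x : EuclideanSpace ℝ (Fin n) => vandermondeProd x) x (coordPow k x) := by
        erw [hd.fderiv]
        simp [vandermondeProd]
      rw [h2, fderiv_vandermondeProd_coordPow, ← sum_indexPairs_geom]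
      simp_rw [h1]
      rw [← Finset.mul_sum]
      simp only [powerSum]
      ring

end DiagonalModel

/-! ### The matrix model: Hermitian matrices with density 1 -/

section HermitianModel

namespace Herm

variable {n : ℕ}

/-- The eigenvalues, indexed by `Fin n`. -/
noncomputable def eigs (x : Herm n) : Fin n → ℝ := x.isHermitian.eigenvalues

/-- The powers of a Hermitian matrix. -/
def pow (k : ℕ) (x : Herm n) : Herm n :=
  (⟨x.toMatrix ^ k, x.isHermitian.isSelfAdjoint.pow k⟩ : selfAdjoint (Matrix (Fin n) (Fin n) ℂ))

theorem toMatrix_pow (k : ℕ) (x : Herm n) : (x.pow k).toMatrix = x.toMatrix ^ k := rfl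

theorem toMatrix_smul (r : ℝ) (x : Herm n) : (r • x).toMatrix = r • x.toMatrix := rfl

theorem inner_eq (x y : Herm n) : inner ℝ x y = (x.toMatrix * y.toMatrix).trace.re := rfl

theorem trace_pow (k : ℕ) (x : Herm n) :
    (x.toMatrix ^ k).trace = (powerSum k x.eigs : ℂ) := by
  have h := x.isHermitian.spectral_theorem
  conv_lhs => rw [h, ← map_pow, Unitary.conjStarAlgAut_apply, Matrix.trace_mul_cycle]
  rw [Unitary.coe_star_mul_self, one_mul, Matrix.diagonal_pow, Matrix.trace_diagonal]
  simp [powerSum, eigs]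

theorem det_eq (x : Herm n) : x.toMatrix.det = ((∏ i, x.eigs i : ℝ) : ℂ) := by
  rw [x.isHermitian.det_eq_prod_eigenvalues]
  simp [eigs]

theorem norm_sq_eq (x : Herm n) : ‖x‖ ^ 2 = (x.toMatrix * x.toMatrix).trace.re := by
  rw [← real_inner_self_eq_norm_sq, inner_eq]

theorem hasTemperateGrowth_entry (k : ℕ) (i j : Fin n) :
    (fun x : Herm n => (x.toMatrix ^ k) i j).HasTemperateGrowth := by
  induction k generalizing i j with
  | zero => simp
  | succ k ih =>
    simp_rw [pow_succ, Matrix.mul_apply]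
    refine Function.HasTemperateGrowth.sum fun m _ => (ih i m).mul ?_
    let f : Herm n →ₗ[ℝ] ℂ :=
      { toFun := fun x => x.toMatrix m j
        map_add' := fun _ _ => rfl
        map_smul' := fun _ _ => rfl }
    exact (LinearMap.toContinuousLinearMap f).hasTemperateGrowth

theorem hasTemperateGrowth_trace (M : Matrix (Fin n) (Fin n) ℂ) (k : ℕ) :
    (fun x : Herm n => (M * x.toMatrix ^ k).trace.re).HasTemperateGrowth := by
  refine Complex.reCLM.hasTemperateGrowth.comp (f := fun x : Herm n => (M * x.toMatrix ^ k).trace) ?_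
  simp only [Matrix.trace, Matrix.diag_apply, Matrix.mul_apply]
  exact Function.HasTemperateGrowth.sum fun i _ => Function.HasTemperateGrowth.sum fun j _ =>
    (Function.HasTemperateGrowth.const _).mul (hasTemperateGrowth_entry k j i)

/-- Noncommutative product rule: the direction `Y` replaces each of the `k` factors in turn. -/
theorem hasDerivAt_entry_pow (X Y : Matrix (Fin n) (Fin n) ℂ) (k : ℕ) (i j : Fin n) :
    HasDerivAt (fun t : ℝ => ((X + t • Y) ^ k) i j)
      ((∑ a ∈ Finset.range k, X ^ a * Y * X ^ (k - 1 - a)) i j) 0 := by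
  induction k generalizing i j with
  | zero => simpa using hasDerivAt_const (0 : ℝ) ((1 : Matrix (Fin n) (Fin n) ℂ) i j)
  | succ k ih =>
    have h1 : ∀ m, HasDerivAt (fun t : ℝ => (X + t • Y) m j) (Y m j) 0 := by
      intro m
      have := ((hasDerivAt_id (0 : ℝ)).smul_const (Y m j)).const_add (X m j)
      simpa using this
    have h2 := HasDerivAt.fun_sum (u := Finset.univ) fun m _ => (ih i m).mul (h1 m)
    simp only [zero_smul, add_zero] at h2
    convert! h2 using 1
    · have h3 : ∑ a ∈ Finset.range (k + 1), X ^ a * Y * X ^ (k + 1 - 1 - a)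
          = (∑ a ∈ Finset.range k, X ^ a * Y * X ^ (k - 1 - a)) * X + X ^ k * Y := by
        rw [Finset.sum_range_succ, Finset.sum_mul]
        congr 1
        · refine Finset.sum_congr rfl fun a ha => ?_
          rw [Finset.mem_range] at ha
          rw [mul_assoc _ _ X, ← pow_succ]
          congr 2
          omega
        · simp
      rw [Finset.sum_add_distrib, ← Matrix.mul_apply, ← Matrix.mul_apply, ← Matrix.add_apply, h3]

theorem fderiv_trace (M : Matrix (Fin n) (Fin n) ℂ) (k : ℕ) (x v : Herm n) :
    fderiv ℝ (fun x : Herm n => (M * x.toMatrix ^ k).trace.re) x v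
      = ∑ a ∈ Finset.range k,
        (M * (x.toMatrix ^ a * v.toMatrix * x.toMatrix ^ (k - 1 - a))).trace.re := by
  rw [← ((hasTemperateGrowth_trace M k).1.differentiable (by simp) x).lineDeriv_eq_fderiv]
  refine HasLineDerivAt.lineDeriv ?_
  rw [HasLineDerivAt]
  have h := HasDerivAt.fun_sum (u := Finset.univ) fun i _ =>
    HasDerivAt.fun_sum (u := Finset.univ) fun j _ =>
      (hasDerivAt_entry_pow x.toMatrix v.toMatrix k j i).const_mul (M i j)
  have h2 := Complex.reCLM.hasFDerivAt.comp_hasDerivAt (0 : ℝ) h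
  convert! h2 using 1
  simp_rw [← Matrix.mul_apply]
  rw [show ∑ i, (M * ∑ a ∈ Finset.range k,
    x.toMatrix ^ a * v.toMatrix * x.toMatrix ^ (k - 1 - a)) i i = (M * ∑ a ∈ Finset.range k,
    x.toMatrix ^ a * v.toMatrix * x.toMatrix ^ (k - 1 - a)).trace from rfl]
  rw [Finset.mul_sum, Matrix.trace_sum]
  simp

variable {ι : Type*} [Fintype ι]

/-- Expansion of a complex matrix in a real orthonormal basis of the Hermitian matrices. -/
theorem sum_trace_smul_basis (e : OrthonormalBasis ι ℝ (Herm n)) (M : Matrix (Fin n) (Fin n) ℂ) :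
    ∑ a, ((e a).toMatrix * M).trace • (e a).toMatrix = M := by
  have hH : ∀ H : Herm n, ∑ a, ((e a).toMatrix * H.toMatrix).trace • (e a).toMatrix
      = H.toMatrix := by
    intro H
    have h1 := congrArg (toMatrixLin n) (e.sum_repr' H)
    rw [map_sum] at h1
    refine Eq.trans (Finset.sum_congr rfl fun a _ => ?_) h1
    rw [map_smul, inner_eq]
    change _ = (_ : ℝ) • (e a).toMatrix
    have h2 : ((((e a).toMatrix * H.toMatrix).trace.re : ℝ) : ℂ)
        = ((e a).toMatrix * H.toMatrix).trace := by
      rw [← Complex.conj_eq_iff_re]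
      change star _ = _
      rw [← Matrix.trace_conjTranspose, Matrix.conjTranspose_mul, (e a).isHermitian.eq,
        H.isHermitian.eq, Matrix.trace_mul_comm]
    rw [← h2]
    ext i j
    simp
  -- Both sides are complex linear in `M`, and `M` is a Hermitian matrix plus `i` times another.
  have hM := realPart_add_I_smul_imaginaryPart M
  have e1 := hH (realPart M : selfAdjoint (Matrix (Fin n) (Fin n) ℂ))
  have e2 := hH (imaginaryPart M : selfAdjoint (Matrix (Fin n) (Fin n) ℂ))
  have t1 : (show Herm n from realPart M).toMatrix = (realPart M : Matrix (Fin n) (Fin n) ℂ) := rfl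
  have t2 : (show Herm n from imaginaryPart M).toMatrix
    = (imaginaryPart M : Matrix (Fin n) (Fin n) ℂ) := rfl
  erw [t1] at e1
  erw [t2] at e2
  conv_lhs => rw [← hM]
  conv_rhs => rw [← hM, ← e1, ← e2]
  simp only [mul_add, Matrix.mul_smul, Matrix.trace_add, Matrix.trace_smul, add_smul,
    Finset.sum_add_distrib, Finset.smul_sum, smul_assoc]

theorem sum_basis_entry (e : OrthonormalBasis ι ℝ (Herm n)) (i j k l : Fin n) :
    ∑ a, (e a).toMatrix i j * (e a).toMatrix k l = if j = k ∧ i = l then 1 else 0 := by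
  have h := congrFun (congrFun (sum_trace_smul_basis e (Matrix.single j i 1)) k) l
  rw [Matrix.sum_apply] at h
  simp only [Matrix.smul_apply, smul_eq_mul, Matrix.single_apply] at h
  rw [← h]
  refine Finset.sum_congr rfl fun a _ => ?_
  congr 1
  rw [Matrix.trace_mul_single]
  simp

/-- Contraction of the completeness relation `∑ e_{ij} e_{kl} = [j = k][i = l]`. It splits the trace
of a product into a product of traces, which produces the quadratic term of the matrix loop
equations. -/
theorem sum_basis_trace (e : OrthonormalBasis ι ℝ (Herm n)) (A B : Matrix (Fin n) (Fin n) ℂ) :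
    ∑ a, ((e a).toMatrix * (A * (e a).toMatrix * B)).trace = A.trace * B.trace := by
  have h : ∀ a, ((e a).toMatrix * (A * (e a).toMatrix * B)).trace
      = ∑ i, ∑ j, ∑ l, ∑ k, (A j k * B l i) * ((e a).toMatrix i j * (e a).toMatrix k l) := by
    intro a
    simp only [Matrix.trace, Matrix.diag_apply, Matrix.mul_apply, Finset.mul_sum, Finset.sum_mul]
    refine Finset.sum_congr rfl fun i _ => Finset.sum_congr rfl fun j _ =>
      Finset.sum_congr rfl fun l _ => Finset.sum_congr rfl fun k _ => by ring
  simp_rw [h]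
  rw [Finset.sum_comm]
  have h2 : ∀ i, ∑ a, ∑ j, ∑ l, ∑ k, (A j k * B l i) * ((e a).toMatrix i j * (e a).toMatrix k l)
      = ∑ j, A j j * B i i := by
    intro i
    rw [Finset.sum_comm]
    refine Finset.sum_congr rfl fun j _ => ?_
    rw [Finset.sum_comm]
    have h3 : ∀ l, ∑ a, ∑ k, (A j k * B l i) * ((e a).toMatrix i j * (e a).toMatrix k l)
        = ∑ k, (A j k * B l i) * if j = k ∧ i = l then 1 else 0 := by
      intro l
      rw [Finset.sum_comm]
      refine Finset.sum_congr rfl fun k _ => ?_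
      rw [← sum_basis_entry e, Finset.mul_sum]
    simp_rw [h3]
    simp [ite_and]
  simp_rw [h2]
  simp only [Matrix.trace, Matrix.diag_apply, Finset.sum_mul_sum]
  rw [Finset.sum_comm]

/-- Taking `A = B = 1` in `sum_basis_trace`, each basis vector contributes its squared norm 1 and
the total is `n · n`. -/
theorem finrank_eq : Module.finrank ℝ (Herm n) = n ^ 2 := by
  have e := stdOrthonormalBasis ℝ (Herm n)
  have h := sum_basis_trace e 1 1
  have h1 : ∀ a, ((e a).toMatrix * (1 * (e a).toMatrix * 1)).trace.re = 1 := by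
    intro a
    rw [one_mul, mul_one, ← norm_sq_eq, e.orthonormal.1 a]
    norm_num
  have h2 := congrArg Complex.re h
  rw [Complex.re_sum] at h2
  simp_rw [h1] at h2
  simp only [Finset.sum_const, Finset.card_univ, Fintype.card_fin, nsmul_eq_mul, mul_one,
    Matrix.trace_one] at h2
  have h3 : ((Module.finrank ℝ (Herm n) : ℕ) : ℝ) = (n : ℝ) * n := by
    rw [h2]; simp
  rw [pow_two]
  exact_mod_cast h3

theorem powerSum_eigs (k : ℕ) (x : Herm n) :
    powerSum k x.eigs = ((1 : Matrix (Fin n) (Fin n) ℂ) * x.toMatrix ^ k).trace.re := by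
  rw [one_mul, trace_pow, Complex.ofReal_re]

/-- The vector field is `x ↦ x^k`. Its divergence is `∑ tr(x^j) tr(x^{k-1-j})`, already the full
quadratic term, so the density is constant. -/
theorem isSpectralModel (n : ℕ) :
    IsSpectralModel (n := n) (fun x : Herm n => x.eigs) (fun _ => 1) := by
  have hp : ∀ k, (fun x : Herm n => powerSum k x.eigs).HasTemperateGrowth := by
    intro k
    simp_rw [powerSum_eigs]
    exact hasTemperateGrowth_trace 1 k
  refine ⟨hp, .const 1, fun _ => zero_le_one, ?_, ?_, ?_, ⟨0, by simpa using finrank_eq, ?_⟩, ?_⟩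
  · intro x
    rw [norm_sq_eq, powerSum_eigs, one_mul, sq]
  · intro k r _ x
    rw [powerSum_eigs, powerSum_eigs, toMatrix_smul, smul_pow, Matrix.mul_smul,
      Matrix.trace_smul, Complex.real_smul, Complex.re_ofReal_mul]
  · intro r _ x
    have h := det_eq (r • x)
    rw [toMatrix_smul, ← Complex.coe_smul, Matrix.det_smul, det_eq x] at h
    simp only [Fintype.card_fin] at h
    exact_mod_cast h.symm
  · simp
  · have e := stdOrthonormalBasis ℝ (Herm n)
    refine satisfiesLoopEquations_of_vectorField e (fun k x => x.pow k) hp (.const 1) ?_ ?_ ?_ ?_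
    · intro k a
      simp_rw [inner_eq, toMatrix_pow]
      exact hasTemperateGrowth_trace _ k
    · intro k x
      rw [inner_eq, toMatrix_pow, powerSum_eigs, one_mul, pow_succ']
    · intro k l x
      simp_rw [powerSum_eigs]
      rw [fderiv_trace]
      have : ∀ a ∈ Finset.range l, ((1 : Matrix (Fin n) (Fin n) ℂ) *
          (x.toMatrix ^ a * (x.pow k).toMatrix * x.toMatrix ^ (l - 1 - a))).trace.re
          = ((1 : Matrix (Fin n) (Fin n) ℂ) * x.toMatrix ^ (k + l - 1)).trace.re := by
        intro a ha
        rw [Finset.mem_range] at ha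
        rw [toMatrix_pow, ← pow_add, ← pow_add]
        congr 5
        omega
      rw [Finset.sum_congr rfl this]
      simp
    · intro k x
      simp_rw [inner_eq, toMatrix_pow, fderiv_trace]
      rw [Finset.sum_comm]
      simp only [mul_one, fderiv_fun_const, Pi.zero_apply, zero_apply, add_zero]
      refine Finset.sum_congr rfl fun j _ => ?_
      rw [← Complex.re_sum, sum_basis_trace, trace_pow, trace_pow, ← Complex.ofReal_mul,
        Complex.ofReal_re]

end Herm

end HermitianModel

/-! ### Generalized Hermite polynomials via the Dunkl operator -/

section GeneralizedHermite

open Polynomial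

/-- The weight `|s|^{2μ} exp(-s²)` on the line. -/
noncomputable def lineWeight (μ s : ℝ) : ℝ := |s| ^ (2 * μ) * Real.exp (-s ^ 2)

theorem lineWeight_nonneg (μ s : ℝ) : 0 ≤ lineWeight μ s := by
  unfold lineWeight; positivity

theorem integrable_pow_mul_lineWeight {μ : ℝ} (hμ : 0 ≤ μ) (k : ℕ) :
    Integrable fun s : ℝ => s ^ k * lineWeight μ s := by
  have h := integrable_gaussian_of_homogeneous (E := ℝ) (G := fun s => s ^ k * |s| ^ (2 * μ))
    (d := k + 2 * μ)
    ((continuous_pow k).mul (continuous_abs.rpow_const fun _ => Or.inr (by positivity)))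
    (by
      intro r hr x
      simp only [smul_eq_mul]
      rw [mul_pow, abs_mul, abs_of_pos hr, Real.mul_rpow hr.le (abs_nonneg _), Real.rpow_add hr,
        Real.rpow_natCast]
      ring)
  refine h.congr (ae_of_all _ fun s => ?_)
  simp only [lineWeight, Real.norm_eq_abs, sq_abs]
  ring

theorem integrable_eval_mul_lineWeight {μ : ℝ} (hμ : 0 ≤ μ) (q : ℝ[X]) :
    Integrable fun s : ℝ => q.eval s * lineWeight μ s := by
  induction q using Polynomial.induction_on' with
  | add p q hp hq =>
    simp only [eval_add, add_mul]
    exact hp.add hq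
  | monomial k a =>
    simp only [eval_monomial, mul_assoc]
    exact (integrable_pow_mul_lineWeight hμ k).const_mul a

/-- The lineMoment functional of the weight. -/
noncomputable def lineMoment (μ : ℝ) (q : ℝ[X]) : ℝ := ∫ s, q.eval s * lineWeight μ s

theorem lineMoment_add {μ : ℝ} (hμ : 0 ≤ μ) (p q : ℝ[X]) :
    lineMoment μ (p + q) = lineMoment μ p + lineMoment μ q := by
  simp only [lineMoment, eval_add, add_mul]
  exact integral_add (integrable_eval_mul_lineWeight hμ p) (integrable_eval_mul_lineWeight hμ q)

theorem lineMoment_C_mul (μ a : ℝ) (q : ℝ[X]) : lineMoment μ (C a * q) = a * lineMoment μ q := by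
  simp only [lineMoment, eval_mul, eval_C, mul_assoc]
  exact integral_const_mul _ _

theorem lineMoment_sub {μ : ℝ} (hμ : 0 ≤ μ) (p q : ℝ[X]) :
    lineMoment μ (p - q) = lineMoment μ p - lineMoment μ q := by
  have : p - q = p + C (-1) * q := by simp [sub_eq_add_neg]
  rw [this, lineMoment_add hμ, lineMoment_C_mul]
  ring

theorem lineMoment_sum {μ : ℝ} (hμ : 0 ≤ μ) {ι : Type*} (s : Finset ι) (f : ι → ℝ[X]) :
    lineMoment μ (∑ i ∈ s, f i) = ∑ i ∈ s, lineMoment μ (f i) := by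
  simp only [lineMoment, eval_finsetSum, Finset.sum_mul]
  exact integral_finsetSum _ fun i _ => integrable_eval_mul_lineWeight hμ _

theorem lineMoment_nonneg {μ : ℝ} {q : ℝ[X]} (hq : ∀ s, 0 ≤ q.eval s) : 0 ≤ lineMoment μ q :=
  integral_nonneg fun s => mul_nonneg (hq s) (lineWeight_nonneg μ s)

theorem lineMoment_X_pow_even {μ : ℝ} (hμ : 0 ≤ μ) {m : ℕ} (hm : Even m) :
    lineMoment μ (X ^ m) = Real.Gamma ((m + 2 * μ + 1) / 2) := by
  have h1 : ∀ s : ℝ, (X ^ m : ℝ[X]).eval s * lineWeight μ s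
      = (fun t : ℝ => t ^ m * (t ^ (2 * μ) * Real.exp (-t ^ 2))) |s| := by
    intro s
    simp [lineWeight, hm.pow_abs]
  simp only [lineMoment, h1]
  rw [integral_comp_abs (f := fun t : ℝ => t ^ m * (t ^ (2 * μ) * Real.exp (-t ^ 2)))]
  have h2 := integral_rpow_mul_exp_neg_rpow (p := 2) (q := m + 2 * μ) (by norm_num)
    (by have : (0 : ℝ) ≤ m := by positivity
        linarith)
  have h3 : ∫ t in Set.Ioi (0 : ℝ), t ^ m * (t ^ (2 * μ) * Real.exp (-t ^ 2))
      = ∫ t in Set.Ioi (0 : ℝ), t ^ ((m : ℝ) + 2 * μ) * Real.exp (-t ^ (2 : ℝ)) := by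
    refine setIntegral_congr_fun measurableSet_Ioi fun t ht => ?_
    rw [Real.rpow_add ht, Real.rpow_natCast, ← Real.rpow_natCast t 2]
    push_cast
    ring
  rw [h3, h2]
  ring

theorem lineMoment_X_pow_odd (μ : ℝ) {m : ℕ} (hm : Odd m) : lineMoment μ (X ^ m) = 0 := by
  have h := integral_neg_eq_self (fun s : ℝ => (X ^ m : ℝ[X]).eval s * lineWeight μ s) volume
  have h2 : ∀ s : ℝ, (X ^ m : ℝ[X]).eval (-s) * lineWeight μ (-s)
      = -((X ^ m : ℝ[X]).eval s * lineWeight μ s) := by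
    intro s
    simp [lineWeight, hm.neg_pow]
  simp only [h2, integral_neg] at h
  simp only [lineMoment]
  linarith

/-- The coefficients `m + 2μ [m odd]` of the Dunkl operator. -/
noncomputable def dunklCoeff (μ : ℝ) (m : ℕ) : ℝ := m + if Odd m then 2 * μ else 0

theorem dunklCoeff_zero (μ : ℝ) : dunklCoeff μ 0 = 0 := by simp [dunklCoeff]

theorem dunklCoeff_succ (μ : ℝ) (m : ℕ) :
    dunklCoeff μ (m + 1) = dunklCoeff μ m + 1 + 2 * μ * (-1) ^ m := by
  rcases Nat.even_or_odd m with h | h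
  · have h1 : Odd (m + 1) := h.add_one
    have h2 : ¬ Odd m := Nat.not_odd_iff_even.2 h
    simp [dunklCoeff, h1, h2, h.neg_one_pow]
  · have h1 : ¬ Odd (m + 1) := Nat.not_odd_iff_even.2 h.add_one
    simp [dunklCoeff, h1, h, h.neg_one_pow]
    ring

theorem dunklCoeff_succ_pos {μ : ℝ} (hμ : 0 ≤ μ) (m : ℕ) : 0 < dunklCoeff μ (m + 1) := by
  unfold dunklCoeff
  push_cast
  split_ifs <;> positivity

/-- The Dunkl operator on polynomials. -/
noncomputable def dunkl (μ : ℝ) : ℝ[X] →ₗ[ℝ] ℝ[X] :=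
  Polynomial.lsum fun m => dunklCoeff μ m • Polynomial.monomial (m - 1)

theorem dunkl_monomial (μ : ℝ) (m : ℕ) (a : ℝ) :
    dunkl μ (monomial m a) = monomial (m - 1) (dunklCoeff μ m * a) := by
  simp only [dunkl, Polynomial.lsum_apply]
  rw [sum_monomial_index]
  · simp [smul_monomial]
  · simp

theorem lineMoment_monomial (μ a : ℝ) (m : ℕ) :
    lineMoment μ (monomial m a) = a * lineMoment μ (X ^ m) := by
  rw [← C_mul_X_pow_eq_monomial, lineMoment_C_mul]

/-- The adjoint of the Dunkl operator. -/
theorem lineMoment_dunkl_adjoint {μ : ℝ} (hμ : 0 ≤ μ) (f g : ℝ[X]) :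
    lineMoment μ (dunkl μ f * g) + lineMoment μ (f * dunkl μ g) = 2 * lineMoment μ (X * f * g) := by
  induction f using Polynomial.induction_on' with
  | add p q hp hq =>
    simp only [map_add, add_mul, mul_add, lineMoment_add hμ]
    linarith
  | monomial a x =>
    induction g using Polynomial.induction_on' with
    | add p q hp hq =>
      simp only [map_add, mul_add, lineMoment_add hμ]
      linarith
    | monomial b y =>
      rw [dunkl_monomial, dunkl_monomial, X_mul_monomial, monomial_mul_monomial,
        monomial_mul_monomial, monomial_mul_monomial, lineMoment_monomial, lineMoment_monomial,
        lineMoment_monomial]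
      have key : dunklCoeff μ a * lineMoment μ (X ^ (a - 1 + b)) + dunklCoeff μ b *
          lineMoment μ (X ^ (a + (b - 1))) = 2 * lineMoment μ (X ^ (a + 1 + b)) := by
        have e1 : dunklCoeff μ a * lineMoment μ (X ^ (a - 1 + b))
            = dunklCoeff μ a * lineMoment μ (X ^ (a + b - 1)) := by
          rcases Nat.eq_zero_or_pos a with rfl | h
          · simp [dunklCoeff_zero]
          · rw [show a - 1 + b = a + b - 1 by omega]
        have e2 : dunklCoeff μ b * lineMoment μ (X ^ (a + (b - 1)))
            = dunklCoeff μ b * lineMoment μ (X ^ (a + b - 1)) := by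
          rcases Nat.eq_zero_or_pos b with rfl | h
          · simp [dunklCoeff_zero]
          · rw [show a + (b - 1) = a + b - 1 by omega]
        rw [e1, e2, ← add_mul]
        rcases Nat.even_or_odd (a + b) with h | h
        · rw [lineMoment_X_pow_odd μ (show Odd (a + 1 + b) by
            rw [show a + 1 + b = a + b + 1 by ring]; exact h.add_one)]
          rcases Nat.eq_zero_or_pos (a + b) with h0 | h0
          · have : a = 0 ∧ b = 0 := by omega
            simp [this.1, this.2, dunklCoeff_zero]
          · rw [lineMoment_X_pow_odd μ (show Odd (a + b - 1) from Nat.Even.sub_odd h0 h odd_one)]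
            ring
        · obtain ⟨c, hc⟩ := h
          -- When `a + b` is odd, exactly one of the two exponents is odd and carries the `2μ`. The
          -- resulting factor is the one in `Γ(z + 1) = z Γ(z)` for consecutive even moments.
          have hs : dunklCoeff μ a + dunklCoeff μ b = 2 * c + 1 + 2 * μ := by
            have hab : (a : ℝ) + b = 2 * c + 1 := by exact_mod_cast hc
            rcases Nat.even_or_odd a with h | h
            · have hb : Odd b := by
                rcases Nat.even_or_odd b with h' | h'
                · exact absurd (h.add h') (Nat.not_even_iff_odd.2 ⟨c, hc⟩)
                · exact h'
              simp only [dunklCoeff, Nat.not_odd_iff_even.2 h, hb, if_true, if_false]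
              linarith
            · have hb : ¬ Odd b := fun h' => absurd (h.add_odd h') (Nat.not_even_iff_odd.2 ⟨c, hc⟩)
              simp only [dunklCoeff, h, hb, if_true, if_false]
              linarith
          rw [hs, show a + b - 1 = 2 * c by omega, show a + 1 + b = 2 * c + 2 by omega,
            lineMoment_X_pow_even hμ (even_two_mul c),
            lineMoment_X_pow_even hμ (show Even (2 * c + 2) from ⟨c + 1, by ring⟩)]
          have h0 : ((2 * c : ℕ) + 2 * μ + 1 : ℝ) / 2 ≠ 0 := by positivity
          rw [show (((2 * c + 2 : ℕ) : ℝ) + 2 * μ + 1) / 2 = ((2 * c : ℕ) + 2 * μ + 1 : ℝ) / 2 + 1 by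
            push_cast; ring, Real.Gamma_add_one h0]
          push_cast
          ring
      linear_combination (x * y) * key

theorem dunkl_X_mul (μ : ℝ) (f : ℝ[X]) :
    dunkl μ (X * f) = X * dunkl μ f + f + C (2 * μ) * f.comp (-X) := by
  induction f using Polynomial.induction_on' with
  | add p q hp hq => simp only [map_add, mul_add, add_comp, hp, hq]; ring
  | monomial m a =>
    have h1 : (monomial m a).comp (-X : ℝ[X]) = monomial m ((-1) ^ m * a) := by
      rw [monomial_comp, neg_pow, ← C_mul_X_pow_eq_monomial]
      simp; ring
    rw [X_mul_monomial, dunkl_monomial, dunkl_monomial, h1, C_mul_monomial, X_mul_monomial]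
    rcases Nat.eq_zero_or_pos m with rfl | hm
    · rw [dunklCoeff_succ, dunklCoeff_zero]
      simp only [zero_add, pow_zero, mul_one, zero_mul, map_zero, one_mul, ← map_add]
      congr 1
      ring
    · rw [show m - 1 + 1 = m by omega, show m + 1 - 1 = m by omega, ← map_add, ← map_add,
        dunklCoeff_succ]
      congr 1
      ring

/-- The recursion coefficients of the monic orthogonal polynomials. -/
noncomputable def hermiteCoeff (μ : ℝ) (k : ℕ) : ℝ := dunklCoeff μ k / 2

/-- The monic orthogonal polynomials of the weight `|s|^{2μ} exp(-s²)`. -/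
noncomputable def genHermite (μ : ℝ) : ℕ → ℝ[X]
  | 0 => 1
  | 1 => X
  | k + 2 => X * genHermite μ (k + 1) - C (hermiteCoeff μ (k + 1)) * genHermite μ k

theorem genHermite_succ_succ (μ : ℝ) (k : ℕ) : genHermite μ (k + 2)
    = X * genHermite μ (k + 1) - C (hermiteCoeff μ (k + 1)) * genHermite μ k := rfl

theorem genHermite_comp_neg (μ : ℝ) (k : ℕ) :
    (genHermite μ k).comp (-X) = C ((-1) ^ k) * genHermite μ k := by
  induction k using Nat.strong_induction_on with
  | _ k ih =>
    match k with
    | 0 => simp [genHermite]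
    | 1 => simp [genHermite]
    | k + 2 =>
      rw [genHermite_succ_succ, sub_comp, mul_comp, mul_comp, X_comp, C_comp, ih (k + 1) (by omega),
        ih k (by omega)]
      simp only [pow_succ, map_mul, map_neg, map_one]
      ring

theorem dunkl_one (μ : ℝ) : dunkl μ 1 = 0 := by
  have := dunkl_monomial μ 0 1
  simpa [dunklCoeff_zero] using this

/-- The Dunkl operator lowers the degree as the derivative does for Hermite polynomials. In the
recursion, the reflected term of `dunkl_X_mul` is evaluated by parity and supplies the alternating
part of `dunklCoeff_succ`. -/
theorem dunkl_genHermite_succ (μ : ℝ) (k : ℕ) :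
    dunkl μ (genHermite μ (k + 1)) = C (dunklCoeff μ (k + 1)) * genHermite μ k := by
  induction k using Nat.strong_induction_on with
  | _ k ih =>
    match k with
    | 0 =>
      have := dunkl_monomial μ 1 1
      simpa [genHermite, ← C_mul_X_pow_eq_monomial] using this
    | k + 1 =>
      rw [genHermite_succ_succ, map_sub, dunkl_X_mul, ih k (by omega), genHermite_comp_neg,
        dunklCoeff_succ μ (k + 1)]
      have hl : dunkl μ (C (hermiteCoeff μ (k + 1)) * genHermite μ k)
          = C (hermiteCoeff μ (k + 1)) * dunkl μ (genHermite μ k) := by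
        rw [← smul_eq_C_mul, map_smul, smul_eq_C_mul]
      rw [hl]
      match k with
      | 0 =>
        rw [show genHermite μ 0 = 1 from rfl, dunkl_one]
        simp [genHermite]
        ring
      | k + 1 =>
        rw [ih k (by omega), genHermite_succ_succ]
        simp only [hermiteCoeff, div_eq_mul_inv, map_mul, map_add, map_one]
        ring

theorem genHermite_succ (μ : ℝ) (k : ℕ) :
    genHermite μ (k + 1) = X * genHermite μ k - C (1 / 2) * dunkl μ (genHermite μ k) := by
  match k with
  | 0 => simp [genHermite, dunkl_one]
  | k + 1 =>
    rw [genHermite_succ_succ, dunkl_genHermite_succ, hermiteCoeff, ← mul_assoc, ← C_mul]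
    congr 3
    ring

/-- `genHermite_succ` raises the degree by `X - T/2`, with `T` the Dunkl operator, and this is the
adjoint of `T/2`. Orthogonality and the norms follow by moving `T` to the other factor. -/
theorem lineMoment_genHermite_succ_mul {μ : ℝ} (hμ : 0 ≤ μ) (k : ℕ) (g : ℝ[X]) :
    lineMoment μ (genHermite μ (k + 1) * g) = 1 / 2 * lineMoment μ (genHermite μ k * dunkl μ g) := by
  rw [genHermite_succ, sub_mul, lineMoment_sub hμ, mul_assoc (C _), lineMoment_C_mul]
  linarith [lineMoment_dunkl_adjoint hμ (genHermite μ k) g]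

theorem lineMoment_genHermite_succ_succ {μ : ℝ} (hμ : 0 ≤ μ) (j k : ℕ) :
    lineMoment μ (genHermite μ (k + 1) * genHermite μ (j + 1))
      = hermiteCoeff μ (j + 1) * lineMoment μ (genHermite μ k * genHermite μ j) := by
  rw [lineMoment_genHermite_succ_mul hμ, dunkl_genHermite_succ, mul_left_comm, lineMoment_C_mul,
    hermiteCoeff]
  ring

theorem lineMoment_genHermite_of_ne {μ : ℝ} (hμ : 0 ≤ μ) {j k : ℕ} (h : j ≠ k) :
    lineMoment μ (genHermite μ j * genHermite μ k) = 0 := by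
  have h0 : ∀ k, lineMoment μ (genHermite μ (k + 1) * genHermite μ 0) = 0 := by
    intro k
    rw [lineMoment_genHermite_succ_mul hμ, show genHermite μ 0 = 1 from rfl, dunkl_one]
    simp [lineMoment]
  induction j generalizing k with
  | zero =>
    obtain ⟨m, rfl⟩ := Nat.exists_eq_succ_of_ne_zero h.symm
    rw [mul_comm]
    exact h0 m
  | succ j ih =>
    cases k with
    | zero => exact h0 j
    | succ k => rw [lineMoment_genHermite_succ_succ hμ, ih (by omega), mul_zero]

theorem lineMoment_genHermite_sq_pos {μ : ℝ} (hμ : 0 ≤ μ) (k : ℕ) :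
    0 < lineMoment μ (genHermite μ k * genHermite μ k) := by
  induction k with
  | zero =>
    have := lineMoment_X_pow_even hμ (m := 0) (by simp)
    simp only [pow_zero] at this
    rw [show genHermite μ 0 = 1 from rfl, mul_one, this]
    exact Real.Gamma_pos_of_pos (by positivity)
  | succ k ih =>
    rw [lineMoment_genHermite_succ_succ hμ]
    exact mul_pos (half_pos (dunklCoeff_succ_pos hμ k)) ih

theorem genHermite_monic_natDegree (μ : ℝ) (k : ℕ) :
    (genHermite μ k).Monic ∧ (genHermite μ k).natDegree = k := by
  induction k using Nat.strong_induction_on with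
  | _ k ih =>
    match k with
    | 0 => simp [genHermite]
    | 1 => simp [genHermite, monic_X]
    | k + 2 =>
      obtain ⟨m1, d1⟩ := ih (k + 1) (by omega)
      obtain ⟨m0, d0⟩ := ih k (by omega)
      have hm : (X * genHermite μ (k + 1)).Monic := monic_X.mul m1
      have hd : (X * genHermite μ (k + 1)).natDegree = k + 2 := by
        rw [monic_X.natDegree_mul m1, d1, natDegree_X]; ring
      have hlt : (C (hermiteCoeff μ (k + 1)) * genHermite μ k).natDegree
          < (X * genHermite μ (k + 1)).natDegree := by
        refine (natDegree_C_mul_le _ _).trans_lt ?_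
        rw [d0, hd]
        omega
      rw [genHermite_succ_succ]
      exact ⟨hm.sub_of_left (degree_lt_degree hlt),
        (natDegree_sub_eq_left_of_natDegree_lt hlt).trans hd⟩

end GeneralizedHermite

/-! ### Determinantal formula and the bound `det G ≤ exp(tr(G - 1))` -/

section DeterminantBound

open Polynomial

/-- Each eigenvalue satisfies `0 ≤ λ ≤ exp(λ - 1)`; multiply over the spectrum. -/
theorem Matrix.PosSemidef.det_le_exp_trace_sub {ι : Type*} [Fintype ι] [DecidableEq ι]
    {A : Matrix ι ι ℝ} (hA : A.PosSemidef) : A.det ≤ Real.exp (∑ i, (A i i - 1)) := by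
  have htr : ∑ i, (A i i - 1) = ∑ i, (hA.isHermitian.eigenvalues i - 1) := by
    have := hA.isHermitian.trace_eq_sum_eigenvalues
    simp only [Matrix.trace, Matrix.diag_apply, RCLike.ofReal_real_eq_id, id] at this
    rw [Finset.sum_sub_distrib, Finset.sum_sub_distrib, this]
  rw [htr, hA.isHermitian.det_eq_prod_eigenvalues, Real.exp_sum]
  refine Finset.prod_le_prod (fun i _ => hA.eigenvalues_nonneg i) fun i _ => ?_
  have := Real.add_one_le_exp (hA.isHermitian.eigenvalues i - 1)
  simpa using this

/-- The integral of a product of determinants is the determinant of the integrals. -/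
theorem integral_det_mul_det {n : ℕ} (f g : Fin n → ℝ → ℝ) (w : ℝ → ℝ)
    (hGint : ∀ i j, Integrable fun s => f i s * g j s * w s) :
    ∫ l : Fin n → ℝ, (Matrix.of fun i j => f j (l i)).det * (Matrix.of fun i j => g j (l i)).det
        * ∏ i, w (l i)
      = n.factorial * (Matrix.of fun i j => ∫ s, f i s * g j s * w s).det := by
  have h1 : ∀ l : Fin n → ℝ, (Matrix.of fun i j => f j (l i)).det *
      (Matrix.of fun i j => g j (l i)).det * ∏ i, w (l i)
      = ∑ σ : Equiv.Perm (Fin n), ∑ τ : Equiv.Perm (Fin n),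
        ((Equiv.Perm.sign σ : ℤ) : ℝ) * ((Equiv.Perm.sign τ : ℤ) : ℝ)
          * ∏ i, (f (σ i) (l i) * g (τ i) (l i) * w (l i)) := by
    intro l
    rw [← Matrix.det_transpose, Matrix.det_apply', ← Matrix.det_transpose (Matrix.of fun i j => g j (l i)),
      Matrix.det_apply', Finset.sum_mul_sum, Finset.sum_mul]
    refine Finset.sum_congr rfl fun σ _ => ?_
    rw [Finset.sum_mul]
    refine Finset.sum_congr rfl fun τ _ => ?_
    simp only [Matrix.transpose_apply, Matrix.of_apply, Finset.prod_mul_distrib]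
    ring
  have hi : ∀ σ τ : Equiv.Perm (Fin n), Integrable fun l : Fin n → ℝ =>
      ∏ i, (f (σ i) (l i) * g (τ i) (l i) * w (l i)) := fun σ τ =>
    Integrable.fintype_prod (f := fun i s => f (σ i) s * g (τ i) s * w s) fun i => hGint _ _
  simp_rw [h1]
  rw [integral_finsetSum _ fun σ _ => integrable_finsetSum _ fun τ _ => (hi σ τ).const_mul _]
  have h2 : ∀ σ : Equiv.Perm (Fin n), ∫ l : Fin n → ℝ, ∑ τ : Equiv.Perm (Fin n),
        ((Equiv.Perm.sign σ : ℤ) : ℝ) * ((Equiv.Perm.sign τ : ℤ) : ℝ)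
          * ∏ i, (f (σ i) (l i) * g (τ i) (l i) * w (l i))
      = (Matrix.of fun i j => ∫ s, f i s * g j s * w s).det := by
    intro σ
    rw [integral_finsetSum _ fun τ _ => (hi σ τ).const_mul _]
    have h3 : ∀ τ : Equiv.Perm (Fin n), ∫ l : Fin n → ℝ, ((Equiv.Perm.sign σ : ℤ) : ℝ)
          * ((Equiv.Perm.sign τ : ℤ) : ℝ) * ∏ i, (f (σ i) (l i) * g (τ i) (l i) * w (l i))
        = ((Equiv.Perm.sign σ : ℤ) : ℝ) * (((Equiv.Perm.sign τ : ℤ) : ℝ)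
          * ∏ i, (Matrix.of fun i j => ∫ s, f j s * g i s * w s).submatrix id σ (τ i) i) := by
      intro τ
      rw [integral_const_mul, mul_assoc,
        integral_fintype_prod_volume_eq_prod fun i s => f (σ i) s * g (τ i) s * w s]
      rfl
    simp_rw [h3]
    rw [← Finset.mul_sum, ← Matrix.det_apply', Matrix.det_permute', ← mul_assoc]
    rw [← Int.cast_mul, Int.units_coe_mul_self, Int.cast_one, one_mul, ← Matrix.det_transpose]
    rfl
  simp_rw [h2]
  simp [Fintype.card_perm]

/-- The quadratic form at `x` is the moment of `g (∑ x_i p_i)²`, which is nonnegative. -/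
theorem lineMoment_gram_posSemidef {μ : ℝ} (hμ : 0 ≤ μ) {n : ℕ} {g : ℝ[X]}
    (hg : ∀ s, 0 ≤ g.eval s) (p : Fin n → ℝ[X]) :
    (Matrix.of fun i j => lineMoment μ (g * p i * p j)).PosSemidef := by
  refine Matrix.PosSemidef.of_dotProduct_mulVec_nonneg ?_ fun x => ?_
  · ext i j
    simp only [Matrix.conjTranspose_apply, Matrix.of_apply, star_trivial]
    congr 1
    ring
  · have h : star x ⬝ᵥ (Matrix.of fun i j => lineMoment μ (g * p i * p j)).mulVec x
        = lineMoment μ (g * (∑ i, C (x i) * p i) ^ 2) := by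
      simp only [dotProduct, Matrix.mulVec, Matrix.of_apply, star_trivial, Pi.star_apply]
      rw [sq, Finset.sum_mul_sum, Finset.mul_sum, lineMoment_sum hμ]
      refine Finset.sum_congr rfl fun i _ => ?_
      rw [Finset.mul_sum, Finset.mul_sum, lineMoment_sum hμ]
      refine Finset.sum_congr rfl fun j _ => ?_
      rw [show g * (C (x i) * p i * (C (x j) * p j)) = C (x i) * (C (x j) * (g * p i * p j)) by ring,
        lineMoment_C_mul, lineMoment_C_mul]
      ring
    rw [h]
    refine lineMoment_nonneg fun s => ?_
    rw [eval_mul, eval_pow]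
    exact mul_nonneg (hg s) (sq_nonneg _)

/-- The eigenvalue integral of a product function. -/
noncomputable def eigenvalueIntegral (n : ℕ) (μ : ℝ) (g : ℝ[X]) : ℝ :=
  ∫ l : Fin n → ℝ, (∏ i, g.eval (l i)) * (∏ i, lineWeight μ (l i)) * vandermondeProd l ^ 2

/-- The Vandermonde determinant is unchanged when monomials are replaced by monic polynomials of the
same degrees; Andréief's identity `integral_det_mul_det` does the rest. -/
theorem eigenvalueIntegral_eq_det {μ : ℝ} (hμ : 0 ≤ μ) (n : ℕ) (g : ℝ[X]) :
    eigenvalueIntegral n μ g = n.factorial * (Matrix.of fun i j : Fin n =>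
      lineMoment μ (g * genHermite μ i * genHermite μ j)).det := by
  have h := integral_det_mul_det (n := n) (fun i s => (genHermite μ i).eval s)
    (fun i s => (genHermite μ i).eval s) (fun s => g.eval s * lineWeight μ s) (by
      intro i j
      refine (integrable_eval_mul_lineWeight hμ
        (g * genHermite μ i * genHermite μ j)).congr (ae_of_all _ fun s => ?_)
      simp only [eval_mul]
      ring)
  rw [eigenvalueIntegral]
  refine Eq.trans (integral_congr_ae (ae_of_all _ fun l => ?_)) (h.trans ?_)
  · beta_reduce
    rw [vandermondeProd_eq_det, Matrix.det_eval_matrixOfPolynomials_eq_det_vandermonde l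
      (fun i : Fin n => genHermite μ i) (fun i => (genHermite_monic_natDegree μ i).2)
      (fun i => (genHermite_monic_natDegree μ i).1), Finset.prod_mul_distrib]
    ring
  · congr 3
    ext i j
    refine integral_congr_ae (ae_of_all _ fun s => ?_)
    simp only [eval_mul]
    ring

/-- The diagonal matrix element of multiplication by `g` at the `k`-th orthonormal polynomial. -/
noncomputable def hermiteDiag (μ : ℝ) (g : ℝ[X]) (k : ℕ) : ℝ :=
  lineMoment μ (g * genHermite μ k * genHermite μ k)
    / lineMoment μ (genHermite μ k * genHermite μ k)

theorem eigenvalueIntegral_one {μ : ℝ} (hμ : 0 ≤ μ) (n : ℕ) :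
    eigenvalueIntegral n μ 1 = n.factorial *
      ∏ k : Fin n, lineMoment μ (genHermite μ k * genHermite μ k) := by
  rw [eigenvalueIntegral_eq_det hμ]
  congr 1
  rw [show (Matrix.of fun i j : Fin n => lineMoment μ (1 * genHermite μ i * genHermite μ j))
    = Matrix.diagonal fun k : Fin n => lineMoment μ (genHermite μ k * genHermite μ k) by
      ext i j
      rw [Matrix.of_apply, one_mul]
      by_cases h : i = j
      · subst h; simp
      · rw [Matrix.diagonal_apply_ne _ h,
          lineMoment_genHermite_of_ne hμ fun h' => h (Fin.ext h')]]
  exact Matrix.det_diagonal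

theorem eigenvalueIntegral_one_pos {μ : ℝ} (hμ : 0 ≤ μ) (n : ℕ) :
    0 < eigenvalueIntegral n μ 1 := by
  rw [eigenvalueIntegral_one hμ]
  have := Finset.prod_pos fun (k : Fin n) (_ : k ∈ Finset.univ) =>
    lineMoment_genHermite_sq_pos hμ (k : ℕ)
  positivity

/-- Normalizing the polynomials turns the Gram matrix for `g = 1` into the identity, so
`eigenvalueIntegral n μ 1` factors out and the determinant bound compares `G` with 1. -/
theorem eigenvalueIntegral_le {μ : ℝ} (hμ : 0 ≤ μ) (n : ℕ) {g : ℝ[X]} (hg : ∀ s, 0 ≤ g.eval s) :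
    eigenvalueIntegral n μ g
      ≤ eigenvalueIntegral n μ 1 * Real.exp (∑ k ∈ Finset.range n, (hermiteDiag μ g k - 1)) := by
  set h : Fin n → ℝ := fun k => lineMoment μ (genHermite μ k * genHermite μ k) with hh
  have hpos : ∀ k, 0 < h k := fun k => lineMoment_genHermite_sq_pos hμ _
  set p : Fin n → ℝ[X] := fun k => C (√(h k))⁻¹ * genHermite μ k with hp
  set G := Matrix.of fun i j => lineMoment μ (g * p i * p j) with hG
  have hGe : ∀ i j, G i j = (√(h i))⁻¹ * (√(h j))⁻¹ *
      lineMoment μ (g * genHermite μ i * genHermite μ j) := by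
    intro i j
    rw [hG, Matrix.of_apply, hp]
    rw [show g * (C (√(h i))⁻¹ * genHermite μ i) * (C (√(h j))⁻¹ * genHermite μ j)
      = C (√(h i))⁻¹ * (C (√(h j))⁻¹ * (g * genHermite μ i * genHermite μ j)) by ring,
      lineMoment_C_mul, lineMoment_C_mul]
    ring
  have hM : (Matrix.of fun i j : Fin n => lineMoment μ (g * genHermite μ i * genHermite μ j))
      = Matrix.diagonal (fun k => √(h k)) * G * Matrix.diagonal (fun k => √(h k)) := by
    ext i j
    rw [Matrix.mul_diagonal, Matrix.diagonal_mul, hGe, Matrix.of_apply]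
    have h1 := (Real.sqrt_pos.2 (hpos i)).ne'
    have h2 := (Real.sqrt_pos.2 (hpos j)).ne'
    field_simp
  have hdet : (Matrix.of fun i j : Fin n =>
      lineMoment μ (g * genHermite μ i * genHermite μ j)).det = (∏ k, h k) * G.det := by
    rw [hM, Matrix.det_mul, Matrix.det_mul, Matrix.det_diagonal, mul_right_comm,
      ← Finset.prod_mul_distrib]
    congr 1
    exact Finset.prod_congr rfl fun k _ => Real.mul_self_sqrt (hpos k).le
  have hle := (lineMoment_gram_posSemidef hμ hg p).det_le_exp_trace_sub
  rw [eigenvalueIntegral_eq_det hμ, eigenvalueIntegral_one hμ, hdet, mul_assoc]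
  have hsum : ∑ k ∈ Finset.range n, (hermiteDiag μ g k - 1) = ∑ i, (G i i - 1) := by
    rw [← Fin.sum_univ_eq_sum_range (fun k => hermiteDiag μ g k - 1)]
    refine Finset.sum_congr rfl fun i _ => ?_
    rw [hGe, ← mul_inv, Real.mul_self_sqrt (hpos i).le, hermiteDiag]
    ring
  rw [hsum]
  have hP : 0 ≤ ∏ k, h k := Finset.prod_nonneg fun k _ => (hpos k).le
  gcongr

theorem prod_aeval_isSymmetric (n : ℕ) (g : ℝ[X]) :
    (∏ i, aeval (MvPolynomial.X i) g : MvPolynomial (Fin n) ℝ).IsSymmetric := by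
  intro e
  rw [map_prod]
  simp only [← Polynomial.aeval_algHom_apply, MvPolynomial.rename_X]
  exact Equiv.prod_comp e fun i => (aeval (MvPolynomial.X i) g : MvPolynomial (Fin n) ℝ)

theorem eval_prod_aeval {n : ℕ} (g : ℝ[X]) (l : Fin n → ℝ) :
    MvPolynomial.eval l (∏ i, aeval (MvPolynomial.X i) g) = ∏ i, g.eval (l i) := by
  rw [map_prod]
  refine Finset.prod_congr rfl fun i _ => ?_
  rw [← MvPolynomial.coe_aeval_eq_eval]
  change (MvPolynomial.aeval l) _ = _
  rw [← Polynomial.aeval_algHom_apply]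
  simp [Polynomial.coe_aeval_eq_eval]

theorem integral_diagonal_eq {n : ℕ} (μ : ℝ) (g : ℝ[X]) :
    ∫ x : EuclideanSpace ℝ (Fin n), (∏ i, g.eval (x i)) * |∏ i, x i| ^ (2 * μ)
      * vandermondeProd x ^ 2 * Real.exp (-‖x‖ ^ 2) = eigenvalueIntegral n μ g := by
  rw [eigenvalueIntegral, ← (PiLp.volume_preserving_toLp (Fin n)).integral_comp
    (MeasurableEquiv.toLp 2 (Fin n → ℝ)).measurableEmbedding]
  refine integral_congr_ae (ae_of_all _ fun l => ?_)
  simp only [lineWeight, Finset.prod_mul_distrib, EuclideanSpace.norm_sq_eq, Real.norm_eq_abs,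
    sq_abs, Finset.abs_prod]
  rw [← Real.finsetProd_rpow _ _ fun i _ => abs_nonneg _, ← Real.exp_sum, Finset.sum_neg_distrib]
  ring

/-- Integration formula for functions `det g(x)` on the Hermitian matrices. -/
theorem Herm.integral_prod_eval {n : ℕ} {μ : ℝ} (hμ : 0 ≤ μ) (g : ℝ[X]) :
    Integrable (fun x : Herm n => (∏ i, g.eval (x.eigs i))
      * (|∏ i, x.eigs i| ^ (2 * μ) * Real.exp (-‖x‖ ^ 2))) ∧
    (∫ x : Herm n, (∏ i, g.eval (x.eigs i)) *
        (|∏ i, x.eigs i| ^ (2 * μ) * Real.exp (-‖x‖ ^ 2))) * eigenvalueIntegral n 0 1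
      = eigenvalueIntegral n μ g * ∫ x : Herm n, Real.exp (-‖x‖ ^ 2) := by
  have h := (Herm.isSpectralModel n).weighted_comm (isSpectralModel_diagonal n)
    (a := 2 * μ) (by positivity) (prod_aeval_isSymmetric n g)
  simp only [eval_prod_aeval, one_mul, mul_one] at h
  have h0 := integral_diagonal_eq (n := n) 0 1
  simp only [eval_one, Finset.prod_const_one, mul_zero, Real.rpow_zero, one_mul] at h0
  rw [integral_diagonal_eq, h0] at h
  simp only [mul_assoc] at h ⊢
  exact ⟨h.1.1, h.2⟩

theorem Herm.integral_weight {n : ℕ} {μ : ℝ} (hμ : 0 ≤ μ) :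
    Integrable (fun x : Herm n => |∏ i, x.eigs i| ^ (2 * μ) * Real.exp (-‖x‖ ^ 2)) ∧
    (∫ x : Herm n, |∏ i, x.eigs i| ^ (2 * μ) * Real.exp (-‖x‖ ^ 2)) * eigenvalueIntegral n 0 1
      = eigenvalueIntegral n μ 1 * ∫ x : Herm n, Real.exp (-‖x‖ ^ 2) := by
  have h := Herm.integral_prod_eval (n := n) hμ 1
  simpa only [eval_one, Finset.prod_const_one, one_mul] using h

theorem Herm.integral_weight_pos {n : ℕ} {μ : ℝ} (hμ : 0 ≤ μ) :
    0 < ∫ x : Herm n, |∏ i, x.eigs i| ^ (2 * μ) * Real.exp (-‖x‖ ^ 2) := by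
  have hE : 0 < ∫ x : Herm n, Real.exp (-‖x‖ ^ 2) := by
    have := GaussianFourier.integral_rexp_neg_mul_sq_norm (V := Herm n) (b := 1) one_pos
    simp only [neg_mul, one_mul] at this
    rw [this]
    positivity
  have h2 := mul_pos (eigenvalueIntegral_one_pos hμ n) hE
  rw [← (Herm.integral_weight hμ).2] at h2
  exact pos_of_mul_pos_left h2 (eigenvalueIntegral_one_pos le_rfl n).le

/-- The expectation of `det g(x)` for a nonnegative polynomial `g` is controlled by the diagonal
matrix elements of `g` in the orthonormal polynomials. -/
theorem Herm.integral_prod_eval_le {n : ℕ} {μ : ℝ} (hμ : 0 ≤ μ) {g : ℝ[X]}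
    (hg : ∀ s, 0 ≤ g.eval s) :
    ∫ x : Herm n, (∏ i, g.eval (x.eigs i)) * (|∏ i, x.eigs i| ^ (2 * μ) * Real.exp (-‖x‖ ^ 2))
      ≤ (∫ x : Herm n, |∏ i, x.eigs i| ^ (2 * μ) * Real.exp (-‖x‖ ^ 2))
        * Real.exp (∑ k ∈ Finset.range n, (hermiteDiag μ g k - 1)) := by
  have hZ := eigenvalueIntegral_one_pos le_rfl n
  have hle := eigenvalueIntegral_le hμ n hg
  have hE : 0 ≤ ∫ x : Herm n, Real.exp (-‖x‖ ^ 2) := integral_nonneg fun x => (Real.exp_pos _).le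
  refine le_of_mul_le_mul_right ?_ hZ
  -- Numerator and denominator carry the same unknown proportionality constant between the matrix
  -- and eigenvalue integrals, so it never has to be computed.
  rw [(Herm.integral_prod_eval hμ g).2, mul_right_comm, (Herm.integral_weight hμ).2, mul_right_comm]
  gcongr

end DeterminantBound

/-! ### Powers of the Jacobi operator and bounds on their diagonal -/

section JacobiOperator

open Polynomial

/-- One step of the Jacobi operator `R + r J`, with off-diagonal entries `a`, on coefficient
sequences. -/
def jacobiStep (a : ℕ → ℝ) (r R : ℝ) (c : ℕ → ℝ) : ℕ → ℝ :=
  fun j => R * c j + r * (a j * c (j - 1) + a (j + 1) * c (j + 1))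

/-- The coefficients of the `m`-th power of `R + r J` in the row `k`. -/
def jacobiPow (a : ℕ → ℝ) (r R : ℝ) (k m : ℕ) : ℕ → ℝ := (jacobiStep a r R)^[m] (Pi.single k 1)

variable {a : ℕ → ℝ} {r R : ℝ}

theorem jacobiPow_succ (k m : ℕ) :
    jacobiPow a r R k (m + 1) = jacobiStep a r R (jacobiPow a r R k m) :=
  Function.iterate_succ_apply' _ _ _

theorem jacobiPow_nonneg (ha : ∀ j, 0 ≤ a j) (hr : 0 ≤ r) (hR : 0 ≤ R) (k m j : ℕ) :
    0 ≤ jacobiPow a r R k m j := by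
  induction m generalizing j with
  | zero =>
    simp only [jacobiPow, Function.iterate_zero, id, Pi.single_apply]
    split_ifs <;> norm_num
  | succ m ih =>
    rw [jacobiPow_succ]
    have := ha j
    have := ha (j + 1)
    have := ih j
    have := ih (j - 1)
    have := ih (j + 1)
    unfold jacobiStep
    positivity

theorem jacobiPow_eq_zero {k m j : ℕ} (h : k + m < j ∨ j + m < k) : jacobiPow a r R k m j = 0 := by
  induction m generalizing j with
  | zero =>
    simp only [jacobiPow, Function.iterate_zero, id]
    exact Pi.single_eq_of_ne (by omega) _
  | succ m ih =>
    rw [jacobiPow_succ, jacobiStep, ih (by omega), ih (by omega), ih (by omega)]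
    ring

/-- Summation by parts, using the symmetry of the Jacobi matrix; `a 0 = 0` neutralizes the truncated
index `0 - 1`. It serves for `v = 1` (row sums) and for `v` the orthonormal polynomials
(multiplication by `rX + R`). -/
theorem sum_jacobiStep_smul {V : Type*} [AddCommGroup V] [Module ℝ V] (ha : a 0 = 0) (v : ℕ → V)
    {c : ℕ → ℝ} {N : ℕ} (hc : ∀ j, N ≤ j → c j = 0) :
    ∑ j ∈ Finset.range (N + 1), jacobiStep a r R c j • v j
      = ∑ j ∈ Finset.range N,
        c j • (R • v j + r • (a (j + 1) • v (j + 1) + a j • v (j - 1))) := by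
  have h1 : ∑ j ∈ Finset.range (N + 1), (R * c j) • v j
      = ∑ j ∈ Finset.range N, (R * c j) • v j := by
    rw [Finset.sum_range_succ, hc N le_rfl]; simp
  have h2 : ∑ j ∈ Finset.range (N + 1), (r * (a j * c (j - 1))) • v j
      = ∑ j ∈ Finset.range N, (r * (a (j + 1) * c j)) • v (j + 1) := by
    rw [Finset.sum_range_succ']
    simp [ha]
  have h3 : ∑ j ∈ Finset.range (N + 1), (r * (a (j + 1) * c (j + 1))) • v j
      = ∑ j ∈ Finset.range N, (r * (a j * c j)) • v (j - 1) := by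
    have e := Finset.sum_range_succ' (fun j => (r * (a j * c j)) • v (j - 1)) (N + 1)
    simp only [ha, zero_mul, mul_zero, zero_smul, add_zero, Nat.add_sub_cancel] at e
    rw [← e, Finset.sum_range_succ, Finset.sum_range_succ, hc N le_rfl, hc (N + 1) (by omega)]
    simp
  have h4 : ∀ j, jacobiStep a r R c j • v j = (R * c j) • v j + (r * (a j * c (j - 1))) • v j
      + (r * (a (j + 1) * c (j + 1))) • v j := by
    intro j
    rw [jacobiStep, mul_add, ← add_assoc, add_smul, add_smul]
  simp_rw [h4]
  rw [Finset.sum_add_distrib, Finset.sum_add_distrib, h1, h2, h3, ← Finset.sum_add_distrib,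
    ← Finset.sum_add_distrib]
  refine Finset.sum_congr rfl fun j _ => ?_
  module

theorem sum_jacobiPow_succ (ha : a 0 = 0) (k m : ℕ) :
    ∑ j ∈ Finset.range (k + (m + 1) + 1), jacobiPow a r R k (m + 1) j
      = ∑ j ∈ Finset.range (k + m + 1), jacobiPow a r R k m j * (R + r * (a j + a (j + 1))) := by
  have h := sum_jacobiStep_smul (r := r) (R := R) ha (fun _ => (1 : ℝ))
    (c := jacobiPow a r R k m) (N := k + m + 1) fun j hj => jacobiPow_eq_zero (by omega)
  simp only [smul_eq_mul, mul_one] at h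
  rw [jacobiPow_succ, show k + (m + 1) + 1 = k + m + 1 + 1 by ring, h]
  exact Finset.sum_congr rfl fun j _ => by ring

theorem sum_jacobiPow_zero (k : ℕ) : ∑ j ∈ Finset.range (k + 0 + 1), jacobiPow a r R k 0 j = 1 := by
  simp [jacobiPow]

theorem sum_jacobiPow_le (ha : ∀ j, 0 ≤ a j) (ha0 : a 0 = 0) (hr : 0 ≤ r) (hR : 0 ≤ R) {k m : ℕ}
    {B : ℝ} (hB0 : 0 ≤ B) (hB : ∀ j, j + 1 ≤ k + m → R + r * (a j + a (j + 1)) ≤ B) :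
    ∑ j ∈ Finset.range (k + m + 1), jacobiPow a r R k m j ≤ B ^ m := by
  induction m with
  | zero => rw [sum_jacobiPow_zero, pow_zero]
  | succ m ih =>
    rw [sum_jacobiPow_succ ha0, pow_succ]
    refine le_trans ?_ (mul_le_mul_of_nonneg_right (ih fun j hj => hB j (by omega)) hB0)
    rw [Finset.sum_mul]
    refine Finset.sum_le_sum fun j hj => ?_
    rw [Finset.mem_range] at hj
    exact mul_le_mul_of_nonneg_left (hB j (by omega)) (jacobiPow_nonneg ha hr hR k m j)

theorem le_sum_jacobiPow (ha : ∀ j, 0 ≤ a j) (ha0 : a 0 = 0) (hr : 0 ≤ r) (hR : 0 ≤ R) {k m : ℕ}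
    {B : ℝ} (hB0 : 0 ≤ B) (hB : ∀ j, k ≤ j + m → B ≤ R + r * (a j + a (j + 1))) :
    B ^ m ≤ ∑ j ∈ Finset.range (k + m + 1), jacobiPow a r R k m j := by
  induction m with
  | zero => rw [sum_jacobiPow_zero, pow_zero]
  | succ m ih =>
    rw [sum_jacobiPow_succ ha0, pow_succ]
    refine (mul_le_mul_of_nonneg_right (ih fun j hj => hB j (by omega)) hB0).trans ?_
    rw [Finset.sum_mul]
    refine Finset.sum_le_sum fun j hj => ?_
    rcases lt_or_ge (j + m) k with h | h
    · rw [jacobiPow_eq_zero (Or.inr h)]; simp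
    · exact mul_le_mul_of_nonneg_left (hB j (by omega)) (jacobiPow_nonneg ha hr hR k m j)

theorem sum_sq_jacobiPow_le (ha : ∀ j, 0 ≤ a j) (ha0 : a 0 = 0) (hr : 0 ≤ r) (hR : 0 ≤ R)
    {k m : ℕ} {B : ℝ} (hB0 : 0 ≤ B) (hB : ∀ j, j + 1 ≤ k + m → R + r * (a j + a (j + 1)) ≤ B) :
    ∑ j ∈ Finset.range (k + m + 1), jacobiPow a r R k m j ^ 2 ≤ B ^ (2 * m) := by
  have hn := jacobiPow_nonneg ha hr hR k m
  refine (Finset.sum_sq_le_sq_sum_of_nonneg fun j _ => hn j).trans ?_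
  rw [mul_comm, pow_mul]
  have := sum_jacobiPow_le ha ha0 hr hR hB0 hB
  have h0 : 0 ≤ ∑ j ∈ Finset.range (k + m + 1), jacobiPow a r R k m j :=
    Finset.sum_nonneg fun j _ => hn j
  gcongr

/-- The row is supported on `|j - k| ≤ m`, at most `2m + 1` indices, so Cauchy-Schwarz bounds the
sum of squares from below by the squared row sum over `2m + 1`. -/
theorem le_sum_sq_jacobiPow (ha : ∀ j, 0 ≤ a j) (ha0 : a 0 = 0) (hr : 0 ≤ r) (hR : 0 ≤ R)
    {k m : ℕ} {B : ℝ} (hB0 : 0 ≤ B) (hB : ∀ j, k ≤ j + m → B ≤ R + r * (a j + a (j + 1))) :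
    B ^ (2 * m) ≤ (2 * m + 1) * ∑ j ∈ Finset.range (k + m + 1), jacobiPow a r R k m j ^ 2 := by
  have h1 := le_sum_jacobiPow ha ha0 hr hR hB0 hB
  set s := (Finset.range (k + m + 1)).filter fun j => k ≤ j + m with hs
  have h2 : ∑ j ∈ Finset.range (k + m + 1), jacobiPow a r R k m j
      = ∑ j ∈ s, jacobiPow a r R k m j := by
    rw [hs, Finset.sum_filter]
    refine Finset.sum_congr rfl fun j _ => ?_
    split_ifs with h
    · rfl
    · exact jacobiPow_eq_zero (Or.inr (by omega))
  have hcard : s.card ≤ 2 * m + 1 := by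
    have : s ⊆ Finset.Ico (k - m) (k + m + 1) := by
      intro j hj
      rw [hs, Finset.mem_filter, Finset.mem_range] at hj
      rw [Finset.mem_Ico]
      omega
    refine (Finset.card_le_card this).trans ?_
    rw [Nat.card_Ico]
    omega
  have h3 := sq_sum_le_card_mul_sum_sq (s := s) (f := jacobiPow a r R k m)
  rw [mul_comm 2 m, pow_mul]
  calc (B ^ m) ^ 2 ≤ (∑ j ∈ Finset.range (k + m + 1), jacobiPow a r R k m j) ^ 2 := by gcongr
    _ ≤ s.card * ∑ j ∈ s, jacobiPow a r R k m j ^ 2 := by rw [h2]; exact h3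
    _ ≤ (2 * m + 1) * ∑ j ∈ Finset.range (k + m + 1), jacobiPow a r R k m j ^ 2 := by
      have h4 : ∑ j ∈ s, jacobiPow a r R k m j ^ 2
          ≤ ∑ j ∈ Finset.range (k + m + 1), jacobiPow a r R k m j ^ 2 :=
        Finset.sum_le_sum_of_subset_of_nonneg (Finset.filter_subset _ _)
          fun _ _ _ => sq_nonneg _
      have h5 : (s.card : ℝ) ≤ 2 * m + 1 := by exact_mod_cast hcard
      have h6 : 0 ≤ ∑ j ∈ s, jacobiPow a r R k m j ^ 2 := Finset.sum_nonneg fun _ _ => sq_nonneg _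
      gcongr

/-- The orthonormal polynomials. -/
noncomputable def hermiteOrtho (μ : ℝ) (k : ℕ) : ℝ[X] :=
  C (√(lineMoment μ (genHermite μ k * genHermite μ k)))⁻¹ * genHermite μ k

/-- The off-diagonal Jacobi coefficients. -/
noncomputable def jacobiCoeff (μ : ℝ) (k : ℕ) : ℝ := √(hermiteCoeff μ k)

theorem jacobiCoeff_zero (μ : ℝ) : jacobiCoeff μ 0 = 0 := by
  simp [jacobiCoeff, hermiteCoeff, dunklCoeff_zero]

theorem jacobiCoeff_nonneg (μ : ℝ) (k : ℕ) : 0 ≤ jacobiCoeff μ k := Real.sqrt_nonneg _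

theorem lineMoment_hermiteOrtho_mul {μ : ℝ} (hμ : 0 ≤ μ) (j k : ℕ) :
    lineMoment μ (hermiteOrtho μ j * hermiteOrtho μ k) = if j = k then 1 else 0 := by
  have h : hermiteOrtho μ j * hermiteOrtho μ k
      = C (√(lineMoment μ (genHermite μ j * genHermite μ j)))⁻¹ *
        (C (√(lineMoment μ (genHermite μ k * genHermite μ k)))⁻¹ *
          (genHermite μ j * genHermite μ k)) := by
    simp only [hermiteOrtho]; ring
  rw [h, lineMoment_C_mul, lineMoment_C_mul]
  split_ifs with hjk
  · subst hjk
    have hp := lineMoment_genHermite_sq_pos hμ j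
    rw [← mul_assoc, ← mul_inv, Real.mul_self_sqrt hp.le, inv_mul_cancel₀ hp.ne']
  · rw [lineMoment_genHermite_of_ne hμ hjk]; ring

theorem X_mul_hermiteOrtho {μ : ℝ} (hμ : 0 ≤ μ) (k : ℕ) :
    X * hermiteOrtho μ k = C (jacobiCoeff μ (k + 1)) * hermiteOrtho μ (k + 1)
      + C (jacobiCoeff μ k) * hermiteOrtho μ (k - 1) := by
  have hγ : ∀ k, 0 < hermiteCoeff μ (k + 1) := fun k => half_pos (dunklCoeff_succ_pos hμ k)
  have hs : ∀ k, √(lineMoment μ (genHermite μ (k + 1) * genHermite μ (k + 1)))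
      = jacobiCoeff μ (k + 1) * √(lineMoment μ (genHermite μ k * genHermite μ k)) := by
    intro k
    rw [lineMoment_genHermite_succ_succ hμ, Real.sqrt_mul (hγ k).le, jacobiCoeff]
  have hj : ∀ k, 0 < jacobiCoeff μ (k + 1) := fun k =>
    Real.sqrt_pos.2 (hγ k)
  have hp : ∀ k, 0 < √(lineMoment μ (genHermite μ k * genHermite μ k)) := fun k =>
    Real.sqrt_pos.2 (lineMoment_genHermite_sq_pos hμ k)
  have h1 : ∀ k, C (jacobiCoeff μ (k + 1)) * hermiteOrtho μ (k + 1)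
      = C (√(lineMoment μ (genHermite μ k * genHermite μ k)))⁻¹ * genHermite μ (k + 1) := by
    intro k
    rw [hermiteOrtho, ← mul_assoc, ← C_mul, hs k, mul_inv, mul_inv_cancel_left₀ (hj k).ne']
  rw [h1 k]
  cases k with
  | zero => simp [jacobiCoeff_zero, hermiteOrtho, genHermite]
  | succ k =>
    have h2 : C (jacobiCoeff μ (k + 1)) * hermiteOrtho μ k
        = C (√(lineMoment μ (genHermite μ (k + 1) * genHermite μ (k + 1))))⁻¹
          * (C (hermiteCoeff μ (k + 1)) * genHermite μ k) := by
      rw [hermiteOrtho, ← mul_assoc, ← mul_assoc, ← C_mul, ← C_mul, hs k]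
      congr 2
      have : hermiteCoeff μ (k + 1) = jacobiCoeff μ (k + 1) * jacobiCoeff μ (k + 1) :=
        (Real.mul_self_sqrt (hγ k).le).symm
      rw [this]
      have := (hj k).ne'
      have := (hp k).ne'
      field_simp
    rw [Nat.add_sub_cancel, h2, hermiteOrtho, genHermite_succ_succ]
    ring

theorem pow_mul_hermiteOrtho {μ : ℝ} (hμ : 0 ≤ μ) (r R : ℝ) (k m : ℕ) :
    (C r * X + C R) ^ m * hermiteOrtho μ k
      = ∑ j ∈ Finset.range (k + m + 1), jacobiPow (jacobiCoeff μ) r R k m j • hermiteOrtho μ j := by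
  induction m with
  | zero => simp [jacobiPow, Pi.single_apply, ite_smul]
  | succ m ih =>
    have h := sum_jacobiStep_smul (r := r) (R := R) (jacobiCoeff_zero μ) (hermiteOrtho μ)
      (c := jacobiPow (jacobiCoeff μ) r R k m) (N := k + m + 1)
      fun j hj => jacobiPow_eq_zero (by omega)
    rw [jacobiPow_succ, show k + (m + 1) + 1 = k + m + 1 + 1 by ring, h, pow_succ', mul_assoc, ih,
      Finset.mul_sum]
    refine Finset.sum_congr rfl fun j _ => ?_
    rw [mul_smul_comm, add_mul, mul_assoc, X_mul_hermiteOrtho hμ]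
    simp only [smul_eq_C_mul]
    ring

theorem hermiteDiag_eq {μ : ℝ} (hμ : 0 ≤ μ) (g : ℝ[X]) (k : ℕ) :
    hermiteDiag μ g k = lineMoment μ (g * hermiteOrtho μ k * hermiteOrtho μ k) := by
  have h : g * hermiteOrtho μ k * hermiteOrtho μ k
      = C (√(lineMoment μ (genHermite μ k * genHermite μ k)))⁻¹ *
        (C (√(lineMoment μ (genHermite μ k * genHermite μ k)))⁻¹ *
          (g * genHermite μ k * genHermite μ k)) := by
    simp only [hermiteOrtho]; ring
  have hp := lineMoment_genHermite_sq_pos hμ k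
  rw [h, lineMoment_C_mul, lineMoment_C_mul, ← mul_assoc, ← mul_inv, Real.mul_self_sqrt hp.le,
    hermiteDiag, div_eq_inv_mul]

/-- By orthonormality the left side is the squared norm of `(R + rJ)^m` applied to the `k`-th basis
vector. -/
theorem hermiteDiag_pow {μ : ℝ} (hμ : 0 ≤ μ) (r R : ℝ) (k m : ℕ) :
    hermiteDiag μ ((C r * X + C R) ^ (2 * m)) k
      = ∑ j ∈ Finset.range (k + m + 1), jacobiPow (jacobiCoeff μ) r R k m j ^ 2 := by
  rw [hermiteDiag_eq hμ]
  have h : (C r * X + C R) ^ (2 * m) * hermiteOrtho μ k * hermiteOrtho μ k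
      = ((C r * X + C R) ^ m * hermiteOrtho μ k) * ((C r * X + C R) ^ m * hermiteOrtho μ k) := by
    ring
  rw [h, pow_mul_hermiteOrtho hμ, Finset.sum_mul_sum, lineMoment_sum hμ]
  refine Finset.sum_congr rfl fun i hi => ?_
  rw [lineMoment_sum hμ]
  simp only [smul_eq_C_mul]
  have h2 : ∀ j, lineMoment μ (C (jacobiPow (jacobiCoeff μ) r R k m i) * hermiteOrtho μ i *
      (C (jacobiPow (jacobiCoeff μ) r R k m j) * hermiteOrtho μ j))
      = if i = j then jacobiPow (jacobiCoeff μ) r R k m i * jacobiPow (jacobiCoeff μ) r R k m j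
        else 0 := by
    intro j
    rw [mul_mul_mul_comm, ← C_mul, lineMoment_C_mul, lineMoment_hermiteOrtho_mul hμ]
    simp
  simp_rw [h2]
  rw [Finset.sum_ite_eq, if_pos hi, sq]

/-- The edge of the spectrum of the Jacobi matrix around the index `t`. -/
noncomputable def jacobiEdge (μ t : ℝ) : ℝ := √((t + 2 * μ) / 2) + √(t / 2)

theorem jacobiEdge_mono (μ : ℝ) {s t : ℝ} (h : s ≤ t) : jacobiEdge μ s ≤ jacobiEdge μ t := by
  unfold jacobiEdge; gcongr

theorem jacobiEdge_nonneg (μ t : ℝ) : 0 ≤ jacobiEdge μ t := by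
  unfold jacobiEdge; positivity

/-- Of two consecutive indices exactly one is odd, so exactly one square root contains `2μ`,
whatever the parity of `j`. The parity oscillation thus disappears from the row sums. -/
theorem jacobiCoeff_add_le (μ : ℝ) (j : ℕ) :
    jacobiCoeff μ j + jacobiCoeff μ (j + 1) ≤ jacobiEdge μ (j + 1) := by
  unfold jacobiCoeff hermiteCoeff dunklCoeff jacobiEdge
  rcases Nat.even_or_odd j with h | h
  · rw [if_neg (Nat.not_odd_iff_even.2 h), if_pos h.add_one, add_comm]
    push_cast
    exact add_le_add (Real.sqrt_le_sqrt (by linarith)) (Real.sqrt_le_sqrt (by linarith))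
  · rw [if_pos h, if_neg (Nat.not_odd_iff_even.2 h.add_one)]
    push_cast
    exact add_le_add (Real.sqrt_le_sqrt (by linarith)) (Real.sqrt_le_sqrt (by linarith))

theorem le_jacobiCoeff_add (μ : ℝ) (j : ℕ) :
    jacobiEdge μ j ≤ jacobiCoeff μ j + jacobiCoeff μ (j + 1) := by
  unfold jacobiCoeff hermiteCoeff dunklCoeff jacobiEdge
  rcases Nat.even_or_odd j with h | h
  · rw [if_neg (Nat.not_odd_iff_even.2 h), if_pos h.add_one, add_comm]
    push_cast
    exact add_le_add (Real.sqrt_le_sqrt (by linarith)) (Real.sqrt_le_sqrt (by linarith))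
  · rw [if_pos h, if_neg (Nat.not_odd_iff_even.2 h.add_one)]
    push_cast
    exact add_le_add (Real.sqrt_le_sqrt (by linarith)) (Real.sqrt_le_sqrt (by linarith))

theorem hermiteDiag_pow_le {μ : ℝ} (hμ : 0 ≤ μ) {r R : ℝ} (hr : 0 ≤ r) (hR : 0 ≤ R) (k m : ℕ) :
    hermiteDiag μ ((C r * X + C R) ^ (2 * m)) k
      ≤ (R + r * jacobiEdge μ ((k + m : ℕ) : ℝ)) ^ (2 * m) := by
  rw [hermiteDiag_pow hμ]
  have := jacobiEdge_nonneg μ ((k + m : ℕ) : ℝ)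
  refine sum_sq_jacobiPow_le (jacobiCoeff_nonneg μ) (jacobiCoeff_zero μ) hr hR (by positivity)
    fun j hj => ?_
  have h1 := (jacobiCoeff_add_le μ j).trans
    (jacobiEdge_mono μ (by exact_mod_cast hj : (j : ℝ) + 1 ≤ ((k + m : ℕ) : ℝ)))
  gcongr

theorem le_hermiteDiag_pow {μ : ℝ} (hμ : 0 ≤ μ) {r R : ℝ} (hr : 0 ≤ r) (hR : 0 ≤ R) {k m : ℕ}
    {t : ℝ} (ht : t + m ≤ k) :
    (R + r * jacobiEdge μ t) ^ (2 * m)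
      ≤ (2 * m + 1) * hermiteDiag μ ((C r * X + C R) ^ (2 * m)) k := by
  rw [hermiteDiag_pow hμ]
  have := jacobiEdge_nonneg μ t
  refine le_sum_sq_jacobiPow (jacobiCoeff_nonneg μ) (jacobiCoeff_zero μ) hr hR (by positivity)
    fun j hj => ?_
  have h0 : (k : ℝ) ≤ j + m := by exact_mod_cast hj
  have h1 := (jacobiEdge_mono μ (by linarith : t ≤ j)).trans (le_jacobiCoeff_add μ j)
  gcongr

theorem hermiteDiag_one {μ : ℝ} (hμ : 0 ≤ μ) (k : ℕ) : hermiteDiag μ 1 k = 1 := by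
  rw [hermiteDiag, one_mul, div_self (lineMoment_genHermite_sq_pos hμ k).ne']

theorem hermiteDiag_add {μ : ℝ} (hμ : 0 ≤ μ) (f g : ℝ[X]) (k : ℕ) :
    hermiteDiag μ (f + g) k = hermiteDiag μ f k + hermiteDiag μ g k := by
  rw [hermiteDiag, add_mul, add_mul, lineMoment_add hμ, add_div]
  rfl

theorem hermiteDiag_C_mul (μ c : ℝ) (g : ℝ[X]) (k : ℕ) :
    hermiteDiag μ (C c * g) k = c * hermiteDiag μ g k := by
  rw [hermiteDiag, mul_assoc, mul_assoc, lineMoment_C_mul, mul_div_assoc, ← mul_assoc]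
  rfl

theorem hermiteDiag_nonneg {μ : ℝ} {g : ℝ[X]} (hg : ∀ s, 0 ≤ g.eval s) (k : ℕ) :
    0 ≤ hermiteDiag μ g k := by
  refine div_nonneg (lineMoment_nonneg fun s => ?_) (lineMoment_nonneg fun s => ?_)
  · rw [eval_mul, eval_mul, mul_assoc]
    exact mul_nonneg (hg s) (mul_self_nonneg _)
  · rw [eval_mul]
    exact mul_self_nonneg _

theorem lineMoment_comp_neg (μ : ℝ) (q : ℝ[X]) : lineMoment μ (q.comp (-X)) = lineMoment μ q := by
  have h := integral_neg_eq_self (fun s : ℝ => q.eval s * lineWeight μ s) volume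
  rw [lineMoment, lineMoment, ← h]
  refine integral_congr_ae (ae_of_all _ fun s => ?_)
  simp [lineWeight, eval_comp]

/-- The weight is even and `genHermite μ k` has the parity of `k`. Hence a test polynomial for the
right edge serves, after reflection, for the left edge. -/
theorem hermiteDiag_comp_neg (μ : ℝ) (g : ℝ[X]) (k : ℕ) :
    hermiteDiag μ (g.comp (-X)) k = hermiteDiag μ g k := by
  have h : g.comp (-X) * genHermite μ k * genHermite μ k
      = (g * genHermite μ k * genHermite μ k).comp (-X) := by
    rw [mul_comp, mul_comp, genHermite_comp_neg]
    have : (C ((-1 : ℝ) ^ k)) * C ((-1 : ℝ) ^ k) = 1 := by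
      rw [← C_mul, ← mul_pow]; simp
    linear_combination (-(g.comp (-X) * genHermite μ k * genHermite μ k)) * this
  rw [hermiteDiag, h, lineMoment_comp_neg, hermiteDiag]

end JacobiOperator

/-! ### Markov's inequality and Borel-Cantelli -/

section Probability

open Polynomial

theorem Herm.weight_eq {n : ℕ} (μ : ℝ) (x : Herm n) :
    Herm.weight μ x = ENNReal.ofReal (|∏ i, x.eigs i| ^ (2 * μ) * Real.exp (-‖x‖ ^ 2)) := by
  rw [Herm.weight, Herm.det_eq, Herm.norm_sq_eq, Complex.norm_real, Real.norm_eq_abs]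

theorem Herm.lintegral_weight {n : ℕ} {μ : ℝ} (hμ : 0 ≤ μ) :
    ∫⁻ x : Herm n, Herm.weight μ x
      = ENNReal.ofReal (∫ x : Herm n, |∏ i, x.eigs i| ^ (2 * μ) * Real.exp (-‖x‖ ^ 2)) := by
  simp_rw [Herm.weight_eq]
  rw [← ofReal_integral_eq_lintegral_ofReal (Herm.integral_weight hμ).1
    (ae_of_all _ fun x => by positivity)]

theorem Herm.continuous_prod_eval {n : ℕ} (g : ℝ[X]) :
    Continuous fun x : Herm n => ∏ i, g.eval (x.eigs i) := by
  have := (Herm.isSpectralModel n).continuous_eval (prod_aeval_isSymmetric n g)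
  simpa only [eval_prod_aeval] using this

/-- Markov's inequality for `det g(x)` under the ensemble. -/
theorem Herm.ensemble_le {n : ℕ} {μ : ℝ} (hμ : 0 ≤ μ) {g : ℝ[X]} (hg : ∀ s, 0 ≤ g.eval s)
    {t : ℝ} (ht : 0 < t) :
    Herm.ensemble n μ {x | t ≤ ∏ i, g.eval (x.eigs i)}
      ≤ ENNReal.ofReal (Real.exp (∑ k ∈ Finset.range n, (hermiteDiag μ g k - 1)) / t) := by
  set Z := ∫ x : Herm n, |∏ i, x.eigs i| ^ (2 * μ) * Real.exp (-‖x‖ ^ 2) with hZ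
  have hZpos : 0 < Z := Herm.integral_weight_pos hμ
  set S := ∑ k ∈ Finset.range n, (hermiteDiag μ g k - 1)
  have hm : MeasurableSet {x : Herm n | t ≤ ∏ i, g.eval (x.eigs i)} :=
    (isClosed_le continuous_const (Herm.continuous_prod_eval g)).measurableSet
  have hG : ∀ x : Herm n, 0 ≤ ∏ i, g.eval (x.eigs i) := fun x =>
    Finset.prod_nonneg fun i _ => hg _
  have hGint := (Herm.integral_prod_eval (n := n) hμ g).1
  have h1 : (volume : Measure (Herm n)).withDensity (Herm.weight μ)
      {x | t ≤ ∏ i, g.eval (x.eigs i)} ≤ ENNReal.ofReal (Z * Real.exp S / t) := by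
    rw [withDensity_apply _ hm]
    calc ∫⁻ x in {x : Herm n | t ≤ ∏ i, g.eval (x.eigs i)}, Herm.weight μ x
        ≤ ∫⁻ x in {x : Herm n | t ≤ ∏ i, g.eval (x.eigs i)}, ENNReal.ofReal
          ((∏ i, g.eval (x.eigs i)) * (|∏ i, x.eigs i| ^ (2 * μ) * Real.exp (-‖x‖ ^ 2)) / t) := by
          refine setLIntegral_mono' hm fun x hx => ?_
          rw [Herm.weight_eq]
          apply ENNReal.ofReal_le_ofReal
          rw [le_div_iff₀ ht, mul_comm]
          exact mul_le_mul_of_nonneg_right hx (by positivity)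
      _ ≤ ∫⁻ x : Herm n, ENNReal.ofReal
          ((∏ i, g.eval (x.eigs i)) * (|∏ i, x.eigs i| ^ (2 * μ) * Real.exp (-‖x‖ ^ 2)) / t) :=
          setLIntegral_le_lintegral _ _
      _ = ENNReal.ofReal (∫ x : Herm n, (∏ i, g.eval (x.eigs i))
          * (|∏ i, x.eigs i| ^ (2 * μ) * Real.exp (-‖x‖ ^ 2)) / t) := by
          rw [ofReal_integral_eq_lintegral_ofReal (hGint.div_const t)
            (ae_of_all _ fun x => div_nonneg (mul_nonneg (hG x) (by positivity)) ht.le)]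
      _ ≤ ENNReal.ofReal (Z * Real.exp S / t) := by
          apply ENNReal.ofReal_le_ofReal
          rw [integral_div]
          exact div_le_div_of_nonneg_right (Herm.integral_prod_eval_le hμ hg) ht.le
  rw [Herm.ensemble, Measure.smul_apply, smul_eq_mul, Herm.lintegral_weight hμ, ← hZ,
    ← ENNReal.ofReal_inv_of_pos hZpos]
  refine (mul_le_mul_right h1 _).trans ?_
  rw [← ENNReal.ofReal_mul (by positivity)]
  apply ENNReal.ofReal_le_ofReal
  rw [mul_div_assoc, inv_mul_cancel_left₀ hZpos.ne']

theorem ae_eventually_notMem_of_summable {Ω : Type*} [MeasurableSpace Ω] {P : Measure Ω}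
    {A : ℕ → Set Ω} {v : ℕ → ℝ} (hv : Summable v) (h : ∀ᶠ n in atTop, P (A n) ≤ ENNReal.ofReal (v n)) :
    ∀ᵐ ω ∂P, ∀ᶠ n in atTop, ω ∉ A n := by
  obtain ⟨N, hN⟩ := eventually_atTop.1 h
  have hs : ∑' n, P (A (n + N)) ≠ ∞ := by
    refine ne_top_of_le_ne_top ?_ (ENNReal.tsum_le_tsum fun n => hN (n + N) (by omega))
    exact ((summable_nat_add_iff N).2 hv).tsum_ofReal_ne_top
  filter_upwards [ae_eventually_notMem hs] with ω hω
  exact (eventually_atTop.2 ((eventually_atTop.1 hω).imp fun a ha b hb => ha b hb) |>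
    (tendsto_sub_atTop_nat N).eventually).mp
      ((eventually_ge_atTop N).mono fun n hn hm => by simpa [Nat.sub_add_cancel hn] using hm)

variable {Ω : Type*} [MeasurableSpace Ω] {P : Measure Ω}
  {X : (n : ℕ) → Ω → Herm n} {μ : ℕ → ℝ} {c : ℝ}

/-- Only the first Borel-Cantelli lemma is used, which needs the marginal laws and no independence.
-/
theorem ae_eventually_prod_eval_lt (hμ : ∀ n, 1 ≤ n → 0 < μ n)
    (hX : ∀ n, 1 ≤ n → HasLaw (X n) (Herm.ensemble n (μ n)) P) {g : ℕ → ℝ[X]}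
    (hg : ∀ n s, 0 ≤ (g n).eval s) {t v : ℕ → ℝ} (ht : ∀ n, 0 < t n) (hv : Summable v)
    (h : ∀ᶠ n in atTop,
      Real.exp (∑ k ∈ Finset.range n, (hermiteDiag (μ n) (g n) k - 1)) / t n ≤ v n) :
    ∀ᵐ ω ∂P, ∀ᶠ n in atTop, ∏ i, (g n).eval ((X n ω).eigs i) < t n := by
  have h2 := ae_eventually_notMem_of_summable (P := P)
    (A := fun n => X n ⁻¹' {x | t n ≤ ∏ i, (g n).eval (x.eigs i)}) hv (by
      filter_upwards [h, eventually_ge_atTop 1] with n hn h1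
      have hm : MeasurableSet {x : Herm n | t n ≤ ∏ i, (g n).eval (x.eigs i)} :=
        (isClosed_le continuous_const (Herm.continuous_prod_eval (g n))).measurableSet
      rw [← Measure.map_apply_of_aemeasurable (hX n h1).aemeasurable hm, (hX n h1).map_eq]
      exact (Herm.ensemble_le (hμ n h1).le (hg n) (ht n)).trans (ENNReal.ofReal_le_ofReal hn))
  filter_upwards [h2] with ω hω
  filter_upwards [hω] with n hn
  simpa using hn

end Probability

/-! ### Asymptotics of the rescaled edge -/

section Asymptotics

variable {μ : ℕ → ℝ} {c : ℝ}

/-- The limit of the rescaled spectral edge around the index `y n`. -/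
noncomputable def edgeLimit (c y : ℝ) : ℝ := √((y + 2 * c) / 2) + √(y / 2)

theorem edgeLimit_one (hc : 0 ≤ c) : edgeLimit c 1 = √(1 + c + √(1 + 2 * c)) := by
  have h0 : 0 ≤ edgeLimit c 1 := by unfold edgeLimit; positivity
  rw [eq_comm, Real.sqrt_eq_iff_mul_self_eq (by positivity) h0]
  unfold edgeLimit
  have h1 : √((1 + 2 * c) / 2) * √((1 + 2 * c) / 2) = (1 + 2 * c) / 2 :=
    Real.mul_self_sqrt (by positivity)
  have h2 : √((1 : ℝ) / 2) * √((1 : ℝ) / 2) = 1 / 2 := Real.mul_self_sqrt (by positivity)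
  have h3 : √((1 + 2 * c) / 2) * √((1 : ℝ) / 2) = √(1 + 2 * c) / 2 := by
    rw [← Real.sqrt_mul (by positivity), show (1 + 2 * c) / 2 * (1 / 2) = (1 + 2 * c) / 2 ^ 2 by ring,
      Real.sqrt_div (by positivity), Real.sqrt_sq (by norm_num)]
  linear_combination -h1 - h2 - 2 * h3

theorem continuous_edgeLimit (c : ℝ) : Continuous (edgeLimit c) := by
  unfold edgeLimit; fun_prop

theorem tendsto_jacobiEdge (hc : Tendsto (fun n : ℕ => μ n / (n : ℝ)) atTop (𝓝 c)) (y : ℝ) :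
    Tendsto (fun n : ℕ => (1 / √(n : ℝ)) * jacobiEdge (μ n) (y * n)) atTop
      (𝓝 (edgeLimit c y)) := by
  have h : Tendsto (fun n : ℕ => √((y + 2 * (μ n / (n : ℝ))) / 2) + √(y / 2)) atTop
      (𝓝 (edgeLimit c y)) :=
    ((((hc.const_mul 2).const_add y).div_const 2).sqrt).add_const _
  refine h.congr' ?_
  filter_upwards [eventually_ge_atTop 1] with n hn
  have hn' : (0 : ℝ) < n := by exact_mod_cast hn
  rw [jacobiEdge, mul_add, one_div, ← Real.sqrt_inv, ← Real.sqrt_mul (by positivity),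
    ← Real.sqrt_mul (by positivity)]
  congr 2
  · field_simp
  · field_simp

theorem tendsto_cube_mul_pow_div {ρ : ℝ} (h0 : 0 < ρ) (h1 : ρ < 1) {q : ℕ} (hq : 0 < q) :
    Tendsto (fun n : ℕ => (n : ℝ) ^ 3 * ρ ^ (2 * (n / q))) atTop (𝓝 0) := by
  have hr : |ρ ^ 2| < 1 := by
    rw [abs_of_pos (by positivity)]
    nlinarith
  have hm : Tendsto (fun n : ℕ => n / q + 1) atTop atTop :=
    (tendsto_add_atTop_nat 1).comp (Nat.tendsto_div_const_atTop hq.ne')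
  have h := ((tendsto_pow_const_mul_const_pow_of_abs_lt_one 3 hr).comp hm).const_mul
    ((q : ℝ) ^ 3 / ρ ^ 2)
  rw [mul_zero] at h
  refine squeeze_zero (fun n => by positivity) (fun n => ?_) h
  -- Trading `n` for `q(⌊n/q⌋ + 1)` reduces the limit to `j³ ρ^{2j} → 0` along `j = ⌊n/q⌋ + 1`.
  have hn : (n : ℝ) ≤ q * ((n / q + 1 : ℕ) : ℝ) := by
    exact_mod_cast (Nat.lt_mul_div_succ n hq).le
  calc (n : ℝ) ^ 3 * ρ ^ (2 * (n / q)) ≤ (q * ((n / q + 1 : ℕ) : ℝ)) ^ 3 * ρ ^ (2 * (n / q)) := by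
        gcongr
    _ = _ := by
        simp only [Function.comp]
        rw [← pow_mul, mul_add, pow_add]
        field_simp

/-- An exponential gap beats the linear loss `2m + 1` of Cauchy-Schwarz. The extra 1 gives the
margin by which the averaged mass exceeds the threshold in `exists_edgeTest`. -/
theorem exists_pow_div_ge {x z : ℝ} (hz : 1 ≤ z) (hx : z < x) {K : ℝ} (hK : 0 < K) :
    ∃ m : ℕ, (z ^ m + 1) * (K * (2 * m + 1)) ≤ x ^ m := by
  have hx0 : 0 < x := by linarith
  have hr : |z / x| < 1 := by
    rw [abs_of_pos (by positivity), div_lt_one hx0]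
    exact hx
  have h1 := tendsto_pow_const_mul_const_pow_of_abs_lt_one 1 hr
  have h2 := tendsto_pow_const_mul_const_pow_of_abs_lt_one 0 hr
  have h3 := ((h1.const_mul 2).add h2).const_mul (2 * K)
  simp only [mul_zero, add_zero] at h3
  obtain ⟨m, hm⟩ := (h3.eventually (gt_mem_nhds one_pos)).exists
  refine ⟨m, ?_⟩
  simp only [pow_one, pow_zero, one_mul, div_pow] at hm
  have hxm : 0 < x ^ m := by positivity
  have hzm : 1 ≤ z ^ m := one_le_pow₀ hz
  have h4 : 2 * K * ((2 * m + 1) * z ^ m) ≤ x ^ m := by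
    have : 2 * K * (2 * (m * (z ^ m / x ^ m)) + z ^ m / x ^ m)
        = 2 * K * ((2 * m + 1) * z ^ m) / x ^ m := by ring
    rw [this, div_lt_one hxm] at hm
    exact hm.le
  have h5 : (z ^ m + 1) * (K * (2 * m + 1)) ≤ (2 * z ^ m) * (K * (2 * m + 1)) := by
    gcongr
    linarith
  linarith

end Asymptotics

/-! ### Outer and inner bounds on the extreme eigenvalues -/

section Tails

open Polynomial

variable {Ω : Type*} [MeasurableSpace Ω] {P : Measure Ω}
  {X : (n : ℕ) → Ω → Herm n} {μ : ℕ → ℝ} {c : ℝ}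

theorem tendsto_edgeLimit_one (c : ℝ) {s : ℝ} :
    Tendsto (fun q : ℕ => edgeLimit c (1 + s * (1 / ((q : ℝ) + 1)))) atTop
      (𝓝 (edgeLimit c 1)) := by
  have h := (tendsto_one_div_add_atTop_nhds_zero_nat (𝕜 := ℝ)).const_mul s
  have h2 := ((continuous_edgeLimit c).tendsto (1 + s * 0)).comp (h.const_add 1)
  simp only [mul_zero, add_zero] at h2
  exact h2

theorem one_le_prod_of_one_le {ι : Type*} {s : Finset ι} {f : ι → ℝ} (h : ∀ i ∈ s, 1 ≤ f i) :
    1 ≤ ∏ i ∈ s, f i := by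
  simpa using Finset.prod_le_prod (f := fun _ => (1 : ℝ)) (fun _ _ => zero_le_one) h

/-- Almost surely, the spectrum is eventually within any interval larger than the limiting one. -/
theorem ae_eventually_abs_eigs_lt (hμ : ∀ n, 1 ≤ n → 0 < μ n)
    (hc : Tendsto (fun n : ℕ => μ n / (n : ℝ)) atTop (𝓝 c))
    (hX : ∀ n, 1 ≤ n → HasLaw (X n) (Herm.ensemble n (μ n)) P) {T : ℝ} (hT : edgeLimit c 1 < T) :
    ∀ᵐ ω ∂P, ∀ᶠ n : ℕ in atTop, ∀ i, |(X n ω).eigs i| < T * √(n : ℝ) := by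
  obtain ⟨T', hT1, hT2⟩ := exists_between hT
  have hb0 : 0 ≤ edgeLimit c 1 := by unfold edgeLimit; positivity
  have hT'0 : 0 < T' := by linarith
  have hT0 : 0 < T := by linarith
  obtain ⟨q₀, hq₀⟩ := ((tendsto_edgeLimit_one c (s := 1)).eventually (gt_mem_nhds hT1)).exists
  set q := q₀ + 1 with hq
  set ρ := T' / T with hρ
  have hρ0 : 0 < ρ := by positivity
  have hρ1 : ρ < 1 := (div_lt_one hT0).2 hT2
  -- The exponent proportional to `n` makes each diagonal element at most `ρ^{2⌊n/q⌋}`,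
  -- exponentially small. This absorbs the factor `n²`, which in turn gives the summable Markov
  -- bound `e / (1 + n²)`.
  set u : ℕ → ℝ[X] := fun n => (C (1 / (T * √(n : ℝ))) * Polynomial.X + C 0) ^ (2 * (n / q)) with hu
  have hu0 : ∀ (n : ℕ) (s : ℝ), 0 ≤ (u n).eval s := by
    intro n s
    rw [hu]
    simp only [eval_pow]
    exact (even_two_mul _).pow_nonneg _
  have hg0 : ∀ (n : ℕ) (s : ℝ), 1 ≤ (1 + C ((n : ℝ) ^ 2) * u n).eval s := by
    intro n s
    have := hu0 n s
    simp only [eval_add, eval_one, eval_mul, eval_C, le_add_iff_nonneg_right]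
    positivity
  have key := ae_eventually_prod_eval_lt (P := P) hμ hX
    (g := fun n => 1 + C ((n : ℝ) ^ 2) * u n) (t := fun n => 1 + (n : ℝ) ^ 2)
    (v := fun n => Real.exp 1 * (1 / (n : ℝ) ^ 2))
    (fun n s => zero_le_one.trans (hg0 n s)) (fun n => by positivity)
    ((Real.summable_one_div_nat_pow.2 one_lt_two).mul_left _) (by
      have e1 := (tendsto_jacobiEdge hc (1 + 1 * (1 / ((q₀ : ℝ) + 1)))).eventually
        (gt_mem_nhds hq₀)
      have e2 := (tendsto_cube_mul_pow_div hρ0 hρ1 (q := q) (by omega)).eventually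
        (gt_mem_nhds one_pos)
      filter_upwards [e1, e2, eventually_ge_atTop 1] with n h1 h2 hn
      have hn' : (0 : ℝ) < n := by exact_mod_cast hn
      have hμn := (hμ n hn).le
      have hd : ∀ k ∈ Finset.range n,
          hermiteDiag (μ n) (1 + C ((n : ℝ) ^ 2) * u n) k - 1 ≤ (n : ℝ) ^ 2 * ρ ^ (2 * (n / q)) := by
        intro k hk
        rw [Finset.mem_range] at hk
        rw [hermiteDiag_add hμn, hermiteDiag_one hμn, hermiteDiag_C_mul, add_sub_cancel_left]
        have h3 := hermiteDiag_pow_le hμn (r := 1 / (T * √(n : ℝ))) (R := 0) (by positivity) le_rfl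
          k (n / q)
        have h4 : ((k + n / q : ℕ) : ℝ) ≤ (1 + 1 * (1 / ((q₀ : ℝ) + 1))) * n := by
          have : ((n / q : ℕ) : ℝ) ≤ (n : ℝ) / q := Nat.cast_div_le
          have hk' : (k : ℝ) ≤ n := by exact_mod_cast hk.le
          push_cast
          rw [hq] at this
          push_cast at this
          rw [hq]
          calc (k : ℝ) + ((n / (q₀ + 1) : ℕ) : ℝ) ≤ n + (n : ℝ) / (q₀ + 1) := add_le_add hk' this
            _ = _ := by ring
        have h5 : 0 + 1 / (T * √(n : ℝ)) * jacobiEdge (μ n) ((k + n / q : ℕ) : ℝ) ≤ ρ := by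
          have h6 := jacobiEdge_mono (μ n) h4
          have h7 : 1 / √(n : ℝ) * jacobiEdge (μ n) ((k + n / q : ℕ) : ℝ) ≤ T' :=
            (mul_le_mul_of_nonneg_left h6 (by positivity)).trans h1.le
          rw [zero_add, hρ, le_div_iff₀ hT0]
          refine le_trans (le_of_eq ?_) h7
          have : √(n : ℝ) ≠ 0 := (Real.sqrt_pos.2 hn').ne'
          field_simp
        have h8 := jacobiEdge_nonneg (μ n) ((k + n / q : ℕ) : ℝ)
        have h9 : hermiteDiag (μ n) (u n) k ≤ ρ ^ (2 * (n / q)) :=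
          h3.trans (pow_le_pow_left₀ (by positivity) h5 _)
        gcongr
      have hS : ∑ k ∈ Finset.range n, (hermiteDiag (μ n) (1 + C ((n : ℝ) ^ 2) * u n) k - 1) ≤ 1 := by
        refine (Finset.sum_le_card_nsmul _ _ _ hd).trans ?_
        rw [Finset.card_range, nsmul_eq_mul]
        calc (n : ℝ) * ((n : ℝ) ^ 2 * ρ ^ (2 * (n / q))) = (n : ℝ) ^ 3 * ρ ^ (2 * (n / q)) := by ring
          _ ≤ 1 := h2.le
      rw [mul_one_div]
      gcongr
      linarith)
  filter_upwards [key] with ω hω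
  filter_upwards [hω, eventually_ge_atTop 1] with n hn h1 i
  have hn' : (0 : ℝ) < n := by exact_mod_cast h1
  have hs : 0 < √(n : ℝ) := Real.sqrt_pos.2 hn'
  by_contra hcon
  push Not at hcon
  refine absurd hn (not_lt.2 ?_)
  rw [← Finset.mul_prod_erase _ _ (Finset.mem_univ i)]
  have h2 : 1 ≤ ∏ j ∈ Finset.univ.erase i,
      (1 + C ((n : ℝ) ^ 2) * u n).eval ((X n ω).eigs j) :=
    one_le_prod_of_one_le fun j _ => hg0 n _
  have h3 : 1 + (n : ℝ) ^ 2 ≤ (1 + C ((n : ℝ) ^ 2) * u n).eval ((X n ω).eigs i) := by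
    simp only [hu, eval_add, eval_one, eval_mul, eval_C, eval_pow, eval_X, add_zero]
    have h4 : 1 ≤ (1 / (T * √(n : ℝ)) * (X n ω).eigs i) ^ (2 * (n / q)) := by
      rw [← (even_two_mul (n / q)).pow_abs, abs_mul, abs_of_pos (by positivity)]
      refine one_le_pow₀ ?_
      rw [one_div, ← div_eq_inv_mul, one_le_div (by positivity)]
      exact hcon
    nlinarith [sq_nonneg (n : ℝ)]
  calc 1 + (n : ℝ) ^ 2 = (1 + (n : ℝ) ^ 2) * 1 := by ring
    _ ≤ _ := mul_le_mul h3 h2 zero_le_one (by linarith [hg0 n ((X n ω).eigs i)])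

/-- The test polynomials `(1 - δ ((s / √n + R) ^ (2 * m) - K)) ^ 2`. -/
noncomputable def edgeTest (δ R K : ℝ) (m n : ℕ) : ℝ[X] :=
  (1 - C δ * ((C (1 / √(n : ℝ)) * Polynomial.X + C R) ^ (2 * m) - C K)) ^ 2

theorem eval_edgeTest (δ R K : ℝ) (m n : ℕ) (s : ℝ) : (edgeTest δ R K m n).eval s
    = (1 - δ * ((1 / √(n : ℝ) * s + R) ^ (2 * m) - K)) ^ 2 := by
  simp [edgeTest]

/-- Expand the square; the cross term `-2δ² K u^{2m}` has a nonpositive diagonal element and is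
dropped. -/
theorem hermiteDiag_edgeTest_le {ν : ℝ} (hν : 0 ≤ ν) {δ R K : ℝ} (hK : 0 ≤ K) (m n k : ℕ) :
    hermiteDiag ν (edgeTest δ R K m n) k - 1
      ≤ -(2 * δ) * (hermiteDiag ν ((C (1 / √(n : ℝ)) * Polynomial.X + C R) ^ (2 * m)) k - K)
        + δ ^ 2 * (hermiteDiag ν ((C (1 / √(n : ℝ)) * Polynomial.X + C R) ^ (2 * (2 * m))) k
          + K ^ 2) := by
  set u : ℝ[X] := C (1 / √(n : ℝ)) * Polynomial.X + C R with hu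
  have he : edgeTest δ R K m n = C ((1 + δ * K) ^ 2) * 1 + (C (-(2 * δ * (1 + δ * K))) * u ^ (2 * m)
      + C (δ ^ 2) * u ^ (2 * (2 * m))) := by
    rw [edgeTest, ← hu]
    simp only [map_neg, map_mul, map_pow, map_add, map_one, map_ofNat]
    ring
  rw [he, hermiteDiag_add hν, hermiteDiag_add hν, hermiteDiag_C_mul, hermiteDiag_C_mul,
    hermiteDiag_C_mul, hermiteDiag_one hν]
  have h0 : 0 ≤ hermiteDiag ν (u ^ (2 * m)) k := hermiteDiag_nonneg (fun s => by
    rw [eval_pow]; exact (even_two_mul _).pow_nonneg _) k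
  nlinarith [mul_nonneg (mul_nonneg (sq_nonneg δ) hK) h0]

/-- The mass of the Jacobi matrix near the spectral edge. -/
theorem eventually_le_sum_hermiteDiag (hμ : ∀ n, 1 ≤ n → 0 < μ n)
    (hc : Tendsto (fun n : ℕ => μ n / (n : ℝ)) atTop (𝓝 c)) {R T' : ℝ} (hR : 0 ≤ R) (hT0 : 0 ≤ T')
    (hT' : T' < edgeLimit c 1) : ∃ κ : ℝ, 0 < κ ∧ ∀ m : ℕ, ∀ᶠ n : ℕ in atTop,
      (n : ℝ) * ((R + T') ^ (2 * m) / (κ * (2 * m + 1)))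
        ≤ ∑ k ∈ Finset.range n,
          hermiteDiag (μ n) ((C (1 / √(n : ℝ)) * Polynomial.X + C R) ^ (2 * m)) k := by
  -- For `k ≥ n - n/q` and `m ≤ n/q`, all indices reached in `m` steps are at least `(1 - 2/q) n`,
  -- where the edge still exceeds `T'√n`.
  obtain ⟨q₀, hq₀⟩ := ((tendsto_edgeLimit_one c (s := -2)).eventually (lt_mem_nhds hT')).exists
  set q := q₀ + 1 with hq
  have hqp : (0 : ℝ) < q := by positivity
  -- There are `⌊n/q⌋ ≥ n / (2q)` such indices once `n ≥ 2q`, whence the constant `2q`.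
  refine ⟨2 * q, by positivity, fun m => ?_⟩
  have e1 := (tendsto_jacobiEdge hc (1 + -2 * (1 / ((q₀ : ℝ) + 1)))).eventually (lt_mem_nhds hq₀)
  filter_upwards [e1, eventually_ge_atTop 1, eventually_ge_atTop (2 * q),
    eventually_ge_atTop (q * m)] with n h1 hn hn2 hn3
  have hn' : (0 : ℝ) < n := by exact_mod_cast hn
  have hμn := (hμ n hn).le
  set u : ℝ[X] := C (1 / √(n : ℝ)) * Polynomial.X + C R with hu
  have h0 : ∀ k, 0 ≤ hermiteDiag (μ n) (u ^ (2 * m)) k := hermiteDiag_nonneg (fun s => by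
    rw [eval_pow]; exact (even_two_mul _).pow_nonneg _)
  have hle : n / q ≤ n := Nat.div_le_self _ _
  have hd1 : ((n / q : ℕ) : ℝ) ≤ (n : ℝ) / q := Nat.cast_div_le
  have hd2 : (n : ℝ) / (2 * q) ≤ ((n / q : ℕ) : ℝ) := by
    have h := Nat.lt_mul_div_succ n (show 0 < q by omega)
    have h' : (n : ℝ) < q * ((n / q : ℕ) + 1) := by exact_mod_cast h
    have h2 : (2 : ℝ) * q ≤ n := by exact_mod_cast hn2
    rw [div_le_iff₀ (by positivity)]
    nlinarith
  have hm : (m : ℝ) ≤ (n : ℝ) / q := by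
    rw [le_div_iff₀ hqp, mul_comm]
    exact_mod_cast hn3
  have hk : ∀ k ∈ Finset.Ico (n - n / q) n,
      (R + T') ^ (2 * m) / (2 * m + 1) ≤ hermiteDiag (μ n) (u ^ (2 * m)) k := by
    intro k hk
    rw [Finset.mem_Ico] at hk
    have hk1 : (n : ℝ) ≤ k + ((n / q : ℕ) : ℝ) := by
      have : n ≤ k + n / q := by omega
      exact_mod_cast this
    have ht : (1 + -2 * (1 / ((q₀ : ℝ) + 1))) * n + m ≤ k := by
      have : (1 + -2 * (1 / ((q₀ : ℝ) + 1))) * n = n - 2 * ((n : ℝ) / q) := by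
        rw [hq]; push_cast; ring
      linarith
    have h3 := le_hermiteDiag_pow hμn (r := 1 / √(n : ℝ)) (R := R) (by positivity) hR ht
    rw [div_le_iff₀ (by positivity)]
    refine le_trans ?_ (h3.trans_eq (mul_comm _ _))
    gcongr
  calc (n : ℝ) * ((R + T') ^ (2 * m) / (2 * q * (2 * m + 1)))
      = (n : ℝ) / (2 * q) * ((R + T') ^ (2 * m) / (2 * m + 1)) := by field_simp
    _ ≤ ((n / q : ℕ) : ℝ) * ((R + T') ^ (2 * m) / (2 * m + 1)) := by gcongr
    _ = (Finset.Ico (n - n / q) n).card • ((R + T') ^ (2 * m) / (2 * m + 1)) := by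
        rw [Nat.card_Ico, nsmul_eq_mul, Nat.sub_sub_self hle]
    _ ≤ ∑ k ∈ Finset.Ico (n - n / q) n, hermiteDiag (μ n) (u ^ (2 * m)) k :=
        Finset.card_nsmul_le_sum _ _ _ hk
    _ ≤ _ := by
        refine Finset.sum_le_sum_of_subset_of_nonneg (fun k hk => ?_) fun k _ _ => h0 k
        rw [Finset.mem_Ico] at hk
        exact Finset.mem_range.2 hk.2

/-- Exponential decay of the expectation of the test products at the spectral edge. -/
theorem exists_edgeTest (hμ : ∀ n, 1 ≤ n → 0 < μ n)
    (hc : Tendsto (fun n : ℕ => μ n / (n : ℝ)) atTop (𝓝 c)) {R T : ℝ} (hR : 1 ≤ R) (hT0 : 0 ≤ T)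
    (hT : T < edgeLimit c 1) : ∃ (m : ℕ) (δ κ : ℝ), 0 < δ ∧ 0 < κ ∧ ∀ᶠ n : ℕ in atTop,
      ∑ k ∈ Finset.range n, (hermiteDiag (μ n) (edgeTest δ R ((T + R) ^ (2 * m)) m n) k - 1)
        ≤ n * (-κ) := by
  obtain ⟨T', hT1, hT2⟩ := exists_between hT
  have hR0 : 0 ≤ R := by linarith
  obtain ⟨q, hq, hsum⟩ := eventually_le_sum_hermiteDiag hμ hc hR0 (hT0.trans hT1.le) hT2
  -- This `m` makes the average diagonal element of `u^{2m}` at least `K + 1`. The hypothesis `1 ≤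
  -- R` ensures `(T + R)² ≥ 1`.
  obtain ⟨m, hm⟩ := exists_pow_div_ge (x := (R + T') ^ 2) (z := (T + R) ^ 2)
    (one_le_pow₀ (by linarith)) (pow_lt_pow_left₀ (by linarith) (by linarith) two_ne_zero) hq
  rw [← pow_mul, ← pow_mul] at hm
  set K := (T + R) ^ (2 * m) with hK
  have hK0 : 0 ≤ K := by positivity
  set B := R + (edgeLimit c 2 + 1) with hB
  have hB1 : 1 ≤ B := by
    have : 0 ≤ edgeLimit c 2 := by unfold edgeLimit; positivity
    linarith
  -- `β` bounds the quadratic coefficient per index. With `δ = 1/β` the linear gain `2δn` beats the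
  -- quadratic loss `δ²βn = δn`, leaving `-n/β`.
  set β := B ^ (2 * (2 * m)) + K ^ 2 with hβ
  have hβ0 : 0 < β := by positivity
  refine ⟨m, 1 / β, 1 / β, by positivity, by positivity, ?_⟩
  -- A crude bound suffices for the quadratic term: indices reached in `2m` steps are at most `2n`
  -- for large `n`.
  have e1 := (tendsto_jacobiEdge hc 2).eventually (gt_mem_nhds (lt_add_one (edgeLimit c 2)))
  filter_upwards [e1, hsum m, eventually_ge_atTop 1, eventually_ge_atTop (2 * m)] with n h1 h2 hn hn2
  have hn' : (0 : ℝ) < n := by exact_mod_cast hn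
  have hμn := (hμ n hn).le
  set u : ℝ[X] := C (1 / √(n : ℝ)) * Polynomial.X + C R with hu
  have h3 : ∀ k ∈ Finset.range n, hermiteDiag (μ n) (u ^ (2 * (2 * m))) k ≤ B ^ (2 * (2 * m)) := by
    intro k hk
    rw [Finset.mem_range] at hk
    refine (hermiteDiag_pow_le hμn (by positivity) hR0 k (2 * m)).trans ?_
    have h4 : ((k + 2 * m : ℕ) : ℝ) ≤ 2 * n := by
      have : k + 2 * m ≤ 2 * n := by omega
      exact_mod_cast this
    have h5 := (mul_le_mul_of_nonneg_left (jacobiEdge_mono (μ n) h4)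
      (by positivity : 0 ≤ 1 / √(n : ℝ))).trans h1.le
    have h6 := jacobiEdge_nonneg (μ n) ((k + 2 * m : ℕ) : ℝ)
    exact pow_le_pow_left₀ (by positivity) (by rw [hB]; linarith) _
  have h4 : K + 1 ≤ (R + T') ^ (2 * m) / (q * (2 * m + 1)) := by
    rw [le_div_iff₀ (by positivity)]
    exact hm
  have h5 : (n : ℝ) * (K + 1) ≤ ∑ k ∈ Finset.range n, hermiteDiag (μ n) (u ^ (2 * m)) k :=
    (mul_le_mul_of_nonneg_left h4 hn'.le).trans h2
  calc ∑ k ∈ Finset.range n, (hermiteDiag (μ n) (edgeTest (1 / β) R K m n) k - 1)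
      ≤ ∑ k ∈ Finset.range n, (-(2 * (1 / β)) * (hermiteDiag (μ n) (u ^ (2 * m)) k - K)
        + (1 / β) ^ 2 * β) := by
        refine Finset.sum_le_sum fun k hk => (hermiteDiag_edgeTest_le hμn hK0 m n k).trans ?_
        have := h3 k hk
        rw [hβ]
        gcongr
    _ = -(2 * (1 / β)) * (∑ k ∈ Finset.range n, hermiteDiag (μ n) (u ^ (2 * m)) k - n * K)
        + n * (1 / β) := by
        rw [Finset.sum_add_distrib, ← Finset.mul_sum, Finset.sum_sub_distrib]
        simp only [Finset.sum_const, Finset.card_range, nsmul_eq_mul]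
        field_simp
    _ ≤ -(2 * (1 / β)) * n + n * (1 / β) := by
        have h6 : (n : ℝ) ≤ ∑ k ∈ Finset.range n, hermiteDiag (μ n) (u ^ (2 * m)) k - n * K := by
          linarith
        have h7 : 0 < 1 / β := by positivity
        nlinarith
    _ = n * (-(1 / β)) := by ring

/-- On `[-R√n, T√n]` the shifted variable `s/√n + R` lies in `[0, T + R]`, so its power is at most
`K` and the base of the square is at least 1. The shift is what lets an even power tell the right
edge from the left. -/
theorem one_le_prod_edgeTest {n m : ℕ} {δ R T : ℝ} (hn : 1 ≤ n) (hδ : 0 < δ)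
    {l : Fin n → ℝ} (h : ∀ i, l i ≤ T * √(n : ℝ)) (h' : ∀ i, -(R * √(n : ℝ)) ≤ l i) :
    1 ≤ ∏ i, (edgeTest δ R ((T + R) ^ (2 * m)) m n).eval (l i) := by
  have hs : 0 < √(n : ℝ) := Real.sqrt_pos.2 (by exact_mod_cast hn)
  refine one_le_prod_of_one_le fun i _ => ?_
  rw [eval_edgeTest]
  refine one_le_pow₀ ?_
  have h1 : 1 / √(n : ℝ) * l i ≤ T := by
    rw [one_div, inv_mul_le_iff₀ hs, mul_comm]; exact h i
  have h2 : -R ≤ 1 / √(n : ℝ) * l i := by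
    rw [one_div, le_inv_mul_iff₀ hs]
    have := h' i
    linarith
  have h3 : (1 / √(n : ℝ) * l i + R) ^ (2 * m) ≤ (T + R) ^ (2 * m) :=
    pow_le_pow_left₀ (by linarith) (by linarith) _
  nlinarith

/-- Almost surely, there are eventually eigenvalues on both sides beyond any interval smaller than
the limiting one. -/
theorem ae_eventually_exists_eigs (hμ : ∀ n, 1 ≤ n → 0 < μ n)
    (hc : Tendsto (fun n : ℕ => μ n / (n : ℝ)) atTop (𝓝 c))
    (hX : ∀ n, 1 ≤ n → HasLaw (X n) (Herm.ensemble n (μ n)) P) {T : ℝ} (hT0 : 0 ≤ T)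
    (hT : T < edgeLimit c 1) :
    ∀ᵐ ω ∂P, ∀ᶠ n : ℕ in atTop, (∃ i, T * √(n : ℝ) < (X n ω).eigs i) ∧
      ∃ i, (X n ω).eigs i < -(T * √(n : ℝ)) := by
  -- By the outer bound all eigenvalues eventually lie in `(-R√n, R√n)`, as the test product
  -- requires.
  set R := edgeLimit c 1 + 1 with hR
  obtain ⟨m, δ, κ, hδ, hκ, hS⟩ := exists_edgeTest (R := R) hμ hc (by linarith) hT0 hT
  set g := edgeTest δ R ((T + R) ^ (2 * m)) m with hg
  have hv : Summable fun n : ℕ => Real.exp (n * (-κ)) :=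
    Real.summable_exp_nat_mul_iff.2 (by linarith)
  have hgn : ∀ (n : ℕ) (s : ℝ), 0 ≤ (g n).eval s := by
    intro n s
    rw [hg, eval_edgeTest]
    exact sq_nonneg _
  have k1 := ae_eventually_prod_eval_lt (P := P) hμ hX (g := g) (t := fun _ => 1) hgn
    (fun _ => one_pos) hv (by
      filter_upwards [hS] with n hn
      rw [div_one]
      exact Real.exp_le_exp.2 hn)
  have k2 := ae_eventually_prod_eval_lt (P := P) hμ hX (g := fun n => (g n).comp (-Polynomial.X))
    (t := fun _ => 1) (fun n s => by rw [eval_comp]; exact hgn n _)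
    (fun _ => one_pos) hv (by
      filter_upwards [hS] with n hn
      simp only [hermiteDiag_comp_neg]
      rw [div_one]
      exact Real.exp_le_exp.2 hn)
  have k3 := ae_eventually_abs_eigs_lt (P := P) hμ hc hX (lt_add_one (edgeLimit c 1))
  filter_upwards [k1, k2, k3] with ω h1 h2 h3
  filter_upwards [h1, h2, h3, eventually_ge_atTop 1] with n h1 h2 h3 hn
  constructor
  · by_contra! hcon
    exact absurd h1 (not_lt.2 (one_le_prod_edgeTest hn hδ hcon fun i => (abs_lt.1 (h3 i)).1.le))
  · by_contra! hcon
    refine absurd h2 (not_lt.2 ?_)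
    simp only [eval_comp, eval_neg, eval_X]
    exact one_le_prod_edgeTest (l := fun i => -(X n ω).eigs i) hn hδ
      (fun i => by linarith [hcon i]) fun i => by linarith [(abs_lt.1 (h3 i)).2]

end Tails

/-! ### Almost sure convergence of the extreme eigenvalues -/

theorem proposition3p1 {Ω : Type*} [MeasurableSpace Ω] (P : Measure Ω) [IsProbabilityMeasure P]
    (X : (n : ℕ) → Ω → Herm n) (μ : ℕ → ℝ) (c : ℝ)
    (hμ : ∀ n, 1 ≤ n → 0 < μ n)
    (hc : Tendsto (fun n : ℕ => μ n / (n : ℝ)) atTop (𝓝 c))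
    (hX : ∀ n, 1 ≤ n → HasLaw (X n) (Herm.ensemble n (μ n)) P) :
    (∀ᵐ ω ∂P, Tendsto (fun n : ℕ => (X n ω).lambdaMax / √(n : ℝ)) atTop
      (𝓝 (√(1 + c + √(1 + 2 * c))))) ∧
    (∀ᵐ ω ∂P, Tendsto (fun n : ℕ => (X n ω).lambdaMin / √(n : ℝ)) atTop
      (𝓝 (-√(1 + c + √(1 + 2 * c))))) := by
  have hc0 : 0 ≤ c := by
    refine ge_of_tendsto hc ?_
    filter_upwards [eventually_ge_atTop 1] with n hn
    exact div_nonneg (hμ n hn).le (Nat.cast_nonneg n)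
  rw [← edgeLimit_one hc0]
  set b := edgeLimit c 1 with hb
  have hbpos : 0 < b := by rw [hb, edgeLimit]; positivity
  -- The margins `1 / (j + 1)` are countable, so a single null set serves for all of them and hence
  -- for every `ε`.
  have hup : ∀ᵐ ω ∂P, ∀ j : ℕ, ∀ᶠ n : ℕ in atTop, ∀ i,
      |(X n ω).eigs i| < (b + 1 / ((j : ℝ) + 1)) * √(n : ℝ) :=
    ae_all_iff.2 fun j => ae_eventually_abs_eigs_lt hμ hc hX
      (by rw [← hb]; exact lt_add_of_pos_right b (by positivity))
  -- The maximum with 0 is there because the inner bound requires a nonnegative threshold; it stays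
  -- below `b` since `b > 0`.
  have hlo : ∀ᵐ ω ∂P, ∀ j : ℕ, ∀ᶠ n : ℕ in atTop,
      (∃ i, max 0 (b - 1 / ((j : ℝ) + 1)) * √(n : ℝ) < (X n ω).eigs i) ∧
      ∃ i, (X n ω).eigs i < -(max 0 (b - 1 / ((j : ℝ) + 1)) * √(n : ℝ)) :=
    ae_all_iff.2 fun j => ae_eventually_exists_eigs hμ hc hX (le_max_left _ _) (by
      rw [← hb]
      exact max_lt hbpos (sub_lt_self b (by positivity)))
  have hmain : ∀ᵐ ω ∂P, ∀ ε : ℝ, 0 < ε → ∀ᶠ n : ℕ in atTop,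
      |(X n ω).lambdaMax / √(n : ℝ) - b| < ε ∧ |(X n ω).lambdaMin / √(n : ℝ) - -b| < ε := by
    filter_upwards [hup, hlo] with ω h1 h2 ε hε
    obtain ⟨j, hj⟩ := exists_nat_one_div_lt hε
    filter_upwards [h1 j, h2 j, eventually_ge_atTop 1] with n a1 a2 hn
    have hs : 0 < √(n : ℝ) := Real.sqrt_pos.2 (by exact_mod_cast hn)
    have : Nonempty (Fin n) := ⟨⟨0, hn⟩⟩
    have hlow : b - ε < max 0 (b - 1 / ((j : ℝ) + 1)) :=
      lt_max_of_lt_right (by linarith)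
    have hl := mul_lt_mul_of_pos_right hlow hs
    have hu : (b + 1 / ((j : ℝ) + 1)) * √(n : ℝ) < (b + ε) * √(n : ℝ) :=
      mul_lt_mul_of_pos_right (by linarith) hs
    obtain ⟨⟨i1, hi1⟩, ⟨i2, hi2⟩⟩ := a2
    obtain ⟨k1, hk1⟩ := exists_eq_ciSup_of_finite (f := (X n ω).isHermitian.eigenvalues)
    obtain ⟨k2, hk2⟩ := exists_eq_ciInf_of_finite (f := (X n ω).isHermitian.eigenvalues)
    have hmax : (X n ω).lambdaMax = (X n ω).eigs k1 := hk1.symm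
    have hmin : (X n ω).lambdaMin = (X n ω).eigs k2 := hk2.symm
    have hge : (X n ω).eigs i1 ≤ (X n ω).lambdaMax :=
      le_ciSup (Set.finite_range (X n ω).isHermitian.eigenvalues).bddAbove i1
    have hle : (X n ω).lambdaMin ≤ (X n ω).eigs i2 :=
      ciInf_le (Set.finite_range (X n ω).isHermitian.eigenvalues).bddBelow i2
    have b1 := abs_lt.1 (a1 k1)
    have b2 := abs_lt.1 (a1 k2)
    rw [← hmax] at b1
    rw [← hmin] at b2
    constructor
    · rw [abs_sub_lt_iff, sub_lt_iff_lt_add, sub_lt_comm, div_lt_iff₀ hs, lt_div_iff₀ hs]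
      constructor <;> linarith
    · rw [abs_sub_lt_iff, sub_lt_iff_lt_add, sub_lt_comm, div_lt_iff₀ hs, lt_div_iff₀ hs]
      constructor <;> linarith
  constructor
  · filter_upwards [hmain] with ω h
    exact Metric.tendsto_nhds.2 fun ε hε => (h ε hε).mono fun n hn => by
      rw [Real.dist_eq]; exact hn.1
  · filter_upwards [hmain] with ω h
    exact Metric.tendsto_nhds.2 fun ε hε => (h ε hε).mono fun n hn => by
      rw [Real.dist_eq]; exact hn.2
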